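/- Monoids $M$ are commutative, sharp, finitely generated, integral and saturated; they are dual to rational polyhedral cones with integral structure, $M \leftrightarrow M^\vee = \mathrm{Hom}(M,\mathbb{R}_{\ge 0})$, and $x \le y$ in $M^{\mathrm{gp}}$ means $y-x\in M$. A tropical curve $\Gamma$ metrized by $M$ is a finite connected graph (loops and multiple edges allowed) with ordered legs and a length $\ell_e\in M\setminus 0$ for each edge $e$. A piecewise linear function on it is a map $\alpha: V(\Gamma)\to M^{\mathrm{gp}}$ such that for each oriented edge $\vec e$ from $v$ to $w$ one has $\alpha(w)-\alpha(v)=s(\vec e)\,\ell_e$ with $s(\vec e)\in\mathbb{Z}$; we require $\alpha=0$ at the vertex carrying the first leg. A tropical line $X$ is a finite strictly increasing sequence of points of $M^{\mathrm{gp}}$, regarded as a subdivision of $\mathbb{R}$. Fix $n\ge 1$; all curves have $n$ legs unless another number is indicated. Consider the following moduli problems over the category of monoids, in which curves are pulled back along $M\to N$ by contracting the edges whose length becomes $0$. * $\Sigma_{\mathbf{Div}_n}(M)$: pairs $(\Gamma,\alpha)$. * $\Sigma_{\mathbf{Ord}_n}(M)$: pairs $(\Gamma,\alpha)$ such that the values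 $\alpha(v)$ are totally ordered in $M^{\mathrm{gp}}$. * $\Sigma_{\mathbf{Rub}_n}(M)$: triples $(\Gamma,\alpha,\Gamma'\to X)$, where $\Gamma'\to\Gamma$ is a subdivision metrized by $M$, $X$ is a tropical line, and $\Gamma'\to X$ is a lift of $\alpha$ that takes vertices to vertices and edges into cells and is stable (minimal): every vertex of $X$ is the image of a vertex of $\Gamma$, and edges of $\Gamma$ of slope $0$ are not subdivided. The universal family of $\Sigma_{\mathbf{Rub}_n}$ is the moduli problem whose objects over $M$ are the objects $(\Gamma,\alpha,\Gamma'\to X)$ of $\Sigma_{\mathbf{Rub}_n}(M)$ together with a point $p$ of $\Gamma'$ over $M$, i.e. either a vertex of $\Gamma'$ or an edge $e$ of $\Gamma'$ with a decomposition $\ell_e=a+b$, where $a,b\in M\setminus 0$ are the distances from $p$ to the endpoints of $e$. A cone stack is a diagram of cones and face inclusions that is fibered in groupoids over the category of cones and face inclusions; it represents a moduli problem if the latter is equivalent to the functor of points of its colimit. **Lemma.** (1) The universal family of $\Sigma_{\mathbf{Rub}_n}$ is represented by a simplicial cone stack, i.e. by a cone stack each of whose cones is generated by linearly independent vectors. (2)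 For each object $(\Gamma,\alpha,\Gamma'\to X,p)$ of the universal family over $M$, let $\Gamma'_p$ be the curve obtained from $\Gamma'$ by subdividing at $p$, if $p$ is not a vertex, and attaching a leg with number $n+1$ at $p$. It exists and is metrized by $M$, it carries the lift of $\alpha$, and the values of the lift at the vertices of $\Gamma'_p$ are totally ordered. So the map $(\Gamma,\alpha,\Gamma'\to X,p)\mapsto(\Gamma'_p,\alpha)$ from the universal family to $\Sigma_{\mathbf{Div}_{n+1}}$ factors through $\Sigma_{\mathbf{Ord}_{n+1}}$. (3) This map does not factor through $\Sigma_{\mathbf{Rub}_{n+1}}\to\Sigma_{\mathbf{Div}_{n+1}}$: for each $n \ge 1$ there are a monoid $M$ and an object of the universal family over $M$ such that $(\Gamma'_p,\alpha)$ is not isomorphic to the image of any object of $\Sigma_{\mathbf{Rub}_{n+1}}(M)$. -/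

import Mathlib

open CategoryTheory

namespace TropRub

/-! ### Monoids and cones -/

/-- The group `M^gp` associated to a commutative monoid `M`. -/
abbrev Gp (M : Type) [AddCommMonoid M] : Type := Algebra.GrothendieckAddGroup M

/-- The canonical map `M → M^gp`. -/
abbrev toGp {M : Type} [AddCommMonoid M] : M →+ Gp M := Algebra.GrothendieckAddGroup.of

/-- The map `M^gp → N^gp` induced by `g : M → N`. -/
noncomputable def gpMap {M N : Type} [AddCommMonoid M] [AddCommMonoid N] (g : M →+ N) :
    Gp M →+ Gp N :=
  Algebra.GrothendieckAddGroup.lift (toGp.comp g)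

/-- The partial order on `M^gp` defined by `M`: `x ≤ y` means `y - x ∈ M`. -/
def GpLE {M : Type} [AddCommMonoid M] (x y : Gp M) : Prop := ∃ m : M, y - x = toGp m

lemma gpMap_toGp {M N : Type} [AddCommMonoid M] [AddCommMonoid N] (g : M →+ N) (m : M) :
    gpMap g (toGp m) = toGp (g m) :=
  DFunLike.congr_fun (Algebra.GrothendieckAddGroup.lift.symm_apply_apply (toGp.comp g)) m

lemma gp_hom_ext {M A : Type} [AddCommMonoid M] [AddCommGroup A] {f f' : Gp M →+ A}
    (h : ∀ m, f (toGp m) = f' (toGp m)) : f = f' :=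
  Algebra.GrothendieckAddGroup.lift.symm.injective (AddMonoidHom.ext h)

lemma gpMap_id {M : Type} [AddCommMonoid M] (x : Gp M) : gpMap (AddMonoidHom.id M) x = x :=
  DFunLike.congr_fun (gp_hom_ext (f := gpMap (AddMonoidHom.id M)) (f' := AddMonoidHom.id _)
    fun m => gpMap_toGp _ m) x

lemma gpMap_comp {M N P : Type} [AddCommMonoid M] [AddCommMonoid N] [AddCommMonoid P]
    (g : M →+ N) (h : N →+ P) (x : Gp M) : gpMap (h.comp g) x = gpMap h (gpMap g x) :=
  DFunLike.congr_fun (gp_hom_ext (f := gpMap (h.comp g)) (f' := (gpMap h).comp (gpMap g))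
    fun m => by
      rw [AddMonoidHom.comp_apply, gpMap_toGp, gpMap_toGp, gpMap_toGp, AddMonoidHom.comp_apply]) x

/-- A sharp, finitely generated, integral and saturated commutative monoid. -/
structure FSMon : Type 1 where
  carrier : Type
  [inst : AddCommMonoid carrier]
  sharp : ∀ a b : carrier, a + b = 0 → a = 0
  fg : AddMonoid.FG carrier
  integral : IsCancelAdd carrier
  saturated : ∀ (k : ℕ) (x : Gp carrier), 0 < k →
    (∃ m : carrier, k • x = toGp m) → ∃ m : carrier, x = toGp m

instance : CoeSort FSMon Type := ⟨FSMon.carrier⟩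

instance (M : FSMon) : AddCommMonoid M := M.inst

/-- The category of monoids; it is dual to the category of rational polyhedral cones with integral
structure, `M` corresponding to the cone `M^∨`. -/
instance : Category FSMon where
  Hom M N := M →+ N
  id M := AddMonoidHom.id M
  comp f g := AddMonoidHom.comp g f

/-- The rational polyhedral cone `M^∨ = Hom(M, ℝ_{≥0})` in the real vector space `Hom(M, ℝ)`. -/
def dualCone (M : FSMon) : PointedCone ℝ (M →+ ℝ) where
  carrier := {f | ∀ m, 0 ≤ f m}
  add_mem' hf hg m := add_nonneg (hf m) (hg m)
  zero_mem' _ := le_rfl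
  smul_mem' c _ hf m := mul_nonneg c.2 (hf m)

/-- `g : M → N` is dual to the inclusion of a face: `N` is the quotient of `M` by the face
`{m | g m = 0}`. -/
def IsFaceMap {M N : FSMon} (g : M ⟶ N) : Prop :=
  Function.Surjective (show M →+ N from g) ∧
    ∀ a b : M, (show M →+ N from g) a = (show M →+ N from g) b →
      ∃ x y : M, (show M →+ N from g) x = 0 ∧ (show M →+ N from g) y = 0 ∧ a + x = b + y

/-- `g : M → N` is local: dually, the map of cones `N^∨ → M^∨` does not factor through a proper
face of `M^∨`. -/
def IsLocal {M N : FSMon} (g : M ⟶ N) : Prop :=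
  ∀ m : M, (show M →+ N from g) m = 0 → m = 0

/-! ### Cone stacks -/

/-- A (combinatorial) cone stack: a diagram of cones and face inclusions, which is fibered in
groupoids over the category of cones and face inclusions. It is written in terms of the monoids dual
to the cones, so an arrow `d ⟶ d'` stands for the inclusion of the cone of `d'` as a face of the
cone of `d`. -/
structure ConeStack where
  Idx : Type 1
  [cat : Category.{0} Idx]
  cone : Idx ⥤ FSMon
  isFaceMap : ∀ {d d' : Idx} (e : d ⟶ d'), IsFaceMap (cone.map e)
  exists_face : ∀ (d : Idx) (N : FSMon) (f : cone.obj d ⟶ N), IsFaceMap f →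
    ∃ (d' : Idx) (e : d ⟶ d') (i : cone.obj d' ≅ N), cone.map e ≫ i.hom = f
  cartesian : ∀ {d d₁ d₂ : Idx} (e₁ : d ⟶ d₁) (e₂ : d ⟶ d₂) (h : cone.obj d₁ ⟶ cone.obj d₂),
    cone.map e₁ ≫ h = cone.map e₂ → ∃! e : d₁ ⟶ d₂, cone.map e = h ∧ e₁ ≫ e = e₂

attribute [instance] ConeStack.cat

/-- The functor of points of the colimit of the cones of `S`, as a category over `FSMon`. A map from
the cone `M^∨` to the colimit lands in the relative interior of exactly one cone, so it is a pair
`(d, f)` of an index `d` and a local homomorphism `f` from the monoid of `d` to `M`. Morphisms are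
the arrows of the diagram that commute with the given maps. -/
abbrev ConeStack.Points (S : ConeStack) : Type 1 :=
  ObjectProperty.FullSubcategory (fun x : Comma S.cone (𝟭 FSMon) =>
    IsLocal (M := S.cone.obj x.left) (N := x.right) x.hom)

/-- The monoid over which a point lives. -/
abbrev ConeStack.pointsProj (S : ConeStack) : S.Points ⥤ FSMon :=
  ObjectProperty.ι _ ⋙ Comma.snd S.cone (𝟭 FSMon)

/-- The cone stack `S` represents the moduli problem `p : 𝓕 ⥤ FSMon`, a category over `FSMon` whose
fiber over `M` is the groupoid of objects of the moduli problem over `M`. -/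
def ConeStack.Represents (S : ConeStack) {𝓕 : Type 1} [Category.{0} 𝓕] (p : 𝓕 ⥤ FSMon) : Prop :=
  ∃ e : S.Points ≌ 𝓕, Nonempty (e.functor ⋙ p ≅ S.pointsProj)

/-- A cone stack is simplicial if each of its cones is simplicial. -/
def ConeStack.IsSimplicial (S : ConeStack) : Prop :=
  ∀ d : S.Idx, (dualCone (S.cone.obj d)).IsSimplicial

/-! ### Tropical curves and piecewise linear functions -/

/-- A tropical curve metrized by `M` with `n` legs: a finite connected graph, possibly with loops
and multiple edges, presented by its vertices `V` and its oriented edges `D` with the orientation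
reversal `rev`, and a length in `M - 0` for each edge. -/
structure TropCurve (M : Type) [AddCommMonoid M] (n : ℕ) where
  V : Type
  D : Type
  [finV : Finite V]
  [finD : Finite D]
  src : D → V
  rev : D → D
  rev_rev : ∀ d, rev (rev d) = d
  rev_ne : ∀ d, rev d ≠ d
  connected : ∀ v w, Relation.ReflTransGen (fun a b => ∃ d, src d = a ∧ src (rev d) = b) v w
  leg : Fin n → V
  len : D → M
  len_rev : ∀ d, len (rev d) = len d
  len_ne : ∀ d, len d ≠ 0

namespace TropCurve

variable {M : Type} [AddCommMonoid M] {n : ℕ}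

/-- The endpoint of an oriented edge. -/
def tgt (Γ : TropCurve M n) (d : Γ.D) : Γ.V := Γ.src (Γ.rev d)

/-- `α` is a piecewise linear function: it has an integral slope on each oriented edge. -/
def IsPL (Γ : TropCurve M n) (α : Γ.V → Gp M) : Prop :=
  ∀ d, ∃ s : ℤ, α (Γ.tgt d) - α (Γ.src d) = s • toGp (Γ.len d)

/-- `l` is an edge path from `u` to `w`. -/
def IsPath (Γ : TropCurve M n) : Γ.V → List Γ.D → Γ.V → Prop
  | u, [], w => u = w
  | u, d :: l, w => Γ.src d = u ∧ Γ.IsPath (Γ.tgt d) l w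

/-- Forget the last leg. -/
def forgetLeg (Γ : TropCurve M (n + 1)) : TropCurve M n where
  V := Γ.V
  D := Γ.D
  finV := Γ.finV
  finD := Γ.finD
  src := Γ.src
  rev := Γ.rev
  rev_rev := Γ.rev_rev
  rev_ne := Γ.rev_ne
  connected := Γ.connected
  leg i := Γ.leg i.castSucc
  len := Γ.len
  len_rev := Γ.len_rev
  len_ne := Γ.len_ne

end TropCurve

/-- A subdivision `Γ' → Γ`: the vertices of `Γ` are vertices of `Γ'`, each oriented edge of `Γ` is
an edge path of `Γ'` of the same total length, each oriented edge of `Γ'` occurs exactly once in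
exactly one of these paths, and the other vertices of `Γ'` (the exceptional ones) are bivalent
interior vertices of these paths without legs. -/
structure Subdivision {M : Type} [AddCommMonoid M] {n : ℕ} (Γ' Γ : TropCurve M n) where
  vtx : Γ.V → Γ'.V
  vtx_inj : Function.Injective vtx
  path : Γ.D → List Γ'.D
  path_isPath : ∀ d, Γ'.IsPath (vtx (Γ.src d)) (path d) (vtx (Γ.tgt d))
  path_rev : ∀ d, path (Γ.rev d) = ((path d).map Γ'.rev).reverse
  path_nodup : ∀ d, (path d).Nodup
  cover : ∀ d', ∃! d, d' ∈ path d
  interior : ∀ d, ∀ d' ∈ (path d).tail, Γ'.src d' ∉ Set.range vtx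
  bivalent : ∀ x, x ∉ Set.range vtx → {d' | Γ'.src d' = x}.ncard = 2
  leg : ∀ i, vtx (Γ.leg i) = Γ'.leg i
  len_sum : ∀ d, ((path d).map Γ'.len).sum = Γ.len d

/-- `α'` is the lift of the piecewise linear function `α` along a subdivision: it has the same
values at the old vertices and the same slopes. -/
def Subdivision.IsLift {M : Type} [AddCommMonoid M] {n : ℕ} {Γ' Γ : TropCurve M n}
    (σ : Subdivision Γ' Γ) (α : Γ.V → Gp M) (α' : Γ'.V → Gp M) : Prop :=
  (∀ v, α' (σ.vtx v) = α v) ∧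
    ∀ (d : Γ.D) (s : ℤ), α (Γ.tgt d) - α (Γ.src d) = s • toGp (Γ.len d) →
      ∀ d' ∈ σ.path d, α' (Γ'.tgt d') - α' (Γ'.src d') = s • toGp (Γ'.len d')

/-- A tropical line metrized by `M`, with vertices `0, …, k` embedded by `pos`. -/
structure TropLine (M : Type) [AddCommMonoid M] where
  k : ℕ
  pos : Fin (k + 1) → Gp M
  len : Fin k → M
  len_ne : ∀ i, len i ≠ 0
  pos_succ : ∀ i : Fin k, pos i.succ - pos i.castSucc = toGp (len i)

/-! ### The moduli problems `Div`, `Ord` and `Rub` -/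

/-- An object of `Σ_Div` over `M`, with `n` legs. -/
structure DivPt (M : Type) [AddCommMonoid M] (n : ℕ) [NeZero n] where
  curve : TropCurve M n
  α : curve.V → Gp M
  isPL : curve.IsPL α
  normalized : α (curve.leg 0) = 0

/-- An object of `Σ_Ord` over `M`, with `n` legs: the values of `α` are totally ordered. -/
structure OrdPt (M : Type) [AddCommMonoid M] (n : ℕ) [NeZero n] extends DivPt M n where
  ordered : ∀ v w, GpLE (α v) (α w) ∨ GpLE (α w) (α v)

/-- An object of `Σ_Rub` over `M`, with `n` legs: a stable lift of `α` to an equidimensional map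
`β` from a subdivision `eqd` of the curve to a tropical line. The map `β` takes vertices to vertices
and edges into cells. It is stable, i.e. minimal: all vertices of the line are images of vertices of
the original curve, and contracted edges are not subdivided. -/
structure RubPt (M : Type) [AddCommMonoid M] (n : ℕ) [NeZero n] extends DivPt M n where
  eqd : TropCurve M n
  sub : Subdivision eqd curve
  line : TropLine M
  β : eqd.V → Fin (line.k + 1)
  β_edge : ∀ d, (β (eqd.tgt d) : ℕ) ≤ β (eqd.src d) + 1
  isLift : sub.IsLift α (fun x => line.pos (β x))
  stable_line : ∀ i, ∃ v, β (sub.vtx v) = i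
  stable_edge : ∀ d, α (curve.tgt d) = α (curve.src d) → (sub.path d).length = 1

/-! ### Morphisms -/

/-- For `g : M → N`, the data identifying `Δ` with the tropical curve over `N` obtained from `Γ` by
applying `g` to the lengths and contracting the edges whose length becomes zero. For `g = id` this
is an isomorphism of tropical curves. -/
@[ext]
structure Contraction {M N : Type} [AddCommMonoid M] [AddCommMonoid N] {n : ℕ} (g : M →+ N)
    (Γ : TropCurve M n) (Δ : TropCurve N n) where
  vtx : Γ.V → Δ.V
  dart : Δ.D → Γ.D
  dart_inj : Function.Injective dart
  dart_range : ∀ d, (∃ e, dart e = d) ↔ g (Γ.len d) ≠ 0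
  dart_rev : ∀ e, dart (Δ.rev e) = Γ.rev (dart e)
  dart_src : ∀ e, vtx (Γ.src (dart e)) = Δ.src e
  dart_len : ∀ e, Δ.len e = g (Γ.len (dart e))
  vtx_leg : ∀ i, vtx (Γ.leg i) = Δ.leg i
  vtx_surj : Function.Surjective vtx
  vtx_eq_iff : ∀ v w, vtx v = vtx w ↔
    Relation.ReflTransGen (fun a b => ∃ d, g (Γ.len d) = 0 ∧ Γ.src d = a ∧ Γ.tgt d = b) v w

namespace Contraction

/-- The identity contraction. -/
def id {M : Type} [AddCommMonoid M] {n : ℕ} (Γ : TropCurve M n) :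
    Contraction (AddMonoidHom.id M) Γ Γ where
  vtx := fun v => v
  dart := fun d => d
  dart_inj := fun _ _ h => h
  dart_range d := ⟨fun _ => Γ.len_ne d, fun _ => ⟨d, rfl⟩⟩
  dart_rev _ := rfl
  dart_src _ := rfl
  dart_len _ := rfl
  vtx_leg _ := rfl
  vtx_surj := fun v => ⟨v, rfl⟩
  vtx_eq_iff v w := by
    constructor
    · rintro rfl
      exact .refl
    · intro h
      induction h with
      | refl => rfl
      | tail _ h _ =>
        obtain ⟨d, hd, _⟩ := h
        exact absurd hd (Γ.len_ne d)

variable {M N P : Type} [AddCommMonoid M] [AddCommMonoid N] [AddCommMonoid P] {n : ℕ}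
  {g : M →+ N} {h : N →+ P} {Γ : TropCurve M n} {Δ : TropCurve N n} {Θ : TropCurve P n}

lemma dart_tgt (c : Contraction g Γ Δ) (e : Δ.D) : c.vtx (Γ.tgt (c.dart e)) = Δ.tgt e := by
  rw [TropCurve.tgt, TropCurve.tgt, ← c.dart_rev, c.dart_src]

lemma contracted (c : Contraction g Γ Δ) {d : Γ.D} (hd : g (Γ.len d) = 0) :
    c.vtx (Γ.src d) = c.vtx (Γ.tgt d) :=
  (c.vtx_eq_iff _ _).2 (.single ⟨d, hd, rfl, rfl⟩)

/-- Composition of contractions. -/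
def comp (c : Contraction g Γ Δ) (c' : Contraction h Δ Θ) : Contraction (h.comp g) Γ Θ where
  vtx v := c'.vtx (c.vtx v)
  dart e := c.dart (c'.dart e)
  dart_inj := c.dart_inj.comp c'.dart_inj
  dart_range d := by
    constructor
    · rintro ⟨e, rfl⟩
      have := (c'.dart_range _).1 ⟨e, rfl⟩
      rwa [c.dart_len] at this
    · intro hd
      obtain ⟨e, rfl⟩ := (c.dart_range d).2 fun h0 => hd (by simp [h0])
      obtain ⟨e', rfl⟩ := (c'.dart_range e).2 (by rw [c.dart_len]; exact hd)
      exact ⟨e', rfl⟩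
  dart_rev e := by rw [c'.dart_rev, c.dart_rev]
  dart_src e := by rw [c.dart_src, c'.dart_src]
  dart_len e := by rw [c'.dart_len, c.dart_len]; rfl
  vtx_leg i := by rw [c.vtx_leg, c'.vtx_leg]
  vtx_surj := c'.vtx_surj.comp c.vtx_surj
  vtx_eq_iff v w := by
    have mono : ∀ a b, c.vtx a = c.vtx b → Relation.ReflTransGen
        (fun a b => ∃ d, (h.comp g) (Γ.len d) = 0 ∧ Γ.src d = a ∧ Γ.tgt d = b) a b := by
      intro a b hab
      refine ((c.vtx_eq_iff a b).1 hab).lift (fun x => x) ?_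
      rintro _ _ ⟨d, hd, h1, h2⟩
      exact ⟨d, by simp [hd], h1, h2⟩
    constructor
    · intro hvw
      have key : ∀ y, Relation.ReflTransGen
          (fun a b => ∃ d, h (Δ.len d) = 0 ∧ Δ.src d = a ∧ Δ.tgt d = b) (c.vtx v) y →
          ∀ b, c.vtx b = y → Relation.ReflTransGen
            (fun a b => ∃ d, (h.comp g) (Γ.len d) = 0 ∧ Γ.src d = a ∧ Γ.tgt d = b) v b := by
        intro y hy
        induction hy with
        | refl => exact fun b hb => mono v b hb.symm
        | tail _ hs ih =>
          obtain ⟨e, he, h1, h2⟩ := hs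
          intro b hb
          have hstep := ih (Γ.src (c.dart e)) (by rw [c.dart_src, h1])
          refine (hstep.tail ⟨c.dart e, ?_, rfl, rfl⟩).trans (mono _ b ?_)
          · rw [AddMonoidHom.comp_apply, ← c.dart_len, he]
          · rw [c.dart_tgt, h2, hb]
      exact key _ ((c'.vtx_eq_iff _ _).1 hvw) w rfl
    · intro hvw
      induction hvw with
      | refl => rfl
      | tail _ hs ih =>
        obtain ⟨d, hd, rfl, rfl⟩ := hs
        rw [ih]
        by_cases h0 : g (Γ.len d) = 0
        · rw [c.contracted h0]
        · obtain ⟨e, rfl⟩ := (c.dart_range d).2 h0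
          rw [c.dart_src, c.dart_tgt]
          exact c'.contracted (by rw [c.dart_len]; exact hd)

end Contraction

/-- A morphism over `g` in `Σ_Div`; for `g = id` it is an isomorphism that respects `α`. -/
structure DivHom {M N : Type} [AddCommMonoid M] [AddCommMonoid N] {n : ℕ} [NeZero n] (g : M →+ N)
    (ξ : DivPt M n) (η : DivPt N n) extends Contraction g ξ.curve η.curve where
  map_α : ∀ v, η.α (vtx v) = gpMap g (ξ.α v)

/-- An object of `Σ_Rub`, the monoid being part of the data. -/
structure Rub (n : ℕ) [NeZero n] : Type 1 where
  base : FSMon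
  pt : RubPt base n

/-- A morphism of `Σ_Rub`: it lies over a homomorphism of monoids and identifies the target with the
base change of the source. Over the identity it is an isomorphism of the curves that respects the
functions, the subdivisions, and the maps to the line. -/
@[ext]
structure RubHom {n : ℕ} [NeZero n] (ξ η : Rub n) where
  base : ξ.base →+ η.base
  con : Contraction base ξ.pt.curve η.pt.curve
  eqd : Contraction base ξ.pt.eqd η.pt.eqd
  map_α : ∀ v, η.pt.α (con.vtx v) = gpMap base (ξ.pt.α v)
  map_vtx : ∀ v, eqd.vtx (ξ.pt.sub.vtx v) = η.pt.sub.vtx (con.vtx v)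
  map_path : ∀ e, ((η.pt.sub.path e).map eqd.dart).Sublist (ξ.pt.sub.path (con.dart e))
  map_line : Set.range η.pt.line.pos = gpMap base '' Set.range ξ.pt.line.pos
  map_β : ∀ x, η.pt.line.pos (η.pt.β (eqd.vtx x)) = gpMap base (ξ.pt.line.pos (ξ.pt.β x))

/-- `Σ_Rub` (with `n` legs) as a category over `FSMon`. -/
instance {n : ℕ} [NeZero n] : Category (Rub n) where
  Hom := RubHom
  id ξ :=
    { base := AddMonoidHom.id _
      con := Contraction.id _
      eqd := Contraction.id _
      map_α := fun v => (gpMap_id _).symm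
      map_vtx := fun _ => rfl
      map_path := fun e => by simp [Contraction.id]
      map_line := by
        ext x
        simp [gpMap_id]
      map_β := fun x => (gpMap_id _).symm }
  comp a b :=
    { base := b.base.comp a.base
      con := a.con.comp b.con
      eqd := a.eqd.comp b.eqd
      map_α := fun v => by
        rw [gpMap_comp, ← a.map_α, ← b.map_α]
        rfl
      map_vtx := fun v => by
        change b.eqd.vtx (a.eqd.vtx _) = _
        rw [a.map_vtx, b.map_vtx]
        rfl
      map_path := fun e => by
        have h1 := (b.map_path e).map a.eqd.dart
        rw [List.map_map] at h1
        exact h1.trans (a.map_path (b.con.dart e))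
      map_line := by
        rw [b.map_line, a.map_line, Set.image_image]
        simp only [gpMap_comp]
      map_β := fun x => by
        rw [gpMap_comp, ← a.map_β, ← b.map_β]
        rfl }

/-! ### The universal family -/

/-- A point of a tropical curve metrized by `M` (a section of the curve over `M^∨`): either a
vertex, or a point in the interior of an edge `d`, at distance `a` from the source of `d` and at
distance `b` from its target. -/
inductive Point {M : Type} [AddCommMonoid M] {n : ℕ} (Γ : TropCurve M n) : Type
  | vertex (v : Γ.V) : Point Γ
  | edge (d : Γ.D) (a b : M) (ha : a ≠ 0) (hb : b ≠ 0) (hab : a + b = Γ.len d) : Point Γ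

/-- `p.MapsTo c q`: the base change of the point `p` along the contraction `c` is the point `q`. The
points `(d, a, b)` and `(rev d, b, a)` are the same. -/
inductive Point.MapsTo {M N : Type} [AddCommMonoid M] [AddCommMonoid N] {n : ℕ} {g : M →+ N}
    {Γ : TropCurve M n} {Δ : TropCurve N n} (c : Contraction g Γ Δ) : Point Γ → Point Δ → Prop
  | vertex (v : Γ.V) : MapsTo c (.vertex v) (.vertex (c.vtx v))
  | source (d : Γ.D) (a b : M) (ha : a ≠ 0) (hb : b ≠ 0) (hab : a + b = Γ.len d) (h : g a = 0) :
      MapsTo c (.edge d a b ha hb hab) (.vertex (c.vtx (Γ.src d)))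
  | target (d : Γ.D) (a b : M) (ha : a ≠ 0) (hb : b ≠ 0) (hab : a + b = Γ.len d) (h : g b = 0) :
      MapsTo c (.edge d a b ha hb hab) (.vertex (c.vtx (Γ.tgt d)))
  | edge (d : Γ.D) (a b : M) (ha : a ≠ 0) (hb : b ≠ 0) (hab : a + b = Γ.len d)
      (e : Δ.D) (ha' : g a ≠ 0) (hb' : g b ≠ 0) (hab' : g a + g b = Δ.len e) (h : c.dart e = d) :
      MapsTo c (.edge d a b ha hb hab) (.edge e (g a) (g b) ha' hb' hab')
  | flip (d : Γ.D) (a b : M) (ha : a ≠ 0) (hb : b ≠ 0) (hab : a + b = Γ.len d)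
      (e : Δ.D) (ha' : g a ≠ 0) (hb' : g b ≠ 0) (hab' : g b + g a = Δ.len e)
      (h : c.dart e = Γ.rev d) :
      MapsTo c (.edge d a b ha hb hab) (.edge e (g b) (g a) hb' ha' hab')

lemma Point.MapsTo.id {M : Type} [AddCommMonoid M] {n : ℕ} {Γ : TropCurve M n} (p : Point Γ) :
    Point.MapsTo (Contraction.id Γ) p p := by
  cases p with
  | vertex v => exact .vertex v
  | edge d a b ha hb hab => exact .edge d a b ha hb hab d ha hb hab rfl

lemma Point.MapsTo.comp {M N P : Type} [AddCommMonoid M] [AddCommMonoid N] [AddCommMonoid P]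
    {n : ℕ} {g : M →+ N} {h : N →+ P} {Γ : TropCurve M n} {Δ : TropCurve N n} {Θ : TropCurve P n}
    {c : Contraction g Γ Δ} {c' : Contraction h Δ Θ} {p : Point Γ} {q : Point Δ} {r : Point Θ}
    (hpq : p.MapsTo c q) (hqr : q.MapsTo c' r) : p.MapsTo (c.comp c') r := by
  cases hpq with
  | vertex v =>
    cases hqr
    exact .vertex v
  | source d a b ha hb hab h0 =>
    cases hqr
    exact .source d a b ha hb hab (by simp [h0])
  | target d a b ha hb hab h0 =>
    cases hqr
    exact .target d a b ha hb hab (by simp [h0])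
  | edge d a b ha hb hab e ha' hb' hab' hd =>
    subst hd
    cases hqr with
    | source _ _ _ _ _ _ h0 =>
      rw [← c.dart_src]
      exact .source (c := c.comp c') _ a b ha hb hab h0
    | target _ _ _ _ _ _ h0 =>
      rw [← c.dart_tgt]
      exact .target (c := c.comp c') _ a b ha hb hab h0
    | edge _ _ _ _ _ _ f h1 h2 h3 hf =>
      exact .edge (c := c.comp c') _ a b ha hb hab f h1 h2 h3 (congrArg c.dart hf)
    | flip _ _ _ _ _ _ f h1 h2 h3 hf =>
      exact .flip (c := c.comp c') _ a b ha hb hab f h1 h2 h3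
        ((congrArg c.dart hf).trans (c.dart_rev e))
  | flip d a b ha hb hab e ha' hb' hab' hd =>
    have hd' : d = c.dart (Δ.rev e) := by rw [c.dart_rev, hd, Γ.rev_rev]
    cases hqr with
    | source _ _ _ _ _ _ h0 =>
      have : c'.vtx (Δ.src e) = (c.comp c').vtx (Γ.tgt d) := by
        rw [← c.dart_src, hd]
        rfl
      rw [this]
      exact .target (c := c.comp c') d a b ha hb hab h0
    | target _ _ _ _ _ _ h0 =>
      have : c'.vtx (Δ.tgt e) = (c.comp c').vtx (Γ.src d) := by
        rw [hd', TropCurve.tgt, ← c.dart_src]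
        rfl
      rw [this]
      exact .source (c := c.comp c') d a b ha hb hab h0
    | edge _ _ _ _ _ _ f h1 h2 h3 hf =>
      exact .flip (c := c.comp c') d a b ha hb hab f h2 h1 h3
        ((congrArg c.dart hf).trans hd)
    | flip _ _ _ _ _ _ f h1 h2 h3 hf =>
      exact .edge (c := c.comp c') d a b ha hb hab f h2 h1 h3
        ((congrArg c.dart hf).trans hd'.symm)

/-- The universal family over `Σ_Rub` (with `n` legs): an object over `M` is an object of `Σ_Rub`
over `M` together with a point of the equidimensional model `Eq_Γ(α)`. -/
structure UnivRub (n : ℕ) [NeZero n] : Type 1 where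
  rub : Rub n
  point : Point rub.pt.eqd

/-- Morphisms of the universal family are morphisms of `Σ_Rub` that respect the points. -/
instance {n : ℕ} [NeZero n] : Category (UnivRub n) where
  Hom ξ η := {a : ξ.rub ⟶ η.rub // ξ.point.MapsTo (RubHom.eqd a) η.point}
  id ξ := ⟨𝟙 ξ.rub, Point.MapsTo.id _⟩
  comp a b := ⟨a.1 ≫ b.1, Point.MapsTo.comp a.2 b.2⟩

/-- The structure map of `Σ_Rub`. -/
def Rub.proj (n : ℕ) [NeZero n] : Rub n ⥤ FSMon where
  obj ξ := ξ.base
  map a := RubHom.base a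

/-- The structure map of the universal family to `Σ_Rub`. -/
def UnivRub.toRub (n : ℕ) [NeZero n] : UnivRub n ⥤ Rub n where
  obj ξ := ξ.rub
  map a := a.1

/-- The universal family as a category over `FSMon`. -/
def UnivRub.proj (n : ℕ) [NeZero n] : UnivRub n ⥤ FSMon := UnivRub.toRub n ⋙ Rub.proj n

/-- `T` is the `(n+1)`-marked curve with piecewise linear function that is determined by the point
`p` of the equidimensional model `Γ'` of `C`: it is `Γ'`, subdivided at `p` if `p` is not a vertex,
with an additional last leg at `p` and with the lift of `α`. -/
def IsMarkedAt {M : Type} [AddCommMonoid M] {n : ℕ} [NeZero n] (C : RubPt M n) (p : Point C.eqd)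
    (T : DivPt M (n + 1)) : Prop :=
  ∃ σ : Subdivision T.curve.forgetLeg C.eqd,
    σ.IsLift (fun x => C.line.pos (C.β x)) T.α ∧
    (∀ x, x ∉ Set.range σ.vtx → x = T.curve.leg (Fin.last n)) ∧
    match p with
    | .vertex v => σ.vtx v = T.curve.leg (Fin.last n)
    | .edge d a b _ _ _ => ∃ e f, σ.path d = [e, f] ∧ T.curve.len e = a ∧ T.curve.len f = b ∧
        T.curve.tgt e = T.curve.leg (Fin.last n)

end TropRub

/-! For (1), the universal family is a category over monoids in which every arrow is cocartesian
(`univRub_allCocartesian`) and objects can be pushed forward (`univRub_hasPushforwards`). Call an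
object minimal if it lifts uniquely against all arrows over local homomorphisms. If every object
receives an arrow over a local homomorphism from a minimal object with simplicial cone, then the
minimal objects themselves form the required cone stack (`exists_simplicial_coneStack_represents`).
Indeed, any homomorphism factors as a face quotient followed by a local map. Pushing a minimal
object forward along a face quotient gives a minimal object, and an arrow between minimal objects
over a local map is invertible; so all arrows between minimal objects are face maps. A point `(d,
f)` of the stack corresponds to the pushforward of `d` along `f`.

The minimal object keeps the combinatorial type and takes universal lengths. For a fixed type, the
lengths are subject only to the condition that slope times length is the same for all edges over one
edge of the line, while edges of slope zero are free. Since monoids are saturated and their groups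
torsion free, the common value is divisible by the least common multiple of the slopes. Each cell
therefore contributes one free parameter `δ`, and the universal monoid is `ℕ^C`
(`exists_universal_lengths`). A point on an edge of length `q δ` adds generators `a`, `b` with `a +
b = q δ`. The result is the monoid of points of a finite index lattice in an orthant, which is
simplicial but in general not free (`exists_universal_lengths_split`).

The geometric work for pushforwards is to show that contracting edges turns a subdivision into a
subdivision: exceptional vertices are bivalent, so a walk along contracted edges can move only along
a path of the subdivision (`contr_of_contr_vtx_aux`, `contr_segment`).

For (2), the vertices of the equidimensional model have values among the positions of the line,
which form a chain. The extra vertex lies on an edge inside a single cell, so its value lies between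
neighbouring positions (`IsMarkedAt.ordered`).

For (3), take over `ℕ` two vertices with values 0 and 2, joined by edges of lengths 2 and 1. Marking
the middle of the long edge creates the value 1. A map to a line would have to cut the short edge,
of slope 2, at the same height, but a length of 1 cannot be divided in `ℕ` (`not_factors`). -/

namespace TropRub

/-! ### Monoids -/

section Monoids

instance (P : FSMon) : IsCancelAdd P := P.integral

lemma toGp_injective (P : FSMon) : Function.Injective (toGp : P → Gp P) :=
  Algebra.GrothendieckAddGroup.of_injective

lemma exists_toGp_sub {M : Type} [AddCommMonoid M] (x : Gp M) :
    ∃ a b : M, x = toGp a - toGp b := by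
  obtain ⟨⟨a, b⟩, h⟩ := (AddLocalization.addMonoidOf (⊤ : AddSubmonoid M)).surj x
  exact ⟨a, b, eq_sub_of_add_eq h⟩

lemma FSMon.right_eq_zero (P : FSMon) {a b : P} (h : a + b = 0) : b = 0 :=
  P.sharp b a (by rw [add_comm, h])

lemma FSMon.nsmul_eq_zero (P : FSMon) {k : ℕ} (hk : k ≠ 0) {a : P} (h : k • a = 0) : a = 0 := by
  obtain ⟨j, rfl⟩ := Nat.exists_eq_succ_of_ne_zero hk
  rw [succ_nsmul] at h
  exact P.right_eq_zero h

lemma FSMon.sum_eq_zero (P : FSMon) {ι : Type*} (s : Finset ι) (f : ι → P)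
    (h : ∑ i ∈ s, f i = 0) (i : ι) (hi : i ∈ s) : f i = 0 := by
  classical
  rw [← Finset.add_sum_erase _ _ hi] at h
  exact P.sharp _ _ h

/-- Saturation puts a torsion element into the monoid, where sharpness kills it. This torsion
freeness is what makes the slope on an edge unique. -/
lemma gp_nsmul_eq_zero (P : FSMon) {k : ℕ} (hk : k ≠ 0) {x : Gp P} (h : k • x = 0) : x = 0 := by
  obtain ⟨a, ha⟩ := P.saturated k x (Nat.pos_of_ne_zero hk) ⟨0, by rw [h, map_zero]⟩
  have : k • a = 0 := toGp_injective P (by rw [map_nsmul, ← ha, h, map_zero])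
  rw [ha, P.nsmul_eq_zero hk this, map_zero]

lemma gp_zsmul_eq_zero (P : FSMon) {k : ℤ} (hk : k ≠ 0) {x : Gp P} (h : k • x = 0) : x = 0 := by
  refine gp_nsmul_eq_zero P (k := k.natAbs) (by omega) ?_
  rcases Int.natAbs_eq k with h' | h'
  · rw [← natCast_zsmul, ← h', h]
  · rw [← natCast_zsmul, ← neg_eq_zero, ← neg_smul, ← h', h]

lemma gp_nsmul_right_injective (P : FSMon) {k : ℕ} (hk : k ≠ 0) {x y : Gp P}
    (h : k • x = k • y) : x = y :=
  sub_eq_zero.1 (gp_nsmul_eq_zero P hk (by rw [nsmul_sub, h, sub_self]))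

lemma FSMon.nsmul_right_injective (P : FSMon) {k : ℕ} (hk : k ≠ 0) {x y : P}
    (h : k • x = k • y) : x = y :=
  toGp_injective P (gp_nsmul_right_injective P hk (by rw [← map_nsmul, ← map_nsmul, h]))

lemma toGp_ne_zero (P : FSMon) {a : P} (ha : a ≠ 0) : (toGp a : Gp P) ≠ 0 := fun h =>
  ha (toGp_injective P (by rw [h, map_zero]))

lemma zsmul_toGp_injective (P : FSMon) {a : P} (ha : a ≠ 0) {s t : ℤ}
    (h : s • (toGp a : Gp P) = t • toGp a) : s = t := by
  by_contra hst
  refine toGp_ne_zero P ha (gp_zsmul_eq_zero P (k := s - t) (by omega) ?_)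
  rw [sub_smul, h, sub_self]

/-- Antisymmetry of the order on `Gp P`; it is sharpness. -/
lemma toGp_add_toGp_eq_zero (P : FSMon) {x : Gp P} {a b : P} (ha : x = toGp a)
    (hb : -x = toGp b) : a = 0 :=
  P.sharp a b (toGp_injective P (by rw [map_add, ← ha, ← hb, map_zero, add_neg_cancel]))

/-! #### Face maps and local maps -/

/-- The congruence on `M` whose quotient is the quotient by the face `g = 0`. -/
def faceCon {M N : FSMon} (g : M →+ N) : AddCon M where
  r a b := ∃ x y, g x = 0 ∧ g y = 0 ∧ a + x = b + y
  iseqv :=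
    { refl := fun _ => ⟨0, 0, map_zero g, map_zero g, rfl⟩
      symm := by
        rintro a b ⟨x, y, hx, hy, h⟩
        exact ⟨y, x, hy, hx, h.symm⟩
      trans := by
        rintro a b c ⟨x, y, hx, hy, h⟩ ⟨x', y', hx', hy', h'⟩
        refine ⟨x + x', y + y', by rw [map_add, hx, hx', add_zero],
          by rw [map_add, hy, hy', add_zero], ?_⟩
        rw [← add_assoc, h, add_right_comm, h', add_right_comm, add_assoc] }
  add' := by
    rintro a b c d ⟨x, y, hx, hy, h⟩ ⟨x', y', hx', hy', h'⟩
    refine ⟨x + x', y + y', by rw [map_add, hx, hx', add_zero],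
      by rw [map_add, hy, hy', add_zero], ?_⟩
    rw [add_add_add_comm, h, h', add_add_add_comm]

lemma faceCon_mk_eq {M N : FSMon} (g : M →+ N) {a b : M} :
    (faceCon g).mk' a = (faceCon g).mk' b ↔
      ∃ x y, g x = 0 ∧ g y = 0 ∧ a + x = b + y :=
  (faceCon g).eq

instance faceCon_isCancelAdd {M N : FSMon} (g : M →+ N) : IsCancelAdd (faceCon g).Quotient := by
  have : IsLeftCancelAdd (faceCon g).Quotient := ⟨by
    intro a b c h
    obtain ⟨a, rfl⟩ := AddCon.mk'_surjective a
    obtain ⟨b, rfl⟩ := AddCon.mk'_surjective b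
    obtain ⟨c, rfl⟩ := AddCon.mk'_surjective c
    change _ + _ = _ + _ at h
    rw [← map_add, ← map_add, faceCon_mk_eq] at h
    obtain ⟨x, y, hx, hy, h⟩ := h
    rw [faceCon_mk_eq]
    exact ⟨x, y, hx, hy, by rwa [add_assoc, add_assoc, add_left_cancel_iff] at h⟩⟩
  exact AddCommMagma.IsLeftCancelAdd.toIsCancelAdd _

/-- The quotient of `M` by the face `g = 0`. -/
noncomputable def faceQuot {M N : FSMon} (g : M →+ N) : FSMon where
  carrier := (faceCon g).Quotient
  sharp a b h := by
    obtain ⟨a, rfl⟩ := AddCon.mk'_surjective a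
    obtain ⟨b, rfl⟩ := AddCon.mk'_surjective b
    rw [← map_add, ← map_zero (faceCon g).mk', faceCon_mk_eq] at h
    obtain ⟨x, y, hx, hy, h⟩ := h
    rw [← map_zero (faceCon g).mk', faceCon_mk_eq]
    refine ⟨0, a, map_zero g, ?_, by rw [add_zero, zero_add]⟩
    refine N.sharp _ (g b) ?_
    simpa [hx, hy] using congrArg g h
  fg := by
    obtain ⟨S, hS, hfin⟩ := (AddMonoid.fg_iff.1 M.fg)
    refine AddMonoid.fg_iff.2 ⟨(faceCon g).mk' '' S, ?_, hfin.image _⟩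
    rw [← AddMonoidHom.map_mclosure, hS, ← AddMonoidHom.mrange_eq_map]
    exact AddMonoidHom.mrange_eq_top.2 AddCon.mk'_surjective
  integral := faceCon_isCancelAdd g
  saturated k x hk := by
    rintro ⟨m, hm⟩
    obtain ⟨u, v, rfl⟩ := exists_toGp_sub x
    obtain ⟨m, rfl⟩ := AddCon.mk'_surjective m
    obtain ⟨u, rfl⟩ := AddCon.mk'_surjective u
    obtain ⟨v, rfl⟩ := AddCon.mk'_surjective v
    have h1 : (faceCon g).mk' (k • u) = (faceCon g).mk' (m + k • v) := by
      apply Algebra.GrothendieckAddGroup.of_injective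
      change toGp _ = toGp _
      rw [map_add, map_add, map_nsmul, map_nsmul, map_nsmul, map_nsmul, ← hm, nsmul_sub,
        sub_add_cancel]
    obtain ⟨x, y, hx, hy, h⟩ := (faceCon_mk_eq g).1 h1
    -- From `k u + x = m + y + k v` one gets `k (u + x - v) = m + y + (k - 1) x`, which lies in `M`.
    -- Adding `x` to `u` does not change its class.
    obtain ⟨z, hz⟩ := M.saturated k (toGp u + toGp x - toGp v) hk
      ⟨m + y + (k - 1) • x, by
        have h2 := congrArg (toGp (M := M)) h
        simp only [map_add, map_nsmul] at h2 ⊢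
        obtain ⟨k, rfl⟩ := Nat.exists_eq_succ_of_ne_zero hk.ne'
        simp only [Nat.succ_eq_add_one, Nat.add_sub_cancel]
        rw [nsmul_sub, nsmul_add, sub_eq_iff_eq_add]
        nth_rewrite 2 [add_smul]
        rw [one_smul, add_comm _ (toGp x), ← add_assoc, h2]
        abel⟩
    refine ⟨(faceCon g).mk' z, ?_⟩
    rw [sub_eq_iff_eq_add, ← map_add, ← map_add]
    refine congrArg _ ((faceCon_mk_eq g).2 ⟨x, 0, hx, map_zero g, ?_⟩)
    apply toGp_injective M
    rw [add_zero, map_add, map_add, ← hz, sub_add_cancel]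

/-- The kernel of `g` is a face because `N` is sharp, and nothing non-zero is killed after dividing
by it. Dually, a map of cones factors through the smallest face containing its image. -/
theorem exists_face_local_factorization {M N : FSMon} (g : M ⟶ N) :
    ∃ (Q : FSMon) (q : M ⟶ Q) (j : Q ⟶ N), IsFaceMap q ∧ IsLocal j ∧ q ≫ j = g := by
  let g' : M →+ N := g
  let j : (faceCon g').Quotient →+ N := (faceCon g').lift g' (by
    rintro a b ⟨x, y, hx, hy, h⟩
    simpa [hx, hy, AddCon.ker] using congrArg g' h)
  have hj : ∀ m, j ((faceCon g').mk' m) = g' m := fun _ => rfl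
  refine ⟨faceQuot g', (faceCon g').mk', j, ⟨AddCon.mk'_surjective, ?_⟩, ?_, ?_⟩
  · intro a b h
    obtain ⟨x, y, hx, hy, h⟩ := (faceCon_mk_eq g').1 h
    refine ⟨x, y, ?_, ?_, h⟩
    · exact (faceCon_mk_eq g').2 ⟨0, x, map_zero _, hx, by simp⟩
    · exact (faceCon_mk_eq g').2 ⟨0, y, map_zero _, hy, by simp⟩
  · intro m hm
    obtain ⟨m, rfl⟩ := AddCon.mk'_surjective (c := faceCon g') m
    exact (faceCon_mk_eq g').2 ⟨0, m, map_zero _, hm, by simp⟩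
  · rfl

lemma IsFaceMap.exists_desc {M N P : FSMon} {f : M ⟶ N} (hf : IsFaceMap f) (g : M ⟶ P)
    (h : ∀ m, (show M →+ N from f) m = 0 → (show M →+ P from g) m = 0) :
    ∃ j : N ⟶ P, f ≫ j = g := by
  let f' : M →+ N := f
  let g' : M →+ P := g
  have key : ∀ a b, f' a = f' b → g' a = g' b := by
    intro a b hab
    obtain ⟨x, y, hx, hy, hxy⟩ := hf.2 a b hab
    have hx' : g' x = 0 := h x hx
    have hy' : g' y = 0 := h y hy
    simpa [hx', hy'] using congrArg g' hxy
  choose r hr using hf.1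
  change ∀ b, f' (r b) = b at hr
  let j : N →+ P :=
    { toFun := fun n => g' (r n)
      map_zero' := by rw [← map_zero g']; exact key _ _ (by rw [hr, map_zero])
      map_add' := fun a b => by
        rw [← map_add]; exact key _ _ (by rw [hr, map_add, hr, hr]) }
  exact ⟨j, AddMonoidHom.ext fun m => key _ _ (hr _)⟩

lemma IsFaceMap.comp_iso {M N P : FSMon} {f : M ⟶ N} (hf : IsFaceMap f) (i : N ≅ P) :
    IsFaceMap (f ≫ i.hom) := by
  let f' : M →+ N := f
  let i' : N →+ P := i.hom
  let k' : P →+ N := i.inv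
  have hik : ∀ x, i' (k' x) = x := fun x => DFunLike.congr_fun (show i'.comp k' = _ from i.inv_hom_id) x
  have hki : ∀ x, k' (i' x) = x := fun x => DFunLike.congr_fun (show k'.comp i' = _ from i.hom_inv_id) x
  refine ⟨?_, ?_⟩
  · intro p
    obtain ⟨m, hm⟩ := hf.1 (k' p)
    exact ⟨m, (congrArg i' hm).trans (hik p)⟩
  · intro a b hab
    have : f' a = f' b := by
      have := congrArg k' (show i' (f' a) = i' (f' b) from hab)
      rwa [hki, hki] at this
    obtain ⟨x, y, hx, hy, h⟩ := hf.2 a b this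
    exact ⟨x, y, (congrArg i' hx).trans (map_zero i'), (congrArg i' hy).trans (map_zero i'), h⟩

end Monoids

/-! #### Divisibility -/

/-- Bézout: let `a'`, `b'` be the coprime parts of `a`, `b` and `a' A + b' B = 1`. Since the lcm is
`a' b = b' a`, it sends `v` to `a' L` and `u` to `b' L`, hence `A v + B u` to `L`. -/
lemma exists_lcm_nsmul {A : Type*} [AddCommGroup A] {a b : ℕ} (L u v : A)
    (hu : a • u = L) (hv : b • v = L) : ∃ d : A, (Nat.lcm a b) • d = L := by
  rcases Nat.eq_zero_or_pos (Nat.gcd a b) with h0 | h0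
  · obtain ⟨rfl, rfl⟩ := Nat.gcd_eq_zero_iff.1 h0
    exact ⟨0, by simpa using hu⟩
  obtain ⟨a', b', hc, ha, hb⟩ := Nat.exists_coprime a b
  have hbez : (1 : ℤ) = a' * Nat.gcdA a' b' + b' * Nat.gcdB a' b' := by
    have := Nat.gcd_eq_gcd_ab a' b'
    rwa [Nat.Coprime.gcd_eq_one hc, Nat.cast_one] at this
  have hl : Nat.lcm a b = a' * b := by
    have h1 := Nat.gcd_mul_lcm a b
    refine Nat.eq_of_mul_eq_mul_left h0 ?_
    rw [h1]
    nth_rewrite 1 [ha]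
    ring
  have hl' : Nat.lcm a b = b' * a := by
    rw [hl]
    calc a' * b = a' * (b' * a.gcd b) := by rw [← hb]
      _ = b' * (a' * a.gcd b) := by ring
      _ = b' * a := by rw [← ha]
  refine ⟨Nat.gcdA a' b' • v + Nat.gcdB a' b' • u, ?_⟩
  have h1 : Nat.lcm a b • v = a' • L := by rw [hl, mul_smul, hv]
  have h2 : Nat.lcm a b • u = b' • L := by rw [hl', mul_smul, hu]
  rw [nsmul_add, smul_comm, h1, smul_comm _ _ u, h2, ← natCast_zsmul, ← natCast_zsmul, smul_smul,
    smul_smul, ← add_smul, mul_comm, add_comm, mul_comm _ (b' : ℤ), add_comm, ← hbez, one_smul]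

/-- The quotient `d` is found in the group, moved into `P` by saturation, and its multiples are
identified by torsion freeness. -/
lemma FSMon.exists_finset_lcm_nsmul (P : FSMon) {X : Type*} (s : Finset X) (w : X → ℕ)
    (hw : ∀ x, 0 < w x) (l : X → P) (L : P) (h : ∀ x ∈ s, w x • l x = L) :
    ∃ d : P, s.lcm w • d = L ∧ ∀ x ∈ s, (s.lcm w / w x) • d = l x := by
  classical
  have key : ∃ d : Gp P, s.lcm w • d = toGp L := by
    induction s using Finset.induction_on with
    | empty => exact ⟨toGp L, by simp⟩
    | insert x s hx ih =>
      obtain ⟨d, hd⟩ := ih fun y hy => h y (Finset.mem_insert_of_mem hy)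
      rw [Finset.lcm_insert]
      exact exists_lcm_nsmul (toGp L) (toGp (l x)) d
        (by rw [← map_nsmul, h x (Finset.mem_insert_self _ _)]) hd
  have hm : s.lcm w ≠ 0 := by
    intro h0
    obtain ⟨x, _, hx⟩ := Finset.lcm_eq_zero_iff.1 h0
    exact (hw x).ne' hx
  obtain ⟨d, hd⟩ := key
  obtain ⟨d, rfl⟩ := P.saturated _ d (Nat.pos_of_ne_zero hm) ⟨L, hd⟩
  have hd' : s.lcm w • d = L := toGp_injective P (by rw [map_nsmul, hd])
  refine ⟨d, hd', fun x hx => P.nsmul_right_injective (hw x).ne' ?_⟩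
  rw [smul_smul, Nat.mul_div_cancel' (Finset.dvd_lcm hx), hd', h x hx]

/-! #### Monoids of lattice points in an orthant -/

/-- The points of the lattice `H` in the orthant. -/
def latticePoints {I : Type} (H : AddSubgroup (I → ℤ)) : AddSubmonoid (I → ℕ) where
  carrier := {v | (fun i => (v i : ℤ)) ∈ H}
  add_mem' {a b} ha hb := by
    have : (fun i => ((a + b) i : ℤ)) = (fun i => (a i : ℤ)) + fun i => (b i : ℤ) := by
      ext i; simp
    change _ ∈ H
    rw [this]
    exact H.add_mem ha hb
  zero_mem' := by
    change _ ∈ H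
    convert! H.zero_mem using 1

section Lattice

variable {I : Type} (H : AddSubgroup (I → ℤ))

lemma latticePoints_sub {u v : I → ℕ} (hu : u ∈ latticePoints H) (hv : v ∈ latticePoints H)
    (h : v ≤ u) : u - v ∈ latticePoints H := by
  have : (fun i => ((u - v) i : ℤ)) = (fun i => (u i : ℤ)) - fun i => (v i : ℤ) := by
    ext i; simp [Nat.cast_sub (h i)]
  change _ ∈ H
  rw [this]
  exact H.sub_mem hu hv

variable [DecidableEq I] {q : ℕ}

/-- The lattice points in the box of side `q` generate: a vector with a coordinate larger than `q`
splits off a multiple of a unit vector and has smaller coordinate sum left. -/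
lemma latticePoints_fg [Finite I] (hq : 0 < q) (h : ∀ i, Pi.single i q ∈ latticePoints H) :
    (latticePoints H).FG := by
  have := Fintype.ofFinite I
  have hfin : {v : I → ℕ | v ∈ latticePoints H ∧ ∀ i, v i ≤ q}.Finite := by
    refine (Set.finite_Iic (fun _ : I => q)).subset ?_
    rintro v ⟨_, hv⟩
    exact hv
  refine (AddSubmonoid.fg_iff _).2 ⟨_, le_antisymm ?_ ?_, hfin⟩
  · rw [AddSubmonoid.closure_le]
    exact fun v hv => hv.1
  · intro v hv
    induction hn : ∑ i, v i using Nat.strong_induction_on generalizing v with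
    | _ N ih =>
      by_cases hle : ∀ i, v i ≤ q
      · exact AddSubmonoid.subset_closure ⟨hv, hle⟩
      · push Not at hle
        obtain ⟨i, hi⟩ := hle
        have hsle : Pi.single i q ≤ v := by
          intro j
          by_cases hj : j = i
          · subst hj; simp [hi.le]
          · simp [Pi.single_eq_of_ne hj]
        have hdec : v = (v - (Pi.single i q : I → ℕ)) + Pi.single i q := (tsub_add_cancel_of_le hsle).symm
        rw [hdec]
        refine add_mem (ih (∑ j, (v - (Pi.single i q : I → ℕ)) j) ?_ (latticePoints_sub H hv (h i) hsle) rfl)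
          (AddSubmonoid.subset_closure ⟨h i, fun j => ?_⟩)
        · rw [← hn]
          conv_rhs => rw [hdec]
          simp only [Pi.add_apply, Finset.sum_add_distrib]
          simp [hq]
        · by_cases hj : j = i
          · subst hj; simp
          · simp [Pi.single_eq_of_ne hj]

/-- The monoid of points of a lattice of finite index in an orthant. -/
def latticeMon [Finite I] (hq : 0 < q) (h : ∀ i, Pi.single i q ∈ latticePoints H) : FSMon where
  carrier := latticePoints H
  sharp a b hab := by
    apply Subtype.ext
    ext i
    have := congrFun (congrArg Subtype.val hab) i
    simp at this
    simp [this.1]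
  fg := (AddMonoid.fg_iff_addSubmonoid_fg _).2 (latticePoints_fg H hq h)
  integral := inferInstance
  saturated k x hk := by
    rintro ⟨m, hm⟩
    obtain ⟨u, v, rfl⟩ := exists_toGp_sub x
    have h1 : k • u = m + k • v := by
      apply Algebra.GrothendieckAddGroup.of_injective
      change toGp _ = toGp _
      rw [map_add, map_nsmul, map_nsmul, ← hm, nsmul_sub, sub_add_cancel]
    have hle : v.1 ≤ u.1 := by
      intro i
      have := congrFun (congrArg Subtype.val h1) i
      simp at this
      exact Nat.le_of_mul_le_mul_left (this ▸ Nat.le_add_left _ _) hk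
    refine ⟨⟨u.1 - v.1, latticePoints_sub H u.2 v.2 hle⟩, ?_⟩
    rw [sub_eq_iff_eq_add, ← map_add]
    exact congrArg _ (Subtype.ext (tsub_add_cancel_of_le hle).symm)

lemma latticePoints_nsmul_eq_sum [Fintype I] (h : ∀ i, Pi.single i q ∈ latticePoints H)
    (v : latticePoints H) : q • v = ∑ i, (v.1 i) • (⟨_, h i⟩ : latticePoints H) := by
  apply Subtype.ext
  rw [AddSubmonoid.coe_finsetSum]
  ext j
  simp [Finset.sum_apply, Pi.single_apply, mul_comm]

/-- The coordinate functionals. -/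
def latticeCoord (i : I) : latticePoints H →+ ℝ where
  toFun v := (v.1 i : ℝ)
  map_zero' := by simp
  map_add' := by simp

/-- The coordinate functionals are, up to the factor `q`, dual to the vectors `Pi.single i q`. So
they are independent, and a nonnegative functional is the combination of them whose coefficients are
its values on these vectors divided by `q`. -/
lemma latticeMon_isSimplicial [Finite I] (hq : 0 < q) (h : ∀ i, Pi.single i q ∈ latticePoints H) :
    (dualCone (latticeMon H hq h)).IsSimplicial := by
  have := Fintype.ofFinite I
  have hq' : (q : ℝ) ≠ 0 := by exact_mod_cast hq.ne'
  let ev : I → ((latticePoints H) →+ ℝ) := latticeCoord H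
  have hev : ∀ i j, ev i ⟨_, h j⟩ = if i = j then (q : ℝ) else 0 := by
    intro i j
    simp [ev, latticeCoord, Pi.single_apply]
  have hli : LinearIndependent ℝ ev := by
    rw [Fintype.linearIndependent_iff]
    intro g hg i
    have := DFunLike.congr_fun hg ⟨_, h i⟩
    simp only [AddMonoidHom.finsetSum_apply, AddMonoidHom.smul_apply, hev] at this
    simpa [hq'] using this
  refine ⟨Set.range ev, Set.finite_range ev, ?_, ?_⟩
  · exact hli.linearIndepOn_id
  · apply le_antisymm
    · refine Submodule.span_le.2 ?_
      rintro _ ⟨i, rfl⟩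
      intro m
      exact Nat.cast_nonneg _
    · intro f hf
      let f' : latticePoints H →+ ℝ := f
      have hf' : ∀ m, 0 ≤ f' m := hf
      have hsum : f' = ∑ i, (f' ⟨_, h i⟩ / q) • ev i := by
        ext v
        have := congrArg f' (latticePoints_nsmul_eq_sum H h v)
        rw [map_nsmul, map_sum] at this
        simp only [map_nsmul, nsmul_eq_mul] at this
        apply mul_left_cancel₀ hq'
        rw [this, AddMonoidHom.finsetSum_apply, Finset.mul_sum]
        refine Finset.sum_congr rfl fun i _ => ?_
        simp only [AddMonoidHom.smul_apply, smul_eq_mul, ev, latticeCoord]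
        simp only [AddMonoidHom.coe_mk, ZeroHom.coe_mk]
        field_simp
      change f' ∈ PointedCone.hull ℝ (Set.range ev)
      rw [hsum]
      refine sum_mem fun i _ => ?_
      exact Submodule.smul_mem (PointedCone.hull ℝ (Set.range ev))
        (⟨f' ⟨_, h i⟩ / q, div_nonneg (hf' _) (Nat.cast_nonneg _)⟩ : {c : ℝ // 0 ≤ c})
        (Submodule.subset_span ⟨i, rfl⟩)

end Lattice

/-- The monoid of the points of the lattice spanned by a family `γ` in an orthant, if this family
contains a multiple of each unit vector: it is simplicial, and maps out of it are determined by the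
images of the members of `γ`. -/
theorem exists_simplicial_monoid {I J : Type} [Finite I] [DecidableEq I] (γ : J → I → ℕ)
    (q : ℕ) (hq : 0 < q)
    (hunit : ∀ i, ∃ j n, 0 < n ∧ n ∣ q ∧ γ j = Pi.single i n) :
    ∃ (Q : FSMon) (g : J → Q) (ι : Q →+ (I → ℕ)), (dualCone Q).IsSimplicial ∧
      Function.Injective ι ∧ (∀ j, ι (g j) = γ j) ∧
      (∀ (P : FSMon) (φ ψ : Q →+ P), (∀ j, φ (g j) = ψ (g j)) → φ = ψ) ∧
      ∀ [Fintype I] (P : FSMon) (x : I → P) (y : J → P), (∀ j, q • y j = ∑ i, γ j i • x i) →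
        ∃ φ : Q →+ P, (∀ j, φ (g j) = y j) ∧ ((∀ i, x i ≠ 0) → ∀ m, φ m = 0 → m = 0) := by
  let H : AddSubgroup (I → ℤ) := AddSubgroup.closure (Set.range fun j i => (γ j i : ℤ))
  have hγ : ∀ j, γ j ∈ latticePoints H := fun j => AddSubgroup.subset_closure ⟨j, rfl⟩
  have h : ∀ i, Pi.single i q ∈ latticePoints H := by
    intro i
    obtain ⟨j, n, hn, ⟨k, rfl⟩, hj⟩ := hunit i
    have := (latticePoints H).nsmul_mem (hγ j) k
    rwa [hj, ← Pi.single_smul, smul_eq_mul, mul_comm] at this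
  let g : J → latticePoints H := fun j => ⟨γ j, hγ j⟩
  refine ⟨latticeMon H hq h, g, (latticePoints H).subtype,
    latticeMon_isSimplicial H hq h, Subtype.val_injective, fun _ => rfl, ?_, ?_⟩
  · intro P φ ψ hφψ
    have := Fintype.ofFinite I
    let φ' : latticePoints H →+ P := φ
    let ψ' : latticePoints H →+ P := ψ
    have hu : ∀ i, φ' ⟨_, h i⟩ = ψ' ⟨_, h i⟩ := by
      intro i
      obtain ⟨j, n, hn, ⟨k, hk⟩, hj⟩ := hunit i
      have : (⟨_, h i⟩ : latticePoints H) = k • g j := by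
        apply Subtype.ext
        change Pi.single i q = k • γ j
        rw [hj, ← Pi.single_smul, hk, smul_eq_mul, mul_comm]
      rw [this, map_nsmul, map_nsmul]
      exact congrArg _ (hφψ j)
    change φ' = ψ'
    ext v
    apply P.nsmul_right_injective hq.ne'
    rw [← map_nsmul, ← map_nsmul, latticePoints_nsmul_eq_sum H h, map_sum, map_sum]
    simp only [map_nsmul, hu]
  · intro _ P x y hxy
    -- The vectors `v` for which `∑ v i • x i` is divisible by `q` in the group. The hypothesis puts
    -- the generators of `H` there; for vectors in the orthant, saturation then gives the quotient
    -- in `P`.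
    let S : AddSubgroup (I → ℤ) :=
      { carrier := {v | ∃ z : Gp P, q • z = ∑ i, v i • toGp (x i)}
        zero_mem' := ⟨0, by simp⟩
        add_mem' := by
          rintro a b ⟨z, hz⟩ ⟨z', hz'⟩
          exact ⟨z + z', by simp [hz, hz', add_smul, Finset.sum_add_distrib]⟩
        neg_mem' := by
          rintro a ⟨z, hz⟩
          exact ⟨-z, by simp [hz]⟩ }
    have hHS : H ≤ S := by
      rw [AddSubgroup.closure_le]
      rintro _ ⟨j, rfl⟩
      refine ⟨toGp (y j), ?_⟩
      rw [← map_nsmul, hxy, map_sum]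
      simp
    have key : ∀ v : latticePoints H, ∃ m : P, q • m = ∑ i, v.1 i • x i := by
      intro v
      obtain ⟨z, hz⟩ := hHS v.2
      have hz' : q • z = toGp (∑ i, v.1 i • x i) := by
        rw [hz, map_sum]
        simp
      obtain ⟨m, rfl⟩ := P.saturated q z hq ⟨_, hz'⟩
      exact ⟨m, toGp_injective P (by rw [map_nsmul, hz'])⟩
    choose f hf using key
    let φ : latticePoints H →+ P :=
      { toFun := f
        map_zero' := P.nsmul_right_injective hq.ne' (by rw [hf]; simp)
        map_add' := fun a b => P.nsmul_right_injective hq.ne' (by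
          rw [nsmul_add, hf, hf, hf]
          simp [add_smul, Finset.sum_add_distrib]) }
    refine ⟨φ, fun j => P.nsmul_right_injective hq.ne' ((hf (g j)).trans (hxy j).symm), ?_⟩
    intro hx v hv
    have h0 : ∑ i, v.1 i • x i = 0 := by
      rw [← hf v]
      change q • φ v = 0
      rw [show φ v = 0 from hv, nsmul_zero]
    refine Subtype.ext (funext fun i => ?_)
    by_contra hne
    exact hx i (P.nsmul_eq_zero hne (P.sum_eq_zero _ _ h0 i (Finset.mem_univ i)))

/-! #### Universal length systems -/

/-- A system of lengths `l` for which all `w x • l x` with `x` in the same cell agree. -/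
def IsLengthSystem {X C P : Type} [AddCommMonoid P] (cell : X → C) (w : X → ℕ) (l : X → P) : Prop :=
  ∀ x y, cell x = cell y → w x • l x = w y • l y

section Universal

variable {X C : Type} [Fintype X] [DecidableEq C] (cell : X → C) (w : X → ℕ)

/-- The least common multiple of the weights in a cell. -/
def cellLcm (c : C) : ℕ := (Finset.univ.filter fun x => cell x = c).lcm w

lemma dvd_cellLcm (x : X) : w x ∣ cellLcm cell w (cell x) :=
  Finset.dvd_lcm (by simp)

variable {w}

lemma cellLcm_pos (hw : ∀ x, 0 < w x) (c : C) : 0 < cellLcm cell w c := by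
  refine Nat.pos_of_ne_zero fun h0 => ?_
  obtain ⟨x, _, hx⟩ := Finset.lcm_eq_zero_iff.1 h0
  exact (hw x).ne' hx

lemma cellLcm_div_pos (hw : ∀ x, 0 < w x) (x : X) : 0 < cellLcm cell w (cell x) / w x :=
  Nat.div_pos (Nat.le_of_dvd (cellLcm_pos cell hw _) (dvd_cellLcm cell w x)) (hw x)

variable {cell}

/-- The common value of `w x • l x` on a cell is divisible by each weight, hence by their least
common multiple. So a cell carries one parameter, of which all its lengths are multiples. -/
lemma IsLengthSystem.exists_cell_length (hw : ∀ x, 0 < w x) (hc : Function.Surjective cell)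
    (P : FSMon) (l : X → P) (hl : IsLengthSystem cell w l) :
    ∃ d : C → P, ∀ x, (cellLcm cell w (cell x) / w x) • d (cell x) = l x := by
  have : ∀ c, ∃ d : P, ∀ x, cell x = c → (cellLcm cell w c / w x) • d = l x := by
    intro c
    obtain ⟨x, rfl⟩ := hc c
    obtain ⟨d, _, hd⟩ := P.exists_finset_lcm_nsmul
      (Finset.univ.filter fun y => cell y = cell x) w hw l (w x • l x)
      fun y hy => hl y x (by simpa using hy)
    exact ⟨d, fun y hy => hd y (by simpa using hy)⟩
  choose d hd using this
  exact ⟨d, fun x => hd _ x rfl⟩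

lemma isLengthSystem_of_cell_length {P : Type} [AddCommMonoid P]
    (d : C → P) : IsLengthSystem cell w fun x => (cellLcm cell w (cell x) / w x) • d (cell x) := by
  intro x y h
  change w x • _ • _ = w y • _ • _
  rw [smul_smul, smul_smul, Nat.mul_div_cancel' (dvd_cellLcm cell w x),
    Nat.mul_div_cancel' (dvd_cellLcm cell w y), h]

lemma cell_length_ne_zero {P : Type} [AddCommMonoid P] (hc : Function.Surjective cell)
    {d : C → P} {l : X → P}
    (hd : ∀ x, (cellLcm cell w (cell x) / w x) • d (cell x) = l x) (hl : ∀ x, l x ≠ 0) (c : C) :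
    d c ≠ 0 := by
  obtain ⟨x, rfl⟩ := hc c
  intro h
  exact hl x (by rw [← hd, h, nsmul_zero])

variable (cell) in
-- The parameters of the cells are independent, so the free monoid on the cells works; it is the
-- orthant monoid of the unit vectors with `q = 1`.
theorem exists_universal_lengths (hw : ∀ x, 0 < w x) (hc : Function.Surjective cell) :
    ∃ (Q : FSMon) (l₀ : X → Q), (dualCone Q).IsSimplicial ∧ IsLengthSystem cell w l₀ ∧
      (∀ x, l₀ x ≠ 0) ∧
      (∀ (P : FSMon) (φ ψ : Q →+ P), (∀ x, φ (l₀ x) = ψ (l₀ x)) → φ = ψ) ∧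
      ∀ (P : FSMon) (l : X → P), IsLengthSystem cell w l →
        ∃ φ : Q →+ P, (∀ x, φ (l₀ x) = l x) ∧ ((∀ x, l x ≠ 0) → ∀ m, φ m = 0 → m = 0) := by
  have : Finite C := Finite.of_surjective _ hc
  have := Fintype.ofFinite C
  obtain ⟨Q, g, ι, hQ, hι, hg, hext, hex⟩ := exists_simplicial_monoid
    (fun c : C => (Pi.single c 1 : C → ℕ)) 1 one_pos fun c => ⟨c, 1, one_pos, dvd_rfl, rfl⟩
  refine ⟨Q, _, hQ, isLengthSystem_of_cell_length g, ?_, ?_, ?_⟩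
  · intro x h
    have := Q.nsmul_eq_zero (cellLcm_div_pos cell hw x).ne' h
    have := congrArg ι this
    rw [hg, map_zero] at this
    simpa using congrFun this (cell x)
  · intro P φ ψ h
    refine hext P φ ψ fun c => ?_
    obtain ⟨x, rfl⟩ := hc c
    have := h x
    rw [map_nsmul, map_nsmul] at this
    exact P.nsmul_right_injective (cellLcm_div_pos cell hw x).ne' this
  · intro P l hl
    obtain ⟨d, hd⟩ := hl.exists_cell_length hw hc
    obtain ⟨φ, hφ, hloc⟩ := hex P d d fun c => by
      simp [Pi.single_apply]
    refine ⟨φ, fun x => by rw [map_nsmul, hφ, hd], fun hne => hloc ?_⟩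
    exact cell_length_ne_zero hc hd hne

variable (cell) in
theorem exists_universal_lengths_split (hw : ∀ x, 0 < w x) (hc : Function.Surjective cell) (z : X) :
    ∃ (Q : FSMon) (l₀ : X → Q) (a₀ b₀ : Q), (dualCone Q).IsSimplicial ∧
      IsLengthSystem cell w l₀ ∧ (∀ x, l₀ x ≠ 0) ∧ a₀ ≠ 0 ∧ b₀ ≠ 0 ∧ a₀ + b₀ = l₀ z ∧
      (∀ (P : FSMon) (φ ψ : Q →+ P), (∀ x, φ (l₀ x) = ψ (l₀ x)) → φ a₀ = ψ a₀ → φ b₀ = ψ b₀ →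
        φ = ψ) ∧
      ∀ (P : FSMon) (l : X → P) (a b : P), IsLengthSystem cell w l → a + b = l z →
        ∃ φ : Q →+ P, (∀ x, φ (l₀ x) = l x) ∧ φ a₀ = a ∧ φ b₀ = b ∧
          ((∀ x, l x ≠ 0) → a ≠ 0 → b ≠ 0 → ∀ m, φ m = 0 → m = 0) := by
  have : Finite C := Finite.of_surjective _ hc
  have := Fintype.ofFinite C
  let q := cellLcm cell w (cell z) / w z
  have hq : 0 < q := cellLcm_div_pos cell hw z
  -- The generators are one `δ` per cell and `a`, `b` (`true`, `false`), with `a + b = q δ` in the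
  -- cell of `z`. The coordinate of that cell is replaced by two, `some (cell z)` for `a` and `none`
  -- for `b`. To keep `δ = (a + b) / q` integral, `a` and `b` are `q` times unit vectors and `δ` is
  -- the sum of the two unit vectors.
  let γ : C ⊕ Bool → Option C → ℕ := Sum.elim
    (fun c => if c = cell z then Pi.single (some c) 1 + Pi.single none 1
      else Pi.single (some c) 1)
    (fun b => if b then Pi.single (some (cell z)) q else Pi.single none q)
  obtain ⟨Q, g, ι, hQ, hι, hg, hext, hex⟩ := exists_simplicial_monoid γ q hq (by
    rintro (_ | c)
    · exact ⟨.inr false, q, hq, dvd_rfl, by simp [γ]⟩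
    · by_cases h : c = cell z
      · exact ⟨.inr true, q, hq, dvd_rfl, by simp [γ, h]⟩
      · exact ⟨.inl c, 1, one_pos, one_dvd _, by simp [γ, h]⟩)
  refine ⟨Q, fun x => (cellLcm cell w (cell x) / w x) • g (.inl (cell x)), g (.inr true),
    g (.inr false), hQ, isLengthSystem_of_cell_length fun c => g (.inl c), ?_, ?_, ?_, ?_, ?_, ?_⟩
  · intro x h
    have := Q.nsmul_eq_zero (cellLcm_div_pos cell hw x).ne' h
    have := congrArg ι this
    rw [hg, map_zero] at this
    have := congrFun this (some (cell x))
    by_cases h : cell x = cell z <;> simp [γ, h] at this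
  · intro h
    have := congrArg ι h
    rw [hg, map_zero] at this
    have := congrFun this (some (cell z))
    simp [γ, hq.ne'] at this
  · intro h
    have := congrArg ι h
    rw [hg, map_zero] at this
    have := congrFun this none
    simp [γ, hq.ne'] at this
  · apply hι
    rw [map_add, map_nsmul, hg, hg, hg]
    change γ _ + γ _ = q • γ _
    ext c
    by_cases h : c = some (cell z)
    · subst h
      simp [γ]
    · by_cases h' : c = none
      · subst h'; simp [γ]
      · simp [γ, h, h']
  · intro P φ ψ h ha hb
    refine hext P φ ψ ?_
    rintro (c | b)
    · obtain ⟨x, rfl⟩ := hc c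
      have := h x
      rw [map_nsmul, map_nsmul] at this
      exact P.nsmul_right_injective (cellLcm_div_pos cell hw x).ne' this
    · cases b
      · exact hb
      · exact ha
  · intro P l a b hl hab
    obtain ⟨d, hd⟩ := hl.exists_cell_length hw hc
    have hdz : q • d (cell z) = a + b := by rw [hab, ← hd]
    obtain ⟨φ, hφ, hloc⟩ := hex P
      -- These are the intended images of `q` times the unit vectors; the unit vectors themselves
      -- need not lie in the lattice.
      (fun o => o.elim b fun c => if c = cell z then a else q • d c)
      (Sum.elim d fun t => if t then a else b) (by
        rintro (c | t)
        · by_cases h : c = cell z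
          · subst h
            simp only [γ, Sum.elim_inl, if_true, Fintype.sum_option, Pi.single_apply, Pi.add_apply]
            rw [Finset.sum_eq_single (cell z)] <;> simp +contextual [hdz, add_comm]
          · simp [γ, h, Pi.single_apply]
        · cases t <;> simp [γ, Pi.single_apply])
    refine ⟨φ, fun x => by rw [map_nsmul, hφ]; exact hd x, hφ (.inr true), hφ (.inr false), ?_⟩
    intro hne ha hb
    refine hloc ?_
    rintro (_ | c)
    · exact hb
    · by_cases h : c = cell z
      · simpa [h] using ha
      · simp only [Option.elim, h, if_false]
        exact fun h0 => cell_length_ne_zero hc hd hne c (P.nsmul_eq_zero hq.ne' h0)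

end Universal

/-! ### Representability of opfibrations by cone stacks -/

lemma dualCone_isSimplicial_of_iso {M N : FSMon} (i : M ≅ N) (h : (dualCone M).IsSimplicial) :
    (dualCone N).IsSimplicial := by
  obtain ⟨s, hs, hli, hspan⟩ := h
  let i' : M →+ N := i.hom
  let k' : N →+ M := i.inv
  have hik : ∀ x, i' (k' x) = x := fun x =>
    DFunLike.congr_fun (show i'.comp k' = _ from i.inv_hom_id) x
  have hki : ∀ x, k' (i' x) = x := fun x =>
    DFunLike.congr_fun (show k'.comp i' = _ from i.hom_inv_id) x
  let L : (M →+ ℝ) →ₗ[ℝ] (N →+ ℝ) :=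
    { toFun := fun f => f.comp k'
      map_add' := fun _ _ => rfl
      map_smul' := fun _ _ => rfl }
  have hL : Function.Injective L := by
    intro f g hfg
    ext m
    have := DFunLike.congr_fun hfg (i' m)
    change f (k' (i' m)) = g (k' (i' m)) at this
    rwa [hki] at this
  refine ⟨L '' s, hs.image _, hli.id_imageₛ hL.injOn, ?_⟩
  have hmap : PointedCone.hull ℝ (L '' s) = PointedCone.map L (PointedCone.hull ℝ s) :=
    (Submodule.map_span (L.restrictScalars _) s).symm
  rw [hmap, hspan]
  ext f
  constructor
  · rintro ⟨g, hg, rfl⟩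
    exact fun m => hg (k' m)
  · intro hf
    let f' : N →+ ℝ := f
    refine ⟨f'.comp i', fun m => hf (i' m), ?_⟩
    change (f'.comp i').comp k' = f'
    ext m
    exact congrArg f' (hik m)

section Opfibration

variable {F : Type 1} [Category.{0} F] (p : F ⥤ FSMon)

/-- Every arrow of `F` is cocartesian. -/
def AllCocartesian : Prop :=
  ∀ {x y z : F} (φ : x ⟶ y) (ψ : x ⟶ z) (h : p.obj y ⟶ p.obj z), p.map φ ≫ h = p.map ψ →
    ∃! χ : y ⟶ z, p.map χ = h ∧ φ ≫ χ = ψ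

/-- Objects can be pushed forward along homomorphisms of monoids. -/
def HasPushforwards : Prop :=
  ∀ (x : F) (N : FSMon) (f : p.obj x ⟶ N),
    ∃ (y : F) (φ : x ⟶ y) (i : p.obj y ≅ N), p.map φ ≫ i.hom = f

/-- `d` has the unique lifting property against all arrows over local homomorphisms. -/
def IsMinimal (d : F) : Prop :=
  ∀ {z e : F} (ψ : d ⟶ z) (φ : e ⟶ z), IsLocal (p.map φ) → ∃! χ : d ⟶ e, χ ≫ φ = ψ

variable {p}

/-- Lifting the identity of `e` gives a section of `φ`; uniqueness of lifts from `d` makes it a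
two-sided inverse. -/
lemma isIso_of_isLocal {d e : F} (hd : IsMinimal p d) (he : IsMinimal p e) (φ : d ⟶ e)
    (h : IsLocal (p.map φ)) : IsIso φ := by
  obtain ⟨s, hs, _⟩ := he (𝟙 e) φ h
  obtain ⟨_, _, huniq⟩ := hd φ φ h
  exact ⟨s, (huniq (φ ≫ s) (by simp [hs])).trans (huniq (𝟙 d) (by simp)).symm, hs⟩

lemma isLocal_iso_comp {A B C : FSMon} (i : A ≅ B) {f : B ⟶ C} (hf : IsLocal f) :
    IsLocal (i.hom ≫ f) := by
  intro m hm
  have h1 : (show A →+ B from i.hom) m = 0 := hf _ hm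
  have h2 := congrArg (show B →+ A from i.inv) h1
  rw [map_zero] at h2
  rw [← h2]
  exact (DFunLike.congr_fun (show (show B →+ A from i.inv).comp (show A →+ B from i.hom) =
    AddMonoidHom.id _ from i.hom_inv_id) m).symm

lemma AllCocartesian.epi_of_isFaceMap (hc : AllCocartesian p) {x y z : F} {φ : x ⟶ y}
    (hφ : IsFaceMap (p.map φ)) {a b : y ⟶ z} (h : φ ≫ a = φ ≫ b) : a = b := by
  have hab : p.map a = p.map b := by
    have h1 : p.map φ ≫ p.map a = p.map φ ≫ p.map b := by rw [← p.map_comp, h, p.map_comp]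
    refine AddMonoidHom.ext fun n => ?_
    obtain ⟨m, rfl⟩ := hφ.1 n
    exact DFunLike.congr_fun (show (show p.obj y →+ p.obj z from p.map a).comp
      (show p.obj x →+ p.obj y from p.map φ) = (show p.obj y →+ p.obj z from p.map b).comp
      (show p.obj x →+ p.obj y from p.map φ) from h1) m
  obtain ⟨_, _, huniq⟩ := hc φ (φ ≫ a) (p.map a) (p.map_comp _ _).symm
  rw [huniq a ⟨rfl, rfl⟩, huniq b ⟨hab.symm, h.symm⟩]

/-- The lift starting at `d` kills the face killed by `φ`, because `θ` lies over a local map. Hence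
its base map descends, and so does the lift, `φ` being cocartesian. -/
lemma IsMinimal.of_isFaceMap (hc : AllCocartesian p) {d e : F} (hd : IsMinimal p d) {φ : d ⟶ e}
    (hφ : IsFaceMap (p.map φ)) : IsMinimal p e := by
  intro z x ψ θ hθ
  obtain ⟨χ₀, hχ₀, huniq⟩ := hd (φ ≫ ψ) θ hθ
  obtain ⟨j, hj⟩ := hφ.exists_desc (p.map χ₀) (by
    intro m hm
    apply hθ
    have h1 : p.map χ₀ ≫ p.map θ = p.map φ ≫ p.map ψ := by rw [← p.map_comp, hχ₀, p.map_comp]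
    have h2 := DFunLike.congr_fun (show (show p.obj x →+ p.obj z from p.map θ).comp
      (show p.obj d →+ p.obj x from p.map χ₀) = (show p.obj e →+ p.obj z from p.map ψ).comp
      (show p.obj d →+ p.obj e from p.map φ) from h1) m
    refine h2.trans ?_
    exact (congrArg (show p.obj e →+ p.obj z from p.map ψ) hm).trans (map_zero _))
  obtain ⟨χ, ⟨hχ, hφχ⟩, _⟩ := hc φ χ₀ j hj
  refine ⟨χ, hc.epi_of_isFaceMap hφ (by rw [← Category.assoc, hφχ, hχ₀]), ?_⟩
  intro χ' hχ'
  exact hc.epi_of_isFaceMap hφ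
    ((huniq (φ ≫ χ') ((Category.assoc _ _ _).trans (congrArg (φ ≫ ·) hχ'))).trans hφχ.symm)

/-- Factor the base map into a face quotient and a local map. The pushforward of `d` along the
quotient is again minimal, so the remaining arrow to `e` is invertible. -/
lemma isFaceMap_map (hc : AllCocartesian p) (hp : HasPushforwards p) {d e : F}
    (hd : IsMinimal p d) (he : IsMinimal p e) (φ : d ⟶ e) : IsFaceMap (p.map φ) := by
  obtain ⟨Q, q, j, hq, hj, hqj⟩ := exists_face_local_factorization (p.map φ)
  obtain ⟨y, θ, i, hi⟩ := hp d Q q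
  have hθ : IsFaceMap (p.map θ) := by
    have : p.map θ = q ≫ i.symm.hom := by simp [← hi]
    rw [this]
    exact hq.comp_iso _
  obtain ⟨χ, ⟨hχ, hθχ⟩, _⟩ := hc θ φ (i.hom ≫ j) (by rw [← Category.assoc, hi, hqj])
  have := isIso_of_isLocal (hd.of_isFaceMap hc hθ) he χ (by rw [hχ]; exact isLocal_iso_comp i hj)
  rw [← hθχ, p.map_comp]
  exact hθ.comp_iso (p.mapIso (asIso χ))

/-- The cone stack of the minimal objects. -/
noncomputable def minimalStack (hc : AllCocartesian p) (hp : HasPushforwards p) : ConeStack where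
  Idx := ObjectProperty.FullSubcategory (fun d : F => IsMinimal p d)
  cone := ObjectProperty.ι _ ⋙ p
  isFaceMap {d d'} e := isFaceMap_map hc hp d.property d'.property e.hom
  exists_face d N f hf := by
    obtain ⟨y, φ, i, hi⟩ := hp d.obj N f
    have hφ : IsFaceMap (p.map φ) := by
      have : p.map φ = f ≫ i.symm.hom := by simp [← hi]
      rw [this]
      exact hf.comp_iso _
    exact ⟨⟨y, IsMinimal.of_isFaceMap hc d.property hφ⟩, ObjectProperty.homMk φ, i, hi⟩
  cartesian {d d₁ d₂} e₁ e₂ h he := by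
    obtain ⟨χ, ⟨h1, h2⟩, huniq⟩ := hc e₁.hom e₂.hom h he
    exact ⟨ObjectProperty.homMk χ, ⟨h1, ObjectProperty.hom_ext _ h2⟩, fun χ' hχ' =>
      ObjectProperty.hom_ext _ (huniq χ'.hom ⟨hχ'.1, congrArg (fun t => t.hom) hχ'.2⟩)⟩

/-- The equivalence sends `(d, f)` to the pushforward of `d` along `f`. An arrow between
pushforwards determines its component on the indices as the unique lift provided by minimality,
which gives fullness and faithfulness; `hm` gives essential surjectivity. -/
theorem exists_simplicial_coneStack_represents (hc : AllCocartesian p) (hp : HasPushforwards p)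
    (hm : ∀ x : F, ∃ (d : F) (φ : d ⟶ x), IsMinimal p d ∧ (dualCone (p.obj d)).IsSimplicial ∧
      IsLocal (p.map φ)) :
    ∃ S : ConeStack, S.IsSimplicial ∧ S.Represents p := by
  refine ⟨minimalStack hc hp, ?_, ?_⟩
  · intro d
    obtain ⟨d₀, φ, hd₀, hs, hφ⟩ := hm d.obj
    have := isIso_of_isLocal hd₀ d.property φ hφ
    exact dualCone_isSimplicial_of_iso (p.mapIso (asIso φ)) hs
  · let S := minimalStack hc hp
    let dd : S.Points → F := fun x => x.obj.left.obj
    have hdd : ∀ x, IsMinimal p (dd x) := fun x => x.obj.left.property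
    let rr : S.Points → FSMon := fun x => x.obj.right
    let ff : ∀ x : S.Points, p.obj (dd x) ⟶ rr x := fun x => x.obj.hom
    have hff : ∀ x, IsLocal (ff x) := fun x => x.property
    have hpp : ∀ x : S.Points, ∃ (y : F) (φ : dd x ⟶ y) (i : p.obj y ≅ rr x),
        p.map φ ≫ i.hom = ff x := fun x => hp _ _ _
    choose yy φφ ii hii using hpp
    have hφφ : ∀ x, IsLocal (p.map (φφ x)) := by
      intro x m hm
      apply hff x
      rw [← hii]
      exact (congrArg (show p.obj (yy x) →+ rr x from (ii x).hom) hm).trans (map_zero _)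
    have hχ : ∀ {x x' : S.Points} (m : x ⟶ x'), ∃! χ : yy x ⟶ yy x',
        p.map χ = (ii x).hom ≫ m.hom.right ≫ (ii x').inv ∧
          φφ x ≫ χ = m.hom.left.hom ≫ φφ x' := by
      intro x x' m
      refine hc _ _ _ ?_
      have hw : p.map m.hom.left.hom ≫ ff x' = ff x ≫ m.hom.right := m.hom.w
      rw [← Category.assoc, hii, ← Category.assoc, ← hw, Category.assoc, ← hii, Category.assoc,
        Iso.hom_inv_id, Category.comp_id, p.map_comp]
    choose χ hχ1 hχ2 using fun {x x' : S.Points} (m : x ⟶ x') => (hχ m)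
    have hχp : ∀ {x x' : S.Points} (m : x ⟶ x'),
        p.map (χ m) ≫ (ii x').hom = (ii x).hom ≫ m.hom.right := by
      intro x x' m
      rw [(hχ1 m).1]
      simp
    let G : S.Points ⥤ F :=
      { obj := yy
        map := χ
        map_id := fun x => ((hχ2 (𝟙 x)) (𝟙 _)
          ⟨(p.map_id _).trans (show (ii x).hom ≫ 𝟙 (rr x) ≫ (ii x).inv = 𝟙 _ by simp).symm,
            (Category.comp_id _).trans (Category.id_comp _).symm⟩).symm
        map_comp := fun {x y z} f g => ((hχ2 (f ≫ g)) _ (by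
          refine ⟨?_, ?_⟩
          · rw [p.map_comp, (hχ1 f).1, (hχ1 g).1]
            simp
          · rw [← Category.assoc, (hχ1 f).2, Category.assoc, (hχ1 g).2]
            exact (Category.assoc _ _ _).symm)).symm }
    have hfaith : G.Faithful := ⟨by
      intro x x' a b hab
      have hab' : χ a = χ b := hab
      apply ObjectProperty.hom_ext
      apply CommaMorphism.ext
      · apply ObjectProperty.hom_ext
        obtain ⟨_, _, hu⟩ := hdd x (φφ x ≫ χ a) (φφ x') (hφφ x')
        rw [hu _ (hχ1 a).2.symm, hu b.hom.left.hom (by rw [hab', (hχ1 b).2])]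
      · rw [← cancel_epi (ii x).hom]
        exact (hχp a).symm.trans ((congrArg (fun t => p.map t ≫ (ii x').hom) hab').trans (hχp b))⟩
    have hfull : G.Full := ⟨by
      intro x x' k
      obtain ⟨l, hl, _⟩ := hdd x (φφ x ≫ k) (φφ x') (hφφ x')
      have hw : p.map l ≫ ff x' = ff x ≫ ((ii x).inv ≫ p.map k ≫ (ii x').hom) := by
        rw [← hii x', ← hii x, ← Category.assoc, ← p.map_comp, hl, p.map_comp]
        simp
      let m : x ⟶ x' := ObjectProperty.homMk
        { left := ObjectProperty.homMk l
          right := (ii x).inv ≫ p.map k ≫ (ii x').hom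
          w := hw }
      refine ⟨m, ((hχ2 m) k ⟨?_, hl.symm⟩).symm⟩
      change _ = (ii x).hom ≫ ((ii x).inv ≫ p.map k ≫ (ii x').hom) ≫ (ii x').inv
      simp⟩
    have hess : G.EssSurj := ⟨by
      intro y
      obtain ⟨d, φ, hd, _, hφ⟩ := hm y
      let x : S.Points := ⟨{ left := ⟨d, hd⟩, right := p.obj y, hom := p.map φ }, hφ⟩
      have h1 : p.map (φφ x) ≫ (ii x).hom = p.map φ := hii x
      obtain ⟨a, ⟨ha1, ha2⟩, _⟩ := hc (φφ x) φ (ii x).hom h1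
      obtain ⟨b, ⟨hb1, hb2⟩, _⟩ := hc φ (φφ x) (ii x).inv (by rw [← h1]; simp)
      refine ⟨x, ⟨a, b, ?_, ?_⟩⟩
      · obtain ⟨_, _, hu⟩ := hc (φφ x) (φφ x) (𝟙 _) (by simp)
        rw [hu (a ≫ b) ⟨by rw [p.map_comp, ha1, hb1]; exact (ii x).hom_inv_id,
            by rw [← Category.assoc, ha2, hb2]⟩,
          hu (𝟙 _) ⟨by simp, by simp⟩]
      · obtain ⟨_, _, hu⟩ := hc φ φ (𝟙 _) (by simp)
        rw [hu (b ≫ a) ⟨by rw [p.map_comp, ha1, hb1]; exact (ii x).inv_hom_id,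
            by rw [← Category.assoc, hb2, ha2]⟩,
          hu (𝟙 _) ⟨by simp, by simp⟩]⟩
    have : G.IsEquivalence := { faithful := hfaith, full := hfull, essSurj := hess }
    exact ⟨G.asEquivalence, ⟨NatIso.ofComponents (fun x => ii x) (fun m => hχp m)⟩⟩

end Opfibration

/-! ### Cocartesian arrows of the universal family -/

namespace Contraction

variable {M N P : Type} [AddCommMonoid M] [AddCommMonoid N] [AddCommMonoid P] {n : ℕ}
  {g : M →+ N} {h : N →+ P} {k : M →+ P}
  {Γ : TropCurve M n} {Δ : TropCurve N n} {Θ : TropCurve P n}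

lemma vtx_eq_of_vtx_eq (φ : Contraction g Γ Δ) (ψ : Contraction k Γ Θ)
    (hk : ∀ m, k m = h (g m)) {v w : Γ.V} (hvw : φ.vtx v = φ.vtx w) : ψ.vtx v = ψ.vtx w :=
  (ψ.vtx_eq_iff v w).2 (((φ.vtx_eq_iff v w).1 hvw).lift (fun x => x)
    fun _ _ ⟨d, hd, h1, h2⟩ => ⟨d, by rw [hk, hd, map_zero], h1, h2⟩)

/-- Everything that `φ` contracts is contracted by `ψ`, so `ψ` factors through the vertices of `Δ`,
and the edges surviving `ψ` are among those surviving `φ`. -/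
theorem exists_desc (φ : Contraction g Γ Δ) (ψ : Contraction k Γ Θ)
    (hk : ∀ m, k m = h (g m)) :
    ∃ χ : Contraction h Δ Θ, (∀ v, χ.vtx (φ.vtx v) = ψ.vtx v) ∧
      ∀ e, φ.dart (χ.dart e) = ψ.dart e := by
  choose r hr using φ.vtx_surj
  have hd : ∀ e, ∃ e', φ.dart e' = ψ.dart e := fun e =>
    (φ.dart_range _).2 fun h0 => (ψ.dart_range _).1 ⟨e, rfl⟩ (by rw [hk, h0, map_zero])
  choose dd hdd using hd
  have hv : ∀ v, ψ.vtx (r (φ.vtx v)) = ψ.vtx v := fun v =>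
    vtx_eq_of_vtx_eq φ ψ hk (hr _)
  have hlen : ∀ d, h (Δ.len d) = k (Γ.len (φ.dart d)) := fun d => by rw [φ.dart_len, hk]
  have hsrc : ∀ d, ψ.vtx (r (Δ.src d)) = ψ.vtx (Γ.src (φ.dart d)) := fun d => by
    rw [← φ.dart_src, hv]
  have htgt : ∀ d, ψ.vtx (r (Δ.tgt d)) = ψ.vtx (Γ.tgt (φ.dart d)) := fun d => by
    rw [← φ.dart_tgt, hv]
  refine ⟨{
    vtx := fun w => ψ.vtx (r w)
    dart := dd
    dart_inj := fun a b hab => ψ.dart_inj (by rw [← hdd, ← hdd, hab])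
    dart_range := fun d => by
      rw [hlen, ← ψ.dart_range]
      exact exists_congr fun e => by rw [← hdd, φ.dart_inj.eq_iff]
    dart_rev := fun e => φ.dart_inj (by rw [hdd, ψ.dart_rev, φ.dart_rev, hdd])
    dart_src := fun e => by rw [hsrc, hdd, ψ.dart_src]
    dart_len := fun e => by rw [ψ.dart_len, hlen, hdd]
    vtx_leg := fun i => by rw [← φ.vtx_leg, hv, ψ.vtx_leg]
    vtx_surj := fun t => by
      obtain ⟨v, rfl⟩ := ψ.vtx_surj t
      exact ⟨φ.vtx v, hv v⟩
    vtx_eq_iff := fun v w => ?_ }, hv, hdd⟩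
  constructor
  · intro hvw
    have := ((ψ.vtx_eq_iff _ _).1 hvw).lift' (p := fun a b => ∃ d, h (Δ.len d) = 0 ∧
      Δ.src d = a ∧ Δ.tgt d = b) φ.vtx (by
        rintro _ _ ⟨d, hd, rfl, rfl⟩
        change Relation.ReflTransGen _ _ _
        by_cases h0 : g (Γ.len d) = 0
        · rw [φ.contracted h0]
        · obtain ⟨e, rfl⟩ := (φ.dart_range d).2 h0
          exact .single ⟨e, by rw [hlen, hd], (φ.dart_src e).symm, (φ.dart_tgt e).symm⟩)
    rwa [Function.onFun, hr, hr] at this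
  · intro hvw
    induction hvw with
    | refl => rfl
    | tail _ hs ih =>
      obtain ⟨d, hd, rfl, rfl⟩ := hs
      rw [ih, hsrc, htgt]
      exact ψ.contracted (by rw [← hlen, hd])

lemma vtx_injective (φ : Contraction g Γ Δ) (hg : ∀ m, g m = 0 → m = 0) :
    Function.Injective φ.vtx := by
  intro v w hvw
  have := (φ.vtx_eq_iff v w).1 hvw
  induction this with
  | refl => rfl
  | tail _ hs _ =>
    obtain ⟨d, hd, _⟩ := hs
    exact absurd (hg _ hd) (Γ.len_ne d)

lemma dart_surjective (φ : Contraction g Γ Δ) (hg : ∀ m, g m = 0 → m = 0) :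
    Function.Surjective φ.dart := fun d =>
  (φ.dart_range d).2 fun h0 => Γ.len_ne d (hg _ h0)

/-- Over a local homomorphism nothing is contracted: `φ` is bijective on vertices and on oriented
edges and can be inverted. Only the lengths over `N` remain as a condition. -/
theorem exists_lift (φ : Contraction h Δ Θ) (ψ : Contraction k Γ Θ)
    (hh : ∀ m, h m = 0 → m = 0) (hk : ∀ m, k m = h (g m))
    (hlen : ∀ e, Δ.len (φ.dart e) = g (Γ.len (ψ.dart e))) :
    ∃ χ : Contraction g Γ Δ, (∀ v, φ.vtx (χ.vtx v) = ψ.vtx v) ∧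
      ∀ e, χ.dart (φ.dart e) = ψ.dart e := by
  have hvi := φ.vtx_injective hh
  choose r hr using φ.vtx_surj
  choose s hs using φ.dart_surjective hh
  have hsd : ∀ e, s (φ.dart e) = e := fun e => φ.dart_inj (hs _)
  have hk0 : ∀ m, g m = 0 ↔ k m = 0 := fun m => by
    rw [hk]
    exact ⟨fun h0 => by rw [h0, map_zero], fun h0 => hh _ h0⟩
  refine ⟨{
    vtx := fun v => r (ψ.vtx v)
    dart := fun e => ψ.dart (s e)
    dart_inj := fun a b hab => by rw [← hs a, ← hs b, ψ.dart_inj hab]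
    dart_range := fun d => by
      rw [Ne, hk0, ← Ne, ← ψ.dart_range]
      exact ⟨fun ⟨e, he⟩ => ⟨_, he⟩, fun ⟨e, he⟩ => ⟨φ.dart e, by rw [hsd, he]⟩⟩
    dart_rev := fun e => by
      rw [← ψ.dart_rev]
      congr 1
      exact φ.dart_inj (by rw [hs, φ.dart_rev, hs])
    dart_src := fun e => hvi (by
      rw [hr, ψ.dart_src, ← φ.dart_src, hs])
    dart_len := fun e => by rw [← hlen, hs]
    vtx_leg := fun i => hvi (by rw [hr, ψ.vtx_leg, φ.vtx_leg])
    vtx_surj := fun w => by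
      obtain ⟨v, hv⟩ := ψ.vtx_surj (φ.vtx w)
      exact ⟨v, hvi (by rw [hr, hv])⟩
    vtx_eq_iff := fun v w => by
      simp only [hk0]
      rw [← ψ.vtx_eq_iff]
      exact ⟨fun h1 => by rw [← hr (ψ.vtx v), h1, hr], fun h1 => by rw [h1]⟩ },
    fun v => hr _, fun e => congrArg ψ.dart (hsd e)⟩

end Contraction

/-! #### Points -/

namespace Point

variable {M N P : Type} [AddCommMonoid M] [AddCommMonoid N] [AddCommMonoid P] {n : ℕ}
  {g : M →+ N} {h : N →+ P} {k : M →+ P}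
  {Γ : TropCurve M n} {Δ : TropCurve N n} {Θ : TropCurve P n}

lemma mapsTo_vertex_iff {c : Contraction g Γ Δ} {v : Γ.V} {q : Point Δ} :
    MapsTo c (.vertex v) q ↔ q = .vertex (c.vtx v) := by
  constructor
  · intro h
    cases h
    rfl
  · rintro rfl
    exact .vertex v

lemma mapsTo_edge_vertex_iff {c : Contraction g Γ Δ} {d : Γ.D} {a b : M} {ha : a ≠ 0} {hb : b ≠ 0}
    {hab : a + b = Γ.len d} {w : Δ.V} :
    MapsTo c (.edge d a b ha hb hab) (.vertex w) ↔
      (g a = 0 ∧ w = c.vtx (Γ.src d)) ∨ (g b = 0 ∧ w = c.vtx (Γ.tgt d)) := by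
  constructor
  · intro h
    cases h with
    | source _ _ _ _ _ _ h => exact .inl ⟨h, rfl⟩
    | target _ _ _ _ _ _ h => exact .inr ⟨h, rfl⟩
  · rintro (⟨h, rfl⟩ | ⟨h, rfl⟩)
    · exact .source _ _ _ _ _ _ h
    · exact .target _ _ _ _ _ _ h

lemma mapsTo_edge_edge_iff {c : Contraction g Γ Δ} {d : Γ.D} {a b : M} {ha : a ≠ 0} {hb : b ≠ 0}
    {hab : a + b = Γ.len d} {e : Δ.D} {a' b' : N} {ha' : a' ≠ 0} {hb' : b' ≠ 0}
    {hab' : a' + b' = Δ.len e} :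
    MapsTo c (.edge d a b ha hb hab) (.edge e a' b' ha' hb' hab') ↔
      (c.dart e = d ∧ a' = g a ∧ b' = g b) ∨ (c.dart e = Γ.rev d ∧ a' = g b ∧ b' = g a) := by
  constructor
  · intro h
    cases h with
    | edge _ _ _ _ _ _ _ _ _ _ h => exact .inl ⟨h, rfl, rfl⟩
    | flip _ _ _ _ _ _ _ _ _ _ h => exact .inr ⟨h, rfl, rfl⟩
  · rintro (⟨h, rfl, rfl⟩ | ⟨h, rfl, rfl⟩)
    · exact .edge _ _ _ _ _ _ _ _ _ _ h
    · exact .flip _ _ _ _ _ _ _ _ _ _ h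

lemma MapsTo.desc {φ : Contraction g Γ Δ} {ψ : Contraction k Γ Θ} {χ : Contraction h Δ Θ}
    (hk : ∀ m, k m = h (g m)) (hv : ∀ v, χ.vtx (φ.vtx v) = ψ.vtx v)
    (hd : ∀ e, φ.dart (χ.dart e) = ψ.dart e) {p : Point Γ} {q : Point Δ} {r : Point Θ}
    (hpq : p.MapsTo φ q) (hpr : p.MapsTo ψ r) : q.MapsTo χ r := by
  cases p with
  | vertex v =>
    rw [mapsTo_vertex_iff] at hpq hpr
    subst hpq hpr
    rw [mapsTo_vertex_iff, hv]
  | edge d a b ha hb hab =>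
    have hka : g a = 0 → k a = 0 := fun h0 => by rw [hk, h0, map_zero]
    have hkb : g b = 0 → k b = 0 := fun h0 => by rw [hk, h0, map_zero]
    -- When both halves of the edge are contracted, the point may be sent to either end; the two
    -- ends then coincide.
    have hcon : k a = 0 → k b = 0 → ψ.vtx (Γ.src d) = ψ.vtx (Γ.tgt d) := fun h1 h2 =>
      ψ.contracted (by rw [← hab, map_add, h1, h2, add_zero])
    have hlen : ∀ e, ψ.dart e = d → Θ.len e = k a + k b := fun e he => by
      rw [ψ.dart_len, he, ← hab, map_add]
    have hlen' : ∀ e, ψ.dart e = Γ.rev d → Θ.len e = k a + k b := fun e he => by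
      rw [ψ.dart_len, he, Γ.len_rev, ← hab, map_add]
    cases q with
    | vertex w =>
      rw [mapsTo_edge_vertex_iff] at hpq
      rw [mapsTo_vertex_iff]
      cases r with
      | vertex t =>
        rw [mapsTo_edge_vertex_iff] at hpr
        rcases hpq with ⟨h1, rfl⟩ | ⟨h1, rfl⟩ <;> rcases hpr with ⟨h2, rfl⟩ | ⟨h2, rfl⟩
        · rw [hv]
        · rw [hv, hcon (hka h1) h2]
        · rw [hv, hcon h2 (hkb h1)]
        · rw [hv]
      | edge e a' b' ha' hb' hab' =>
        rw [mapsTo_edge_edge_iff] at hpr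
        rcases hpq with ⟨h1, rfl⟩ | ⟨h1, rfl⟩ <;> rcases hpr with ⟨_, rfl, rfl⟩ | ⟨_, rfl, rfl⟩
        · exact absurd (hka h1) ha'
        · exact absurd (hka h1) hb'
        · exact absurd (hkb h1) hb'
        · exact absurd (hkb h1) ha'
    | edge e a' b' ha' hb' hab' =>
      rw [mapsTo_edge_edge_iff] at hpq
      have hsrc : φ.dart e = d → χ.vtx (Δ.src e) = ψ.vtx (Γ.src d) := by
        rintro rfl
        rw [← φ.dart_src, hv]
      have htgt : φ.dart e = d → χ.vtx (Δ.tgt e) = ψ.vtx (Γ.tgt d) := by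
        rintro rfl
        rw [← φ.dart_tgt, hv]
      have hsrc' : φ.dart e = Γ.rev d → χ.vtx (Δ.src e) = ψ.vtx (Γ.tgt d) := by
        intro he
        rw [← φ.dart_src, hv, he]
        rfl
      have htgt' : φ.dart e = Γ.rev d → χ.vtx (Δ.tgt e) = ψ.vtx (Γ.src d) := by
        intro he
        rw [← φ.dart_tgt, hv, he, TropCurve.tgt, Γ.rev_rev]
      cases r with
      | vertex t =>
        rw [mapsTo_edge_vertex_iff] at hpr
        rw [mapsTo_edge_vertex_iff]
        rcases hpq with ⟨h1, rfl, rfl⟩ | ⟨h1, rfl, rfl⟩ <;>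
          rcases hpr with ⟨h2, rfl⟩ | ⟨h2, rfl⟩
        · exact .inl ⟨by rw [← hk, h2], (hsrc h1).symm⟩
        · exact .inr ⟨by rw [← hk, h2], (htgt h1).symm⟩
        · exact .inr ⟨by rw [← hk, h2], (htgt' h1).symm⟩
        · exact .inl ⟨by rw [← hk, h2], (hsrc' h1).symm⟩
      | edge e' a'' b'' ha'' hb'' hab'' =>
        rw [mapsTo_edge_edge_iff] at hpr
        rw [mapsTo_edge_edge_iff]
        rcases hpq with ⟨h1, rfl, rfl⟩ | ⟨h1, rfl, rfl⟩ <;>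
          rcases hpr with ⟨h2, rfl, rfl⟩ | ⟨h2, rfl, rfl⟩
        · exact .inl ⟨φ.dart_inj (by rw [hd, h1, h2]), hk _, hk _⟩
        · exact .inr ⟨φ.dart_inj (by rw [hd, φ.dart_rev, h1, h2]), hk _, hk _⟩
        · exact .inr ⟨φ.dart_inj (by rw [hd, φ.dart_rev, h1, h2, Γ.rev_rev]), hk _, hk _⟩
        · exact .inl ⟨φ.dart_inj (by rw [hd, h1, h2]), hk _, hk _⟩

end Point

/-! #### Positions on a tropical line -/

namespace TropLine

lemma exists_pos_sub {P : FSMon} (X : TropLine P) {i j : Fin (X.k + 1)} (hij : i ≤ j) :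
    ∃ m : P, X.pos j - X.pos i = toGp m ∧ (i ≠ j → m ≠ 0) := by
  induction j using Fin.induction with
  | zero =>
    obtain rfl : i = 0 := le_antisymm hij (Fin.zero_le _)
    exact ⟨0, by simp, fun h => absurd rfl h⟩
  | succ j ih =>
    rcases hij.eq_or_lt with rfl | hlt
    · exact ⟨0, by simp, fun h => absurd rfl h⟩
    · obtain ⟨m, hm, _⟩ := ih (Fin.le_castSucc_iff.2 hlt)
      refine ⟨X.len j + m, ?_, fun _ h0 => X.len_ne j (P.sharp _ _ h0)⟩
      rw [map_add, ← hm, ← X.pos_succ, sub_add_sub_cancel]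

lemma pos_injective_of_local {P Q : FSMon} (X : TropLine P) (g : P →+ Q) (hg : ∀ m, g m = 0 → m = 0)
    {i j : Fin (X.k + 1)} (h : gpMap g (X.pos i) = gpMap g (X.pos j)) : i = j := by
  wlog hij : i ≤ j generalizing i j
  · exact (this h.symm (le_of_not_ge hij)).symm
  by_contra hne
  obtain ⟨m, hm, hm0⟩ := X.exists_pos_sub hij
  refine hm0 hne (hg _ (toGp_injective Q ?_))
  rw [← gpMap_toGp, ← hm, map_sub, h, sub_self, map_zero]

lemma pos_injective {P : FSMon} (X : TropLine P) : Function.Injective X.pos := fun i j h =>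
  X.pos_injective_of_local (AddMonoidHom.id P) (fun _ h => h) (by rw [h])

lemma le_of_gpLE {P : FSMon} (X : TropLine P) {i j : Fin (X.k + 1)}
    (h : GpLE (X.pos i) (X.pos j)) : i ≤ j := by
  by_contra hij
  push Not at hij
  obtain ⟨m, hm, hm0⟩ := X.exists_pos_sub hij.le
  obtain ⟨m', hm'⟩ := h
  exact hm0 hij.ne (toGp_add_toGp_eq_zero P hm (by rw [neg_sub, hm']))

end TropLine

/-! #### Morphisms of `Σ_Rub` -/

namespace RubHom

variable {n : ℕ} [NeZero n] {ξ η ζ : Rub n}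

open Classical in
-- The sublist condition already forces equality: a surviving edge of the path of `ξ` comes from
-- some path of `η`, and since it lies in only one path of `ξ`, this can only be the path of `e`.
lemma map_path_eq (a : RubHom ξ η) (e : η.pt.curve.D) :
    (η.pt.sub.path e).map a.eqd.dart =
      (ξ.pt.sub.path (a.con.dart e)).filter (fun d => a.base (ξ.pt.eqd.len d) ≠ 0) := by
  have hs : List.Sublist ((η.pt.sub.path e).map a.eqd.dart)
      ((ξ.pt.sub.path (a.con.dart e)).filter (fun d => a.base (ξ.pt.eqd.len d) ≠ 0)) := by
    have := (a.map_path e).filter (fun d => a.base (ξ.pt.eqd.len d) ≠ 0)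
    rwa [List.filter_eq_self.2] at this
    intro d hd
    obtain ⟨d', _, rfl⟩ := List.mem_map.1 hd
    simpa using (a.eqd.dart_range _).1 ⟨d', rfl⟩
  refine hs.eq_of_length_le (List.Nodup.subperm
    ((ξ.pt.sub.path_nodup _).filter _) ?_).length_le
  intro d hd
  rw [List.mem_filter] at hd
  obtain ⟨hd, h0⟩ := hd
  obtain ⟨d', rfl⟩ := (a.eqd.dart_range d).2 (by simpa using h0)
  obtain ⟨e', he', _⟩ := η.pt.sub.cover d'
  have h1 := (a.map_path e').subset (List.mem_map_of_mem he')
  have h2 := (ξ.pt.sub.cover (a.eqd.dart d')).unique h1 hd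
  rw [a.con.dart_inj h2] at he'
  exact List.mem_map_of_mem he'

theorem exists_desc (a : RubHom ξ η) (b : RubHom ξ ζ) (h : η.base →+ ζ.base)
    (hk : ∀ m, b.base m = h (a.base m)) :
    ∃ χ : RubHom η ζ, χ.base = h ∧ (∀ v, χ.con.vtx (a.con.vtx v) = b.con.vtx v) ∧
      (∀ e, a.con.dart (χ.con.dart e) = b.con.dart e) ∧
      (∀ v, χ.eqd.vtx (a.eqd.vtx v) = b.eqd.vtx v) ∧
      (∀ e, a.eqd.dart (χ.eqd.dart e) = b.eqd.dart e) := by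
  obtain ⟨c, hcv, hcd⟩ := a.con.exists_desc b.con hk
  obtain ⟨c', hcv', hcd'⟩ := a.eqd.exists_desc b.eqd hk
  have hgp : ∀ x, gpMap b.base x = gpMap h (gpMap a.base x) := fun x => by
    rw [← gpMap_comp]
    congr 1
    exact congrArg _ (AddMonoidHom.ext hk)
  refine ⟨{
    base := h
    con := c
    eqd := c'
    map_α := fun v => by
      obtain ⟨v, rfl⟩ := a.con.vtx_surj v
      rw [hcv, b.map_α, a.map_α, hgp]
    map_vtx := fun v => by
      obtain ⟨v, rfl⟩ := a.con.vtx_surj v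
      rw [← a.map_vtx, hcv', b.map_vtx, hcv]
    map_path := fun e => ?_
    map_line := by
      rw [b.map_line, a.map_line, Set.image_image]
      simp only [hgp]
    map_β := fun x => by
      obtain ⟨x, rfl⟩ := a.eqd.vtx_surj x
      rw [hcv', b.map_β, a.map_β, hgp] }, rfl, hcv, hcd, hcv', hcd'⟩
  classical
  have h1 : List.Sublist (((ζ.pt.sub.path e).map c'.dart).map a.eqd.dart)
      ((η.pt.sub.path (c.dart e)).map a.eqd.dart) := by
    rw [List.map_map, show a.eqd.dart ∘ c'.dart = b.eqd.dart from funext hcd', b.map_path_eq,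
      a.map_path_eq, hcd]
    refine List.monotone_filter_right _ fun d hd => ?_
    simp only [ne_eq, decide_not, Bool.not_eq_eq_eq_not, Bool.not_true, decide_eq_false_iff_not]
      at hd ⊢
    exact fun h0 => hd (by rw [hk, h0, map_zero])
  obtain ⟨l, hl, hle⟩ := List.sublist_map_iff.1 h1
  rwa [List.map_injective_iff.2 a.eqd.dart_inj hle]

lemma hom_ext {a b : RubHom ξ η} (h : ∀ m, a.base m = b.base m)
    (h1 : ∀ v, a.con.vtx v = b.con.vtx v) (h2 : ∀ e, a.con.dart e = b.con.dart e)
    (h3 : ∀ v, a.eqd.vtx v = b.eqd.vtx v) (h4 : ∀ e, a.eqd.dart e = b.eqd.dart e) : a = b := by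
  obtain ⟨ab, ac, ae, _, _, _, _, _⟩ := a
  obtain ⟨bb, bc, be, _, _, _, _, _⟩ := b
  obtain rfl : ab = bb := AddMonoidHom.ext h
  obtain rfl : ac = bc := Contraction.ext (funext h1) (funext h2)
  obtain rfl : ae = be := Contraction.ext (funext h3) (funext h4)
  rfl

lemma path_eq_map_of_local (φ : RubHom η ζ) (hφ : ∀ m, φ.base m = 0 → m = 0) (e : ζ.pt.curve.D) :
    η.pt.sub.path (φ.con.dart e) = (ζ.pt.sub.path e).map φ.eqd.dart := by
  classical
  rw [φ.map_path_eq, List.filter_eq_self.2]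
  intro d _
  simpa using fun h0 => η.pt.eqd.len_ne d (hφ _ h0)

/-- The combinatorics transfers through the bijections given by `φ`. What must be supplied over
`η.base` is metric: the lengths on the model and the positions on the line, from which the lengths
and the function on the curve follow. -/
theorem exists_lift (φ : RubHom η ζ) (ψ : RubHom ξ ζ) (hφ : ∀ m, φ.base m = 0 → m = 0)
    (h : ξ.base →+ η.base) (hk : ∀ m, ψ.base m = φ.base (h m))
    (hlen : ∀ e, η.pt.eqd.len (φ.eqd.dart e) = h (ξ.pt.eqd.len (ψ.eqd.dart e)))
    (hpos : ∀ i, ∃ j, η.pt.line.pos j = gpMap h (ξ.pt.line.pos i)) :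
    ∃ χ : RubHom ξ η, χ.base = h ∧ (∀ v, φ.con.vtx (χ.con.vtx v) = ψ.con.vtx v) ∧
      (∀ e, χ.con.dart (φ.con.dart e) = ψ.con.dart e) ∧
      (∀ v, φ.eqd.vtx (χ.eqd.vtx v) = ψ.eqd.vtx v) ∧
      (∀ e, χ.eqd.dart (φ.eqd.dart e) = ψ.eqd.dart e) := by
  classical
  have hgp : ∀ x, gpMap ψ.base x = gpMap φ.base (gpMap h x) := fun x => by
    rw [← gpMap_comp]
    congr 1
    exact congrArg _ (AddMonoidHom.ext hk)
  have hk0 : ∀ m, h m = 0 ↔ ψ.base m = 0 := fun m => by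
    rw [hk]
    exact ⟨fun h0 => by rw [h0, map_zero], fun h0 => hφ _ h0⟩
  -- Both sides are sums over paths of the model; the path for `ξ` has additional edges, but `h`
  -- kills their lengths.
  have hclen : ∀ e, η.pt.curve.len (φ.con.dart e) = h (ξ.pt.curve.len (ψ.con.dart e)) := by
    intro e
    rw [← η.pt.sub.len_sum, ← ξ.pt.sub.len_sum, φ.path_eq_map_of_local hφ, List.map_map,
      map_list_sum, List.map_map]
    have h1 : (ζ.pt.sub.path e).map (η.pt.eqd.len ∘ φ.eqd.dart) =
        ((ζ.pt.sub.path e).map ψ.eqd.dart).map (h ∘ ξ.pt.eqd.len) := by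
      rw [List.map_map]
      exact List.map_congr_left fun d _ => hlen d
    rw [h1, ψ.map_path_eq]
    generalize ξ.pt.sub.path (ψ.con.dart e) = l
    induction l with
    | nil => rfl
    | cons d l ih =>
      by_cases h0 : ψ.base (ξ.pt.eqd.len d) = 0
      · rw [List.filter_cons_of_neg (by simpa using h0), ih]
        simp [(hk0 _).2 h0]
      · rw [List.filter_cons_of_pos (by simpa using h0), List.map_cons, List.sum_cons, ih]
        simp
  obtain ⟨c, hcv, hcd⟩ := φ.con.exists_lift ψ.con hφ hk hclen
  obtain ⟨c', hcv', hcd'⟩ := φ.eqd.exists_lift ψ.eqd hφ hk hlen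
  have hβ : ∀ x, η.pt.line.pos (η.pt.β (c'.vtx x)) = gpMap h (ξ.pt.line.pos (ξ.pt.β x)) := by
    intro x
    obtain ⟨j, hj⟩ := hpos (ξ.pt.β x)
    rw [← hj]
    congr 1
    apply η.pt.line.pos_injective_of_local φ.base hφ
    rw [← φ.map_β, hcv', ψ.map_β, hgp, hj]
  have hvtx : ∀ v, c'.vtx (ξ.pt.sub.vtx v) = η.pt.sub.vtx (c.vtx v) := fun v =>
    φ.eqd.vtx_injective hφ (by rw [hcv', ψ.map_vtx, φ.map_vtx, hcv])
  refine ⟨{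
    base := h
    con := c
    eqd := c'
    map_α := fun v => by
      rw [← η.pt.isLift.1, ← ξ.pt.isLift.1, ← hvtx]
      exact hβ _
    map_vtx := hvtx
    map_path := fun e => by
      obtain ⟨e, rfl⟩ := φ.con.dart_surjective hφ e
      rw [φ.path_eq_map_of_local hφ, List.map_map, hcd,
        show c'.dart ∘ φ.eqd.dart = ψ.eqd.dart from funext hcd']
      exact ψ.map_path e
    map_line := by
      apply Set.Subset.antisymm
      · rintro _ ⟨j, rfl⟩
        have h1 : gpMap φ.base (η.pt.line.pos j) ∈ Set.range ζ.pt.line.pos := by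
          rw [φ.map_line]
          exact ⟨_, ⟨j, rfl⟩, rfl⟩
        rw [ψ.map_line] at h1
        obtain ⟨_, ⟨i, rfl⟩, hi⟩ := h1
        obtain ⟨j', hj'⟩ := hpos i
        rw [hgp, ← hj'] at hi
        rw [← η.pt.line.pos_injective_of_local φ.base hφ hi, hj']
        exact ⟨_, ⟨i, rfl⟩, rfl⟩
      · rintro _ ⟨_, ⟨i, rfl⟩, rfl⟩
        obtain ⟨j, hj⟩ := hpos i
        exact ⟨j, hj⟩
    map_β := hβ }, rfl, hcv, hcd, hcv', hcd'⟩

end RubHom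

theorem univRub_allCocartesian (n : ℕ) [NeZero n] : AllCocartesian (UnivRub.proj n) := by
  intro ξ η ζ a b h hab
  have hk : ∀ m, RubHom.base b.1 m = (show η.rub.base →+ ζ.rub.base from h) (RubHom.base a.1 m) :=
    fun m => (DFunLike.congr_fun (show AddMonoidHom.comp (show η.rub.base →+ ζ.rub.base from h)
      (RubHom.base a.1) = RubHom.base b.1 from hab) m).symm
  obtain ⟨χ, hχ, h1, h2, h3, h4⟩ := RubHom.exists_desc a.1 b.1 _ hk
  subst hχ
  refine ⟨⟨χ, Point.MapsTo.desc hk h3 h4 a.2 b.2⟩, ⟨rfl, ?_⟩, ?_⟩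
  · exact Subtype.ext (RubHom.hom_ext (fun m => (hk m).symm) h1 h2 h3 h4)
  · rintro ⟨χ', hχ'⟩ ⟨h5, h6⟩
    have h7 : a.1 ≫ χ' = b.1 := congrArg Subtype.val h6
    refine Subtype.ext (RubHom.hom_ext (fun m => ?_) (fun v => ?_) (fun e => a.1.con.dart_inj ?_)
      (fun v => ?_) (fun e => a.1.eqd.dart_inj ?_))
    · exact DFunLike.congr_fun (show RubHom.base χ' = χ.base from h5) m
    · obtain ⟨v, rfl⟩ := a.1.con.vtx_surj v
      exact (congrArg (fun t : RubHom ξ.rub ζ.rub => t.con.vtx v) h7).trans (h1 v).symm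
    · exact (congrArg (fun t : RubHom ξ.rub ζ.rub => t.con.dart e) h7).trans (h2 e).symm
    · obtain ⟨v, rfl⟩ := a.1.eqd.vtx_surj v
      exact (congrArg (fun t : RubHom ξ.rub ζ.rub => t.eqd.vtx v) h7).trans (h3 v).symm
    · exact (congrArg (fun t : RubHom ξ.rub ζ.rub => t.eqd.dart e) h7).trans (h4 e).symm

/-! ### Contraction of curves -/

namespace TropCurve

section

variable {M N : Type} [AddCommMonoid M] [AddCommMonoid N] {n : ℕ}

/-- Two vertices are related if they are joined by edges whose length is killed by `g`. -/
def Contr (Γ : TropCurve M n) (g : M →+ N) : Γ.V → Γ.V → Prop :=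
  Relation.ReflTransGen (fun a b => ∃ d, g (Γ.len d) = 0 ∧ Γ.src d = a ∧ Γ.tgt d = b)

variable {Γ : TropCurve M n} {g : M →+ N}

lemma tgt_rev (Γ : TropCurve M n) (d : Γ.D) : Γ.tgt (Γ.rev d) = Γ.src d := by
  rw [tgt, Γ.rev_rev]

lemma rev_injective (Γ : TropCurve M n) : Function.Injective Γ.rev := fun a b h => by
  rw [← Γ.rev_rev a, h, Γ.rev_rev]

lemma Contr.refl (v : Γ.V) : Γ.Contr g v v := Relation.ReflTransGen.refl

lemma Contr.trans {u v w : Γ.V} (h : Γ.Contr g u v) (h' : Γ.Contr g v w) : Γ.Contr g u w :=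
  Relation.ReflTransGen.trans h h'

lemma Contr.dart {d : Γ.D} (h : g (Γ.len d) = 0) : Γ.Contr g (Γ.src d) (Γ.tgt d) :=
  .single ⟨d, h, rfl, rfl⟩

lemma Contr.symm {v w : Γ.V} (h : Γ.Contr g v w) : Γ.Contr g w v := by
  induction h with
  | refl => exact .refl _
  | tail _ hs ih =>
    obtain ⟨d, hd, rfl, rfl⟩ := hs
    exact .trans (.single ⟨Γ.rev d, by rw [Γ.len_rev, hd], rfl, Γ.tgt_rev d⟩) ih

lemma isPath_append {u w : Γ.V} {l₁ l₂ : List Γ.D} :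
    Γ.IsPath u (l₁ ++ l₂) w ↔ ∃ m, Γ.IsPath u l₁ m ∧ Γ.IsPath m l₂ w := by
  induction l₁ generalizing u with
  | nil => simp [IsPath]
  | cons d l ih => simp [IsPath, ih, and_assoc]

lemma IsPath.contr {u w : Γ.V} {l : List Γ.D} (h : Γ.IsPath u l w)
    (hl : ∀ d ∈ l, g (Γ.len d) = 0) : Γ.Contr g u w := by
  induction l generalizing u with
  | nil => exact h ▸ Contr.refl _
  | cons d l ih =>
    obtain ⟨rfl, h⟩ := h
    exact (Contr.dart (hl d (by simp))).trans (ih h fun e he => hl e (by simp [he]))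

variable (Γ g) in
/-- The setoid of the vertices that are joined by contracted edges. -/
def contrSetoid : Setoid Γ.V where
  r := Γ.Contr g
  iseqv := ⟨Contr.refl, Contr.symm, Contr.trans⟩

variable (Γ g) in
/-- The curve obtained by applying `g` to the lengths and contracting the edges of length zero. -/
abbrev contract : TropCurve N n where
  V := Quotient (Γ.contrSetoid g)
  D := {d : Γ.D // g (Γ.len d) ≠ 0}
  finV := have := Γ.finV; inferInstance
  finD := have := Γ.finD; inferInstance
  src d := Quotient.mk _ (Γ.src d.1)
  rev d := ⟨Γ.rev d.1, by rw [Γ.len_rev]; exact d.2⟩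
  rev_rev d := Subtype.ext (Γ.rev_rev _)
  rev_ne d h := Γ.rev_ne d.1 (congrArg Subtype.val h)
  connected v w := by
    induction v using Quotient.inductionOn with | _ v
    induction w using Quotient.inductionOn with | _ w
    refine (Γ.connected v w).lift' (Quotient.mk (Γ.contrSetoid g)) ?_
    rintro _ _ ⟨d, rfl, rfl⟩
    by_cases h : g (Γ.len d) = 0
    · have : Quotient.mk (Γ.contrSetoid g) (Γ.src d) = Quotient.mk _ (Γ.src (Γ.rev d)) :=
        Quotient.sound (Contr.dart h)
      rw [Function.onFun, this]
    · exact .single ⟨⟨d, h⟩, rfl, rfl⟩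
  leg i := Quotient.mk _ (Γ.leg i)
  len d := g (Γ.len d.1)
  len_rev d := by rw [Γ.len_rev]
  len_ne d := d.2

variable (Γ g) in
/-- The contraction map. -/
def contraction : Contraction g Γ (Γ.contract g) where
  vtx := Quotient.mk _
  dart := Subtype.val
  dart_inj := Subtype.val_injective
  dart_range d := ⟨fun ⟨e, he⟩ => he ▸ e.2, fun h => ⟨⟨d, h⟩, rfl⟩⟩
  dart_rev _ := rfl
  dart_src _ := rfl
  dart_len _ := rfl
  vtx_leg _ := rfl
  vtx_surj := Quotient.mk_surjective
  vtx_eq_iff _ _ := Quotient.eq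

open Classical in
variable (g) in
/-- The edges of a path that are not contracted. -/
noncomputable def contractList (l : List Γ.D) : List (Γ.contract g).D :=
  l.filterMap fun d => if h : g (Γ.len d) ≠ 0 then some ⟨d, h⟩ else none

open Classical in
lemma map_val_contractList (l : List Γ.D) :
    (contractList g l).map Subtype.val = l.filter (fun d => g (Γ.len d) ≠ 0) := by
  induction l with
  | nil => rfl
  | cons d l ih =>
    by_cases h : g (Γ.len d) = 0
    · rw [List.filter_cons_of_neg (by simpa using h), ← ih, contractList,
        List.filterMap_cons_none (by simp [h])]
      rfl
    · rw [List.filter_cons_of_pos (by simpa using h), ← ih, contractList,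
        List.filterMap_cons_some (b := ⟨d, h⟩) (by simp [h])]
      rfl

lemma mem_contractList {l : List Γ.D} {d : (Γ.contract g).D} :
    d ∈ contractList g l ↔ d.1 ∈ l := by
  refine (List.mem_map_of_injective (f := (Subtype.val : (Γ.contract g).D → Γ.D))
    Subtype.val_injective).symm.trans ?_
  rw [map_val_contractList, List.mem_filter]
  exact ⟨fun h => h.1, fun h => ⟨h, by simpa using d.2⟩⟩

lemma isPath_contractList {u w : Γ.V} {l : List Γ.D} (h : Γ.IsPath u l w) :
    (Γ.contract g).IsPath (Quotient.mk _ u) (contractList g l) (Quotient.mk _ w) := by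
  induction l generalizing u with
  | nil =>
    obtain rfl : u = w := h
    rfl
  | cons d l ih =>
    obtain ⟨rfl, h⟩ := h
    by_cases h0 : g (Γ.len d) = 0
    · rw [contractList, List.filterMap_cons_none (by simp [h0])]
      have : Quotient.mk (Γ.contrSetoid g) (Γ.src d) = Quotient.mk _ (Γ.tgt d) :=
        Quotient.sound (Contr.dart h0)
      rw [this]
      exact ih h
    · rw [contractList, List.filterMap_cons_some (b := ⟨d, h0⟩) (by simp [h0])]
      exact ⟨rfl, ih h⟩

lemma sum_contractList (l : List Γ.D) :
    ((contractList g l).map (Γ.contract g).len).sum = g ((l.map Γ.len).sum) := by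
  induction l with
  | nil => exact (map_zero g).symm
  | cons d l ih =>
    rw [List.map_cons, List.sum_cons, map_add, ← ih]
    by_cases h : g (Γ.len d) = 0
    · rw [contractList, List.filterMap_cons_none (by simp [h]), h, zero_add]
      rfl
    · rw [contractList, List.filterMap_cons_some (b := ⟨d, h⟩) (by simp [h])]
      rfl

end

end TropCurve

/-! ### Splitting a list at entries that survive a filter. -/

lemma List.exists_split_of_mem_tail_filter {α : Type*} (p : α → Bool) {l : List α} {f : α}
    (h : f ∈ (l.filter p).tail) : ∃ L e mid R, l = L ++ e :: (mid ++ f :: R) ∧ p e = true ∧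
      p f = true ∧ ∀ m ∈ mid, ¬ p m = true := by
  induction l with
  | nil => simp at h
  | cons a l ih =>
    by_cases ha : p a = true
    · rw [List.filter_cons_of_pos ha, List.tail_cons] at h
      rcases hl : l.filter p with _ | ⟨b, t⟩
      · rw [hl] at h
        simp at h
      · rw [hl] at h
        rcases List.mem_cons.1 h with rfl | h
        · obtain ⟨mid, R, rfl, hmid, hf, _⟩ := List.filter_eq_cons_iff.1 hl
          exact ⟨[], a, mid, R, rfl, ha, hf, hmid⟩
        · obtain ⟨L, e, mid, R, rfl, he, hf, hmid⟩ := ih (by rw [hl]; exact h)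
          exact ⟨a :: L, e, mid, R, rfl, he, hf, hmid⟩
    · rw [List.filter_cons_of_neg ha] at h
      obtain ⟨L, e, mid, R, rfl, he, hf, hmid⟩ := ih h
      exact ⟨a :: L, e, mid, R, rfl, he, hf, hmid⟩

lemma List.exists_last_split {α : Type*} (p : α → Prop) {l : List α} (h : ∃ a ∈ l, p a) :
    ∃ L e R, l = L ++ e :: R ∧ p e ∧ ∀ m ∈ R, ¬ p m := by
  induction l with
  | nil => simp at h
  | cons a l ih =>
    by_cases hl : ∃ b ∈ l, p b
    · obtain ⟨L, e, R, rfl, he, hR⟩ := ih hl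
      exact ⟨a :: L, e, R, rfl, he, hR⟩
    · obtain ⟨b, hb, hpb⟩ := h
      rcases List.mem_cons.1 hb with rfl | hb
      · exact ⟨[], b, l, rfl, hpb, fun m hm hpm => hl ⟨m, hm, hpm⟩⟩
      · exact absurd ⟨b, hb, hpb⟩ hl

lemma List.exists_first_split {α : Type*} (p : α → Prop) {l : List α} (h : ∃ a ∈ l, p a) :
    ∃ L e R, l = L ++ e :: R ∧ p e ∧ ∀ m ∈ L, ¬ p m := by
  obtain ⟨L, e, R, h1, h2, h3⟩ := List.exists_last_split p (l := l.reverse) (by simpa using h)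
  refine ⟨R.reverse, e, L.reverse, ?_, h2, by simpa using h3⟩
  rw [← List.reverse_reverse l, h1]
  simp

/-! ### Contracted walks in a subdivided curve. -/

namespace Subdivision

section

variable {M : FSMon} {n : ℕ} {Γ' Γ : TropCurve M n} (σ : Subdivision Γ' Γ)

lemma path_ne_nil (d : Γ.D) : σ.path d ≠ [] := fun h => Γ.len_ne d (by
  rw [← σ.len_sum, h]
  rfl)

lemma tgt_eq_src {d : Γ.D} {A B : List Γ'.D} {h g : Γ'.D} (hd : σ.path d = A ++ h :: g :: B) :
    Γ'.tgt h = Γ'.src g := by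
  have := σ.path_isPath d
  rw [hd, TropCurve.isPath_append] at this
  obtain ⟨_, _, _, h1, _⟩ := this
  exact h1.symm

lemma src_head {d : Γ.D} {B : List Γ'.D} {g : Γ'.D} (hd : σ.path d = g :: B) :
    Γ'.src g = σ.vtx (Γ.src d) := by
  have := σ.path_isPath d
  rw [hd] at this
  exact this.1

lemma tgt_last {d : Γ.D} {A : List Γ'.D} {h : Γ'.D} (hd : σ.path d = A ++ [h]) :
    Γ'.tgt h = σ.vtx (Γ.tgt d) := by
  have := σ.path_isPath d
  rw [hd, TropCurve.isPath_append] at this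
  obtain ⟨_, _, _, h1⟩ := this
  exact h1

lemma src_notMem {d : Γ.D} {A B : List Γ'.D} {h g : Γ'.D} (hd : σ.path d = A ++ h :: g :: B) :
    Γ'.src g ∉ Set.range σ.vtx := by
  refine σ.interior d g ?_
  rw [hd]
  cases A <;> simp

/-- The outgoing edges `g` and `rev h` are distinct, as an edge and its reversal belong to paths of
opposite orientation; bivalence leaves no third one. -/
lemma src_eq_iff {d : Γ.D} {A B : List Γ'.D} {h g : Γ'.D} (hd : σ.path d = A ++ h :: g :: B)
    (e : Γ'.D) : Γ'.src e = Γ'.src g ↔ e = g ∨ e = Γ'.rev h := by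
  have hne : g ≠ Γ'.rev h := by
    intro hg
    refine Γ.rev_ne d ((σ.cover g).unique ?_ ?_)
    · rw [σ.path_rev, hd, hg]
      simp
    · rw [hd]
      simp
  have hfin := Γ'.finD
  have : ({g, Γ'.rev h} : Set Γ'.D) = {e | Γ'.src e = Γ'.src g} := by
    refine Set.eq_of_subset_of_ncard_le ?_ ?_ (Set.toFinite _)
    · rintro _ (rfl | rfl)
      · rfl
      · exact σ.tgt_eq_src hd
    · rw [σ.bivalent _ (σ.src_notMem hd), Set.ncard_pair hne]
  exact (Set.ext_iff.1 this e).symm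

lemma exists_split_of_notMem {x : Γ'.V} (hx : x ∉ Set.range σ.vtx) :
    ∃ d A h g B, σ.path d = A ++ h :: g :: B ∧ Γ'.src g = x := by
  obtain ⟨a, b, _, hab⟩ := Set.ncard_eq_two.1 (σ.bivalent x hx)
  have ha : Γ'.src a = x := (Set.ext_iff.1 hab a).2 (by simp)
  obtain ⟨d, hd, _⟩ := σ.cover a
  obtain ⟨A, B, hAB⟩ := List.append_of_mem hd
  rcases List.eq_nil_or_concat A with rfl | ⟨A, h, rfl⟩
  · exact absurd ⟨_, (σ.src_head hAB).symm.trans ha⟩ hx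
  · exact ⟨d, A, h, a, B, by simpa using hAB, ha⟩

lemma exists_path_of_src_eq {e : Γ'.D} {v : Γ.V} (he : Γ'.src e = σ.vtx v) :
    ∃ d B, σ.path d = e :: B ∧ Γ.src d = v := by
  obtain ⟨d, hd, _⟩ := σ.cover e
  obtain ⟨A, B, hAB⟩ := List.append_of_mem hd
  rcases List.eq_nil_or_concat A with rfl | ⟨A, h, rfl⟩
  · exact ⟨d, B, hAB, σ.vtx_inj ((σ.src_head hAB).symm.trans he)⟩
  · exact absurd ⟨v, he.symm⟩ (σ.src_notMem (A := A) (h := h) (by simpa using hAB))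

variable {N : FSMon} (g : M →+ N)

lemma len_eq_zero_iff (d : Γ.D) :
    g (Γ.len d) = 0 ↔ ∀ e ∈ σ.path d, g (Γ'.len e) = 0 := by
  rw [← σ.len_sum]
  generalize σ.path d = l
  induction l with
  | nil => simp
  | cons e l ih =>
    rw [List.map_cons, List.sum_cons, map_add, List.forall_mem_cons, ← ih]
    exact ⟨fun h => ⟨N.sharp _ _ h, N.right_eq_zero h⟩, fun h => by rw [h.1, h.2, add_zero]⟩

lemma contr_vtx {v w : Γ.V} (h : Γ.Contr g v w) : Γ'.Contr g (σ.vtx v) (σ.vtx w) := by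
  change Relation.ReflTransGen _ _ _ at h
  refine h.lift' σ.vtx ?_
  rintro _ _ ⟨d, hd, rfl, rfl⟩
  exact (σ.path_isPath d).contr ((σ.len_eq_zero_iff g d).1 hd)

/-- An invariant of contracted walks that start at an old vertex: inside a path, everything between
its source and the current position is contracted. By bivalence the walk can only continue or turn
back there. If it reaches the end, the whole edge of `Γ` is contracted. -/
lemma contr_of_contr_vtx_aux {w : Γ.V} {x : Γ'.V} (h : Γ'.Contr g (σ.vtx w) x) :
    (∃ v, x = σ.vtx v ∧ Γ.Contr g w v) ∨
      ∃ d A h' f B, σ.path d = A ++ h' :: f :: B ∧ Γ'.src f = x ∧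
        (∀ e ∈ A ++ [h'], g (Γ'.len e) = 0) ∧ Γ.Contr g w (Γ.src d) := by
  have closed : ∀ (d : Γ.D) (A : List Γ'.D) (e : Γ'.D) (B : List Γ'.D), σ.path d = A ++ e :: B →
      (∀ e' ∈ A, g (Γ'.len e') = 0) → g (Γ'.len e) = 0 → Γ.Contr g w (Γ.src d) →
      (∃ v, Γ'.tgt e = σ.vtx v ∧ Γ.Contr g w v) ∨
      ∃ d A h' f B, σ.path d = A ++ h' :: f :: B ∧ Γ'.src f = Γ'.tgt e ∧
        (∀ e ∈ A ++ [h'], g (Γ'.len e) = 0) ∧ Γ.Contr g w (Γ.src d) := by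
    intro d A e B hd hA he hw
    have hAe : ∀ e' ∈ A ++ [e], g (Γ'.len e') = 0 := by
      intro e' he'
      rcases List.mem_append.1 he' with h1 | h1
      · exact hA _ h1
      · rw [List.mem_singleton.1 h1, he]
    cases B with
    | nil =>
      refine .inl ⟨_, σ.tgt_last hd, hw.trans (.dart ?_)⟩
      rw [σ.len_eq_zero_iff, hd]
      exact hAe
    | cons f B => exact .inr ⟨d, A, e, f, B, hd, (σ.tgt_eq_src hd).symm, hAe, hw⟩
  induction h with
  | refl => exact .inl ⟨w, rfl, .refl w⟩
  | tail _ hs ih =>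
    obtain ⟨e, he, rfl, rfl⟩ := hs
    rcases ih with ⟨v, hv, hwv⟩ | ⟨d, A, h', f, B, hd, hf, hA, hw⟩
    · obtain ⟨d, B, hd, rfl⟩ := σ.exists_path_of_src_eq hv
      exact closed d [] e B hd (by simp) he hwv
    · rcases (σ.src_eq_iff hd e).1 hf.symm with rfl | rfl
      · exact closed d (A ++ [h']) e B (by simpa using hd) hA he hw
      · rw [Γ'.tgt_rev]
        rcases List.eq_nil_or_concat A with rfl | ⟨A, h'', rfl⟩
        · exact .inl ⟨_, σ.src_head hd, hw⟩
        · exact .inr ⟨d, A, h'', h', f :: B, by simpa using hd, rfl,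
            fun e he => hA e (by simp at he ⊢; tauto), hw⟩

lemma contr_vtx_iff {v w : Γ.V} : Γ'.Contr g (σ.vtx v) (σ.vtx w) ↔ Γ.Contr g v w := by
  refine ⟨fun h => ?_, σ.contr_vtx g⟩
  rcases σ.contr_of_contr_vtx_aux g h with ⟨u, hu, h⟩ | ⟨d, A, h', f, B, hd, hf, _⟩
  · rwa [σ.vtx_inj hu]
  · exact absurd ⟨w, hf.symm⟩ (σ.src_notMem hd)

/-- The vertices on a segment of a path between two edges that are not contracted. -/
lemma contr_segment {d : Γ.D} {L mid R : List Γ'.D} {e f : Γ'.D}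
    (hd : σ.path d = L ++ e :: (mid ++ f :: R)) (he : g (Γ'.len e) ≠ 0) (hf : g (Γ'.len f) ≠ 0)
    {y : Γ'.V} (h : Γ'.Contr g (Γ'.src f) y) :
    ∃ A h' k B, e :: (mid ++ [f]) = A ++ h' :: k :: B ∧ Γ'.src k = y := by
  have hd' : ∀ {A B h' k}, e :: (mid ++ [f]) = A ++ h' :: k :: B →
      σ.path d = (L ++ A) ++ h' :: k :: (B ++ R) := by
    intro A B h' k hA
    rw [hd, show e :: (mid ++ f :: R) = (e :: (mid ++ [f])) ++ R by simp, hA]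
    simp
  -- The walk could leave the segment only across `e` or `f`, which are not contracted.
  induction h with
  | refl =>
    rcases List.eq_nil_or_concat mid with rfl | ⟨mid, m, rfl⟩
    · exact ⟨[], e, f, [], rfl, rfl⟩
    · exact ⟨e :: mid, m, f, [], by simp, rfl⟩
  | tail _ hs ih =>
    obtain ⟨e', he', rfl, rfl⟩ := hs
    obtain ⟨A, h', k, B, hA, hk⟩ := ih
    rcases (σ.src_eq_iff (hd' hA) e').1 hk.symm with rfl | rfl
    · cases B with
      | nil =>
        have := congrArg List.getLast? hA
        simp [List.getLast?_cons] at this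
        exact absurd he' (this ▸ hf)
      | cons k' B =>
        exact ⟨A ++ [h'], e', k', B, by simpa using hA,
          (σ.tgt_eq_src (A := L ++ (A ++ [h'])) (B := B ++ R) (by simpa using hd' hA)).symm⟩
    · rw [Γ'.tgt_rev]
      rw [Γ'.len_rev] at he'
      rcases List.eq_nil_or_concat A with rfl | ⟨A, h'', rfl⟩
      · obtain rfl : e = h' := (List.cons.inj hA).1
        exact absurd he' he
      · exact ⟨A, h'', h', k :: B, by simpa using hA, rfl⟩

lemma contr_segment_notMem {d : Γ.D} {L mid R : List Γ'.D} {e f : Γ'.D}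
    (hd : σ.path d = L ++ e :: (mid ++ f :: R)) (he : g (Γ'.len e) ≠ 0) (hf : g (Γ'.len f) ≠ 0)
    (v : Γ.V) : ¬ Γ'.Contr g (Γ'.src f) (σ.vtx v) := by
  intro h
  obtain ⟨A, h', k, B, hA, hk⟩ := σ.contr_segment g hd he hf h
  refine σ.src_notMem (d := d) (A := L ++ A) (h := h') (B := B ++ R) (g := k) ?_ ⟨v, hk.symm⟩
  rw [hd, show e :: (mid ++ f :: R) = (e :: (mid ++ [f])) ++ R by simp, hA]
  simp

lemma contr_segment_src {d : Γ.D} {L mid R : List Γ'.D} {e f : Γ'.D}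
    (hd : σ.path d = L ++ e :: (mid ++ f :: R)) (he : g (Γ'.len e) ≠ 0) (hf : g (Γ'.len f) ≠ 0)
    (hmid : ∀ m ∈ mid, g (Γ'.len m) = 0) {y : Γ'.D} (hy : g (Γ'.len y) ≠ 0)
    (h : Γ'.Contr g (Γ'.src f) (Γ'.src y)) : y = f ∨ y = Γ'.rev e := by
  obtain ⟨A, h', k, B, hA, hk⟩ := σ.contr_segment g hd he hf h
  have hd' : σ.path d = (L ++ A) ++ h' :: k :: (B ++ R) := by
    rw [hd, show e :: (mid ++ f :: R) = (e :: (mid ++ [f])) ++ R by simp, hA]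
    simp
  rcases (σ.src_eq_iff hd' y).1 hk.symm with rfl | rfl
  · left
    have h1 : y ∈ mid ++ [f] := by
      cases A with
      | nil => rw [(List.cons.inj hA).2]; simp
      | cons a A => rw [(List.cons.inj hA).2]; simp
    rcases List.mem_append.1 h1 with h1 | h1
    · exact absurd (hmid _ h1) hy
    · exact List.mem_singleton.1 h1
  · right
    rw [Γ'.len_rev] at hy
    have h1 : h' ∈ e :: mid := by
      have h2 := congrArg List.dropLast hA
      rw [← List.cons_append, List.dropLast_concat] at h2
      rw [h2]
      rw [List.dropLast_append_of_ne_nil (by simp)]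
      simp
    rcases List.mem_cons.1 h1 with rfl | h1
    · rfl
    · exact absurd (hmid _ h1) hy

end

end Subdivision

/-! ### Pushforward of objects of the universal family -/

namespace Subdivision

variable {M N : FSMon} {n : ℕ} {Γ' Γ : TropCurve M n} (σ : Subdivision Γ' Γ) (g : M →+ N)

lemma contr_of_path {d : Γ.D} {A mid B : List Γ'.D} {e f : Γ'.D}
    (hd : σ.path d = A ++ e :: (mid ++ f :: B)) (hmid : ∀ m ∈ mid, g (Γ'.len m) = 0) :
    Γ'.Contr g (Γ'.src f) (Γ'.tgt e) := by
  have := σ.path_isPath d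
  rw [hd, TropCurve.isPath_append] at this
  obtain ⟨_, _, _, h1⟩ := this
  rw [TropCurve.isPath_append] at h1
  obtain ⟨_, h2, rfl, _⟩ := h1
  exact (h2.contr hmid).symm

lemma ne_rev_of_path {d : Γ.D} {e f : Γ'.D} (he : e ∈ σ.path d) (hf : f ∈ σ.path d) :
    f ≠ Γ'.rev e := by
  intro h
  refine Γ.rev_ne d ((σ.cover f).unique ?_ hf)
  rw [σ.path_rev, h]
  simpa using ⟨e, he, rfl⟩

/-- Here `x` is interior to some path. If no edge before it (after it) survived, it would be joined
to the source (target) of the path, an old vertex. The nearest survivors on both sides are `e` and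
`f`. -/
lemma exists_segment {x : Γ'.V} (hx : ∀ v, ¬ Γ'.Contr g (σ.vtx v) x) :
    ∃ d L mid R e f, σ.path d = L ++ e :: (mid ++ f :: R) ∧ g (Γ'.len e) ≠ 0 ∧
      g (Γ'.len f) ≠ 0 ∧ (∀ m ∈ mid, g (Γ'.len m) = 0) ∧ Γ'.Contr g (Γ'.src f) x := by
  obtain ⟨d, A, h, k, B, hd, rfl⟩ := σ.exists_split_of_notMem (x := x) (by
    rintro ⟨v, rfl⟩
    exact hx v (.refl _))
  have hd' : σ.path d = (A ++ [h]) ++ k :: B := by simpa using hd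
  have hp := σ.path_isPath d
  rw [hd', TropCurve.isPath_append] at hp
  obtain ⟨_, hp1, rfl, hp2⟩ := hp
  obtain ⟨L, e, mid₁, hL, he, hmid₁⟩ := List.exists_last_split (fun m => g (Γ'.len m) ≠ 0)
    (l := A ++ [h]) (by
      by_contra hcon
      push Not at hcon
      exact hx _ (hp1.contr hcon))
  obtain ⟨mid₂, f, R, hR, hf, hmid₂⟩ := List.exists_first_split (fun m => g (Γ'.len m) ≠ 0)
    (l := k :: B) (by
      by_contra hcon
      push Not at hcon
      have : Γ'.IsPath (Γ'.src k) (k :: B) (σ.vtx (Γ.tgt d)) := ⟨rfl, hp2⟩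
      exact hx _ (this.contr hcon).symm)
  refine ⟨d, L, mid₁ ++ mid₂, R, e, f, ?_, he, hf, ?_, ?_⟩
  · rw [hd', hL, hR]
    simp
  · intro m hm
    rcases List.mem_append.1 hm with hm | hm
    · exact not_not.1 (hmid₁ m hm)
    · exact not_not.1 (hmid₂ m hm)
  · have : Γ'.IsPath (Γ'.src k) (k :: B) (σ.vtx (Γ.tgt d)) := ⟨rfl, hp2⟩
    rw [hR, TropCurve.isPath_append] at this
    obtain ⟨_, h1, rfl, _⟩ := this
    exact (h1.contr fun m hm => not_not.1 (hmid₂ m hm)).symm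

/-- The subdivision of the contracted curves. -/
noncomputable def contract : Subdivision (Γ'.contract g) (Γ.contract g) where
  vtx := Quotient.map σ.vtx fun _ _ h => σ.contr_vtx g h
  vtx_inj v w h := by
    induction v using Quotient.inductionOn with | _ v
    induction w using Quotient.inductionOn with | _ w
    exact Quotient.sound ((σ.contr_vtx_iff g).1 (Quotient.exact h))
  path d := TropCurve.contractList g (σ.path d.1)
  path_isPath d := TropCurve.isPath_contractList (σ.path_isPath d.1)
  path_rev d := by
    apply List.map_injective_iff.2 Subtype.val_injective
    rw [TropCurve.map_val_contractList, List.map_reverse, List.map_map]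
    have : (Subtype.val ∘ (Γ'.contract g).rev : (Γ'.contract g).D → Γ'.D) =
        Γ'.rev ∘ Subtype.val := rfl
    rw [this, ← List.map_map, TropCurve.map_val_contractList]
    change List.filter _ (σ.path (Γ.rev d.1)) = _
    rw [σ.path_rev, List.filter_reverse, List.filter_map]
    congr 2
    exact List.filter_congr fun e _ => by simp [Γ'.len_rev]
  path_nodup d := by
    apply List.Nodup.of_map Subtype.val
    rw [TropCurve.map_val_contractList]
    exact (σ.path_nodup _).filter _
  cover d' := by
    obtain ⟨d, hd, hu⟩ := σ.cover d'.1
    refine ⟨⟨d, fun h0 => d'.2 ((σ.len_eq_zero_iff g d).1 h0 _ hd)⟩,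
      TropCurve.mem_contractList.2 hd, fun e he => Subtype.ext (hu _ ?_)⟩
    exact TropCurve.mem_contractList.1 he
  interior d d' hd' := by
    classical
    have h1 := List.mem_map_of_mem (f := Subtype.val) hd'
    rw [List.map_tail, TropCurve.map_val_contractList] at h1
    obtain ⟨L, e, mid, R, hd, he, hf, _⟩ := List.exists_split_of_mem_tail_filter _ h1
    rintro ⟨v, hv⟩
    induction v using Quotient.inductionOn with | _ v
    exact σ.contr_segment_notMem g hd (by simpa using he) (by simpa using hf) v
      (TropCurve.Contr.symm (Quotient.exact hv))
  bivalent x hx := by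
    induction x using Quotient.inductionOn with | _ x
    obtain ⟨d, L, mid, R, e, f, hd, he, hf, hmid, hfx⟩ := σ.exists_segment g (x := x) (by
      intro v hv
      exact hx ⟨Quotient.mk _ v, Quotient.sound hv⟩)
    -- The class of `x` is the segment between `e` and `f`; the surviving edges leaving it are `f`
    -- and `rev e`.
    have hset : {d' | (Γ'.contract g).src d' = Quotient.mk (Γ'.contrSetoid g) x} =
        {⟨f, hf⟩, ⟨Γ'.rev e, by rwa [Γ'.len_rev]⟩} := by
      ext y
      constructor
      · intro hy
        rcases σ.contr_segment_src g hd he hf hmid y.2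
          (hfx.trans (TropCurve.Contr.symm (Quotient.exact hy))) with h | h
        · exact .inl (Subtype.ext h)
        · exact .inr (Subtype.ext h)
      · rintro (rfl | rfl)
        · exact Quotient.sound hfx
        · exact Quotient.sound ((σ.contr_of_path g hd hmid).symm.trans hfx)
    rw [hset, Set.ncard_pair]
    exact fun h => σ.ne_rev_of_path (d := d) (e := e) (f := f) (by rw [hd]; simp)
      (by rw [hd]; simp) (congrArg Subtype.val h)
  leg i := congrArg (Quotient.mk _) (σ.leg i)
  len_sum d := by
    rw [TropCurve.sum_contractList, σ.len_sum]

end Subdivision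

/-! #### Pushforward of tropical lines -/

/-- Consecutive points at distance zero are merged by `f`. The clause on `Fin.last` carries the
induction, since each new point is compared with the last one; the bound on the steps of `f` will
keep edges inside cells. -/
lemma exists_tropLine_of_steps {N : Type} [AddCommMonoid N] (k : ℕ) (p : Fin (k + 1) → Gp N)
    (l : Fin k → N) (h : ∀ i : Fin k, p i.succ - p i.castSucc = toGp (l i)) :
    ∃ (Y : TropLine N) (f : Fin (k + 1) → Fin (Y.k + 1)), Function.Surjective f ∧
      (∀ i, Y.pos (f i) = p i) ∧ f (Fin.last k) = Fin.last Y.k ∧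
      ∀ i : Fin k, (f i.castSucc : ℕ) ≤ f i.succ ∧ (f i.succ : ℕ) ≤ f i.castSucc + 1 := by
  classical
  induction k with
  | zero =>
    exact ⟨⟨0, p, Fin.elim0, fun i => i.elim0, fun i => i.elim0⟩, fun i => i,
      fun i => ⟨i, rfl⟩, fun _ => rfl, rfl, fun i => i.elim0⟩
  | succ k ih =>
    obtain ⟨Y, f, hf, hp, hlast, hstep⟩ := ih (fun i => p i.castSucc) (fun i => l i.castSucc)
      fun i => by simpa using h i.castSucc
    by_cases h0 : l (Fin.last k) = 0
    · refine ⟨Y, Fin.lastCases (f (Fin.last k)) f, fun j => ?_, fun i => ?_, by simp [hlast],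
        fun i => ?_⟩
      · obtain ⟨i, rfl⟩ := hf j
        exact ⟨i.castSucc, by simp⟩
      · refine Fin.lastCases ?_ (fun i => ?_) i <;> beta_reduce
        · rw [Fin.lastCases_last, hp]
          have := h (Fin.last k)
          rw [h0, map_zero, sub_eq_zero] at this
          simpa using this.symm
        · rw [Fin.lastCases_castSucc, hp]
      · refine Fin.lastCases ?_ (fun i => ?_) i
        · simp [Fin.succ_last]
        · beta_reduce
          rw [Fin.succ_castSucc, Fin.lastCases_castSucc, Fin.lastCases_castSucc]
          exact hstep i
    · refine ⟨⟨Y.k + 1, Fin.snoc Y.pos (p (Fin.last (k + 1))), Fin.snoc Y.len (l (Fin.last k)),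
        fun i => ?_, fun i => ?_⟩, Fin.lastCases (Fin.last _) fun i => (f i).castSucc,
        fun j => ?_, fun i => ?_, by simp, fun i => ?_⟩
      · refine Fin.lastCases ?_ (fun i => ?_) i
        · simpa using h0
        · simpa using Y.len_ne i
      · refine Fin.lastCases ?_ (fun i => ?_) i
        · rw [Fin.succ_last, Fin.snoc_last, Fin.snoc_last, Fin.snoc_castSucc, ← hlast, hp]
          simpa using h (Fin.last k)
        · rw [Fin.succ_castSucc, Fin.snoc_castSucc, Fin.snoc_castSucc, Fin.snoc_castSucc]
          exact Y.pos_succ i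
      · refine Fin.lastCases ?_ (fun j => ?_) j
        · exact ⟨Fin.last _, by simp⟩
        · obtain ⟨i, rfl⟩ := hf j
          exact ⟨i.castSucc, by simp⟩
      · refine Fin.lastCases ?_ (fun i => ?_) i
        · simp
        · simp [hp]
      · refine Fin.lastCases ?_ (fun i => ?_) i
        · simp [Fin.succ_last, hlast]
        · beta_reduce
          rw [Fin.succ_castSucc, Fin.lastCases_castSucc, Fin.lastCases_castSucc]
          exact hstep i

lemma TropLine.exists_contract {M N : Type} [AddCommMonoid M] [AddCommMonoid N] (X : TropLine M)
    (g : M →+ N) : ∃ (Y : TropLine N) (f : Fin (X.k + 1) → Fin (Y.k + 1)), Function.Surjective f ∧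
      (∀ i, Y.pos (f i) = gpMap g (X.pos i)) ∧
      ∀ i j : Fin (X.k + 1), (j : ℕ) ≤ i + 1 → (f j : ℕ) ≤ f i + 1 := by
  obtain ⟨Y, f, hf, hp, _, hstep⟩ := exists_tropLine_of_steps X.k (fun i => gpMap g (X.pos i))
    (fun i => g (X.len i)) fun i => by rw [← map_sub, X.pos_succ, gpMap_toGp]
  refine ⟨Y, f, hf, hp, fun i j hij => ?_⟩
  have hmono : Monotone f := Fin.monotone_iff_le_succ.2 fun i => (hstep i).1
  rcases Nat.lt_or_ge i j with hlt | hle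
  · have hi : (i : ℕ) < X.k := by omega
    have hj : j = Fin.succ ⟨i, hi⟩ := Fin.ext (by simp at hij hlt ⊢; omega)
    rw [hj]
    exact (hstep ⟨i, hi⟩).2
  · exact (show (f j : ℕ) ≤ f i from hmono hle).trans (Nat.le_succ _)

/-! #### Pushforward of objects -/

namespace RubPt

variable {M : FSMon} {n : ℕ} [NeZero n] (C : RubPt M n)

lemma exists_slope (d : C.eqd.D) : ∃ s : ℤ, C.line.pos (C.β (C.eqd.tgt d)) -
    C.line.pos (C.β (C.eqd.src d)) = s • toGp (C.eqd.len d) := by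
  obtain ⟨e, he, _⟩ := C.sub.cover d
  obtain ⟨s, hs⟩ := C.isPL e
  exact ⟨s, C.isLift.2 e s hs d he⟩

variable {N : FSMon} (g : M →+ N)

lemma gpMap_pos_eq_of_contr {x y : C.eqd.V} (h : C.eqd.Contr g x y) :
    gpMap g (C.line.pos (C.β x)) = gpMap g (C.line.pos (C.β y)) := by
  induction h with
  | refl => rfl
  | tail _ hs ih =>
    obtain ⟨d, hd, rfl, rfl⟩ := hs
    obtain ⟨s, hs⟩ := C.exists_slope d
    rw [ih, eq_comm, ← sub_eq_zero, ← map_sub, hs, map_zsmul, gpMap_toGp, hd, map_zero, smul_zero]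

/-- Curve, model and line are contracted simultaneously. A surviving edge has non-zero length in a
torsion free group, so it keeps its slope; hence the lift condition and stability are inherited. -/
theorem exists_push : ∃ (η : RubPt N n) (φ : RubHom ⟨M, C⟩ ⟨N, η⟩), φ.base = g ∧
    ∀ p : Point C.eqd, ∃ q, p.MapsTo φ.eqd q := by
  obtain ⟨Y, f, hf, hp, hstep⟩ := C.line.exists_contract g
  let β : (C.eqd.contract g).V → Fin (Y.k + 1) := Quotient.lift (fun x => f (C.β x)) fun x y h =>
    Y.pos_injective (by rw [hp, hp, C.gpMap_pos_eq_of_contr g h])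
  let α : (C.curve.contract g).V → Gp N := fun v => Y.pos (β ((C.sub.contract g).vtx v))
  have hβ : ∀ x, Y.pos (β (Quotient.mk _ x)) = gpMap g (C.line.pos (C.β x)) := fun x => hp _
  have hα : ∀ v, α (Quotient.mk _ v) = gpMap g (C.α v) := fun v => by
    rw [← C.isLift.1]
    exact hβ _
  have hslope : ∀ (d : (C.curve.contract g).D) (s : ℤ),
      C.α (C.curve.tgt d.1) - C.α (C.curve.src d.1) = s • toGp (C.curve.len d.1) →
      α ((C.curve.contract g).tgt d) - α ((C.curve.contract g).src d) =
        s • toGp ((C.curve.contract g).len d) := by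
    intro d s hs
    change α (Quotient.mk _ (C.curve.tgt d.1)) - α (Quotient.mk _ (C.curve.src d.1)) = _
    rw [hα, hα, ← map_sub, hs, map_zsmul, gpMap_toGp]
  let η : RubPt N n :=
    { curve := C.curve.contract g
      α := α
      isPL := fun d => by
        obtain ⟨s, hs⟩ := C.isPL d.1
        exact ⟨s, hslope d s hs⟩
      normalized := by
        change α (Quotient.mk _ _) = _
        rw [hα, C.normalized, map_zero]
      eqd := C.eqd.contract g
      sub := C.sub.contract g
      line := Y
      β := β
      β_edge := fun d => hstep _ _ (C.β_edge d.1)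
      isLift := by
        refine ⟨fun _ => rfl, fun d s hs d' hd' => ?_⟩
        obtain ⟨t, ht⟩ := C.isPL d.1
        have hst : s = t := zsmul_toGp_injective N d.2 (hs.symm.trans (hslope d t ht))
        subst hst
        have h1 : C.line.pos (C.β (C.eqd.tgt d'.1)) - C.line.pos (C.β (C.eqd.src d'.1)) =
            s • toGp (C.eqd.len d'.1) :=
          C.isLift.2 d.1 s ht d'.1 (TropCurve.mem_contractList.1 hd')
        change Y.pos (β (Quotient.mk _ (C.eqd.tgt d'.1))) -
          Y.pos (β (Quotient.mk _ (C.eqd.src d'.1))) = _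
        rw [hβ, hβ, ← map_sub, h1, map_zsmul, gpMap_toGp]
      stable_line := fun i => by
        obtain ⟨j, rfl⟩ := hf i
        obtain ⟨v, rfl⟩ := C.stable_line j
        exact ⟨Quotient.mk _ v, rfl⟩
      stable_edge := fun d hd => by
        obtain ⟨s, hs⟩ := C.isPL d.1
        have h0 : s = 0 := zsmul_toGp_injective N d.2 (by
          have := hslope d s hs
          rw [hd, sub_self] at this
          rw [zero_smul]
          exact this.symm)
        have h1 := C.stable_edge d.1 (by rwa [h0, zero_smul, sub_eq_zero] at hs)
        -- Contraction cannot lengthen a path, and the path of a surviving edge is not empty.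
        refine le_antisymm (h1 ▸ List.length_filterMap_le _ _) ?_
        exact List.length_pos_iff.2 ((C.sub.contract g).path_ne_nil d) }
  refine ⟨η, ⟨g, C.curve.contraction g, C.eqd.contraction g, hα, fun _ => rfl, fun e => ?_, ?_,
    hβ⟩, rfl, ?_⟩
  · classical
    change List.Sublist (List.map Subtype.val (TropCurve.contractList g _)) _
    rw [TropCurve.map_val_contractList]
    exact List.filter_sublist
  · change Set.range Y.pos = _
    rw [← hf.range_comp, ← Set.range_comp]
    exact congrArg _ (funext hp)
  · intro p
    cases p with
    | vertex v => exact ⟨_, .vertex v⟩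
    | edge d a b ha hb hab =>
      by_cases h1 : g a = 0
      · exact ⟨_, .source d a b ha hb hab h1⟩
      by_cases h2 : g b = 0
      · exact ⟨_, .target d a b ha hb hab h2⟩
      have h3 : g (C.eqd.len d) ≠ 0 := fun h0 => h1 (N.sharp _ (g b) (by rw [← map_add, hab, h0]))
      exact ⟨_, .edge d a b ha hb hab (show (C.eqd.contract g).D from ⟨d, h3⟩) h1 h2
        ((map_add g a b).symm.trans (congrArg g hab)) rfl⟩

end RubPt

theorem univRub_hasPushforwards (n : ℕ) [NeZero n] : HasPushforwards (UnivRub.proj n) := by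
  rintro ⟨⟨M, C⟩, p⟩ N f
  obtain ⟨η, φ, hφ, hq⟩ := C.exists_push (N := N) f
  obtain ⟨q, hq⟩ := hq p
  refine ⟨⟨⟨N, η⟩, q⟩, ⟨φ, hq⟩, Iso.refl _, ?_⟩
  exact (Category.comp_id _).trans hφ

/-! ### Length systems of an object of `Σ_Rub` -/

namespace RubPt

variable {M : FSMon} {n : ℕ} [NeZero n] (C : RubPt M n)

/-- The slope of an oriented edge of the equidimensional model. -/
noncomputable def slope (d : C.eqd.D) : ℤ := (C.exists_slope d).choose

lemma slope_spec (d : C.eqd.D) : C.line.pos (C.β (C.eqd.tgt d)) -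
    C.line.pos (C.β (C.eqd.src d)) = C.slope d • toGp (C.eqd.len d) := (C.exists_slope d).choose_spec

lemma slope_unique {d : C.eqd.D} {s : ℤ} (h : C.line.pos (C.β (C.eqd.tgt d)) -
    C.line.pos (C.β (C.eqd.src d)) = s • toGp (C.eqd.len d)) : s = C.slope d :=
  zsmul_toGp_injective M (C.eqd.len_ne d) (h.symm.trans (C.slope_spec d))

lemma slope_rev (d : C.eqd.D) : C.slope (C.eqd.rev d) = -C.slope d := by
  symm
  apply C.slope_unique
  rw [C.eqd.tgt_rev, C.eqd.len_rev, neg_smul, ← C.slope_spec, neg_sub]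
  rfl

lemma exists_curve_slope (e : C.curve.D) : ∃ s : ℤ,
    C.α (C.curve.tgt e) - C.α (C.curve.src e) = s • toGp (C.curve.len e) ∧
      ∀ d ∈ C.sub.path e, C.slope d = s := by
  obtain ⟨s, hs⟩ := C.isPL e
  exact ⟨s, hs, fun d hd => (C.slope_unique (C.isLift.2 e s hs d hd)).symm⟩

/-- `d` maps to the `i`-th edge of the line, in the positive direction. -/
def Over (d : C.eqd.D) (i : Fin C.line.k) : Prop :=
  C.β (C.eqd.src d) = i.castSucc ∧ C.β (C.eqd.tgt d) = i.succ

variable {C}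

lemma Over.slope_pos {d : C.eqd.D} {i : Fin C.line.k} (h : C.Over d i) : 0 < C.slope d := by
  by_contra hs
  push Not at hs
  obtain ⟨s, hs⟩ := Int.exists_eq_neg_ofNat hs
  have h1 := C.slope_spec d
  rw [h.1, h.2, C.line.pos_succ, hs, neg_smul, natCast_zsmul, ← map_nsmul] at h1
  exact C.line.len_ne i (toGp_add_toGp_eq_zero M (b := s • C.eqd.len d) rfl (by rw [h1, neg_neg]))

lemma Over.unique {d : C.eqd.D} {i j : Fin C.line.k} (h : C.Over d i) (h' : C.Over d j) : i = j :=
  Fin.castSucc_injective _ (h.1.symm.trans h'.1)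

variable (C)

lemma β_eq_or_over (d : C.eqd.D) : (C.β (C.eqd.tgt d) = C.β (C.eqd.src d) ∧ C.slope d = 0) ∨
    (∃ i, C.Over d i) ∨ ∃ i, C.Over (C.eqd.rev d) i := by
  have h1 := C.β_edge d
  have h2 := C.β_edge (C.eqd.rev d)
  rw [C.eqd.tgt_rev] at h2
  change _ ≤ (C.β (C.eqd.tgt d) : ℕ) + 1 at h2
  have h3 := (C.β (C.eqd.tgt d)).2
  have h4 := (C.β (C.eqd.src d)).2
  rcases lt_trichotomy (C.β (C.eqd.tgt d) : ℕ) (C.β (C.eqd.src d)) with h | h | h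
  · refine .inr (.inr ⟨⟨C.β (C.eqd.tgt d), by omega⟩, Fin.ext rfl, Fin.ext ?_⟩)
    rw [C.eqd.tgt_rev]
    simp
    omega
  · have h' := Fin.ext h
    refine .inl ⟨h', ?_⟩
    symm
    apply C.slope_unique
    rw [h', sub_self, zero_smul]
  · exact .inr (.inl ⟨⟨C.β (C.eqd.src d), by omega⟩, Fin.ext rfl, Fin.ext (by simp; omega)⟩)

lemma exists_index (d : C.eqd.D) (hd : C.slope d ≠ 0) :
    ∃ i, C.Over d i ∨ C.Over (C.eqd.rev d) i := by
  rcases C.β_eq_or_over d with h | ⟨i, hi⟩ | ⟨i, hi⟩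
  · exact absurd h.2 hd
  · exact ⟨i, .inl hi⟩
  · exact ⟨i, .inr hi⟩

/-- A system of lengths for the line and for the equidimensional model with the slopes of `C`. -/
structure IsLengths {P : Type} [AddCommMonoid P] (lam : Fin C.line.k → P) (l : C.eqd.D → P) :
    Prop where
  rev : ∀ d, l (C.eqd.rev d) = l d
  slope_smul : ∀ d i, C.Over d i → C.slope d • (toGp (l d) : Gp P) = toGp (lam i)

lemma isLengths_self : C.IsLengths C.line.len C.eqd.len where
  rev := C.eqd.len_rev
  slope_smul d i h := by rw [← C.slope_spec, h.1, h.2, C.line.pos_succ]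

open Classical in
/-- The cell of an edge of the line or of the equidimensional model. -/
noncomputable def cellAux : Fin C.line.k ⊕ C.eqd.D → Fin C.line.k ⊕ Sym2 C.eqd.D
  | .inl i => .inl i
  -- The length of an edge of slope zero is free, except that both orientations share it.
  | .inr d => if h : C.slope d = 0 then .inr s(d, C.eqd.rev d) else
      .inl (C.exists_index d h).choose

/-- The map from the edges to the set of cells. -/
noncomputable def cell : Fin C.line.k ⊕ C.eqd.D → Set.range C.cellAux :=
  Set.rangeFactorization C.cellAux

lemma cell_surjective : Function.Surjective C.cell := Set.rangeFactorization_surjective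

/-- The weight of an edge. -/
noncomputable def weight : Fin C.line.k ⊕ C.eqd.D → ℕ
  | .inl _ => 1
  | .inr d => if C.slope d = 0 then 1 else (C.slope d).natAbs

lemma weight_pos (x : Fin C.line.k ⊕ C.eqd.D) : 0 < C.weight x := by
  cases x with
  | inl i => exact one_pos
  | inr d =>
    by_cases h : C.slope d = 0
    · simp [weight, h]
    · simp [weight, h]

lemma cell_eq_iff {x y : Fin C.line.k ⊕ C.eqd.D} : C.cell x = C.cell y ↔
    C.cellAux x = C.cellAux y := by
  simp [cell, Set.rangeFactorization, Subtype.ext_iff]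

variable {C} in
lemma Over.cellAux_eq {d : C.eqd.D} {i : Fin C.line.k} (h : C.Over d i) :
    C.cellAux (.inr d) = .inl i := by
  have h0 := h.slope_pos
  rw [cellAux, dif_neg h0.ne']
  congr 1
  rcases (C.exists_index d h0.ne').choose_spec with h1 | h1
  · exact h1.unique h
  · have := h1.slope_pos
    rw [slope_rev] at this
    omega

variable {C} in
lemma Over.cellAux_rev_eq {d : C.eqd.D} {i : Fin C.line.k} (h : C.Over d i) :
    C.cellAux (.inr (C.eqd.rev d)) = .inl i := by
  have h0 := h.slope_pos
  have hne : C.slope (C.eqd.rev d) ≠ 0 := by rw [slope_rev]; omega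
  rw [cellAux, dif_neg hne]
  congr 1
  rcases (C.exists_index _ hne).choose_spec with h1 | h1
  · have := h1.slope_pos
    rw [slope_rev] at this
    omega
  · have : ∀ j, C.Over (C.eqd.rev (C.eqd.rev d)) j → j = i := fun j hj => by
      rw [C.eqd.rev_rev] at hj
      exact hj.unique h
    exact this _ h1

lemma weight_rev (d : C.eqd.D) : C.weight (.inr (C.eqd.rev d)) = C.weight (.inr d) := by
  simp [weight, slope_rev]

variable {C} in
lemma Over.weight_nsmul {P : FSMon} {d : C.eqd.D} {i : Fin C.line.k} (h : C.Over d i) (a : P) :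
    (toGp (C.weight (.inr d) • a) : Gp P) = C.slope d • toGp a := by
  have h0 := h.slope_pos
  rw [weight, if_neg h0.ne', map_nsmul, ← natCast_zsmul, Int.natCast_natAbs, abs_of_pos h0]

/-- An edge of the line has weight one and shares its cell with all edges of the model over it, in
both orientations. So agreement within cells is the slope condition together with invariance under
reversal. -/
lemma isLengthSystem_iff {P : FSMon} (lam : Fin C.line.k → P) (l : C.eqd.D → P) :
    IsLengthSystem C.cell C.weight (Sum.elim lam l) ↔ C.IsLengths lam l := by
  constructor
  · intro h
    refine ⟨fun d => ?_, fun d i hi => ?_⟩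
    · have hcell : C.cellAux (.inr (C.eqd.rev d)) = C.cellAux (.inr d) := by
        rcases C.β_eq_or_over d with h0 | ⟨i, hi⟩ | ⟨i, hi⟩
        · have h1 : C.slope (C.eqd.rev d) = 0 := by rw [slope_rev, h0.2, neg_zero]
          rw [cellAux, cellAux, dif_pos h0.2, dif_pos h1, C.eqd.rev_rev, Sym2.eq_swap]
        · rw [hi.cellAux_eq, hi.cellAux_rev_eq]
        · have := hi.cellAux_rev_eq
          rw [C.eqd.rev_rev] at this
          rw [this, hi.cellAux_eq]
      have := h _ _ (C.cell_eq_iff.2 hcell)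
      rw [weight_rev] at this
      exact P.nsmul_right_injective (C.weight_pos _).ne' this
    · have := h (.inr d) (.inl i) (C.cell_eq_iff.2 hi.cellAux_eq)
      rw [← hi.weight_nsmul]
      exact congrArg _ (this.trans (one_nsmul _))
  · intro h
    have key : ∀ d i, C.cellAux (.inr d) = .inl i → C.weight (.inr d) • l d = lam i := by
      intro d i hd
      apply toGp_injective P
      rcases C.β_eq_or_over d with h0 | ⟨j, hj⟩ | ⟨j, hj⟩
      · rw [cellAux, dif_pos h0.2] at hd
        cases hd
      · rw [hj.cellAux_eq] at hd
        cases hd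
        rw [hj.weight_nsmul, h.slope_smul d _ hj]
      · have := hj.cellAux_rev_eq
        rw [C.eqd.rev_rev, hd] at this
        cases this
        rw [← h.rev, ← weight_rev, hj.weight_nsmul, h.slope_smul _ _ hj]
    have key' : ∀ d e, C.cellAux (.inr d) = .inr e →
        C.weight (.inr d) = 1 ∧ e = s(d, C.eqd.rev d) := by
      intro d e hd
      by_cases h0 : C.slope d = 0
      · rw [cellAux, dif_pos h0] at hd
        exact ⟨by rw [weight, if_pos h0], (Sum.inr.inj hd).symm⟩
      · rw [cellAux, dif_neg h0] at hd
        cases hd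
    have hall : ∀ x i, C.cellAux x = .inl i → C.weight x • Sum.elim lam l x = lam i := by
      rintro (j | d) i hx
      · cases hx
        exact one_nsmul _
      · exact key d i hx
    intro x y hxy
    rw [cell_eq_iff] at hxy
    rcases hx : C.cellAux x with i | e
    · rw [hall x i hx, hall y i (hxy ▸ hx)]
    · rcases x with j | d
      · cases hx
      rcases y with j | d'
      · rw [hx] at hxy
        cases hxy
      obtain ⟨h1, h2⟩ := key' d e hx
      obtain ⟨h3, h4⟩ := key' d' e (hxy ▸ hx)
      rw [h1, h3, one_nsmul, one_nsmul]
      change l d = l d'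
      rw [h2, Sym2.eq_iff] at h4
      rcases h4 with ⟨h5, _⟩ | ⟨h5, _⟩
      · rw [h5]
      · rw [h5, h.rev]

/-! #### Change of lengths -/

section Retype

variable {C} {P : FSMon} {lam : Fin C.line.k → P} {l : C.eqd.D → P}

variable (C) in
/-- The positions on the line with the lengths `lam`. -/
noncomputable def posOf (lam : Fin C.line.k → P) (i : Fin (C.line.k + 1)) : Gp P :=
  toGp (Fin.partialSum lam i) - toGp (Fin.partialSum lam (C.β (C.sub.vtx (C.curve.leg 0))))

lemma posOf_succ (lam : Fin C.line.k → P) (i : Fin C.line.k) :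
    C.posOf lam i.succ - C.posOf lam i.castSucc = toGp (lam i) := by
  rw [posOf, posOf, sub_sub_sub_cancel_right, Fin.partialSum_succ, map_add, add_sub_cancel_left]

lemma posOf_leg (lam : Fin C.line.k → P) :
    C.posOf lam (C.β (C.sub.vtx (C.curve.leg 0))) = 0 := sub_self _

lemma IsLengths.posOf_sub (h : C.IsLengths lam l) (d : C.eqd.D) :
    C.posOf lam (C.β (C.eqd.tgt d)) - C.posOf lam (C.β (C.eqd.src d)) =
      C.slope d • toGp (l d) := by
  rcases C.β_eq_or_over d with h0 | ⟨i, hi⟩ | ⟨i, hi⟩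
  · rw [h0.1, h0.2, sub_self, zero_smul]
  · rw [h.slope_smul d i hi, hi.1, hi.2, posOf_succ]
  · have h1 := h.slope_smul _ i hi
    rw [h.rev, slope_rev, neg_smul] at h1
    rw [neg_eq_iff_eq_neg] at h1
    rw [h1, ← posOf_succ, ← hi.1, ← hi.2, neg_sub, C.eqd.tgt_rev]
    rfl

/-- A tropical curve with other lengths. -/
abbrev _root_.TropRub.TropCurve.withLen {M P : Type} [AddCommMonoid M] [AddCommMonoid P] {n : ℕ}
    (Γ : TropCurve M n) (len : Γ.D → P) (hrev : ∀ d, len (Γ.rev d) = len d)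
    (hne : ∀ d, len d ≠ 0) : TropCurve P n where
  V := Γ.V
  D := Γ.D
  finV := Γ.finV
  finD := Γ.finD
  src := Γ.src
  rev := Γ.rev
  rev_rev := Γ.rev_rev
  rev_ne := Γ.rev_ne
  connected := Γ.connected
  leg := Γ.leg
  len := len
  len_rev := hrev
  len_ne := hne

lemma _root_.TropRub.TropCurve.isPath_withLen {M P : Type} [AddCommMonoid M] [AddCommMonoid P]
    {n : ℕ} (Γ : TropCurve M n) (len : Γ.D → P) (hrev : ∀ d, len (Γ.rev d) = len d)
    (hne : ∀ d, len d ≠ 0) {u w : Γ.V} {p : List Γ.D} (h : Γ.IsPath u p w) :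
    (Γ.withLen len hrev hne).IsPath u p w := by
  induction p generalizing u with
  | nil => exact h
  | cons d p ih => exact ⟨h.1, ih h.2⟩

lemma IsLengths.pathSum_rev (h : C.IsLengths lam l) (e : C.curve.D) :
    ((C.sub.path (C.curve.rev e)).map l).sum = ((C.sub.path e).map l).sum := by
  rw [C.sub.path_rev, List.map_reverse, List.sum_reverse, List.map_map]
  congr 1
  exact List.map_congr_left fun d _ => h.rev d

lemma pathSum_ne (hl : ∀ d, l d ≠ 0) (e : C.curve.D) : ((C.sub.path e).map l).sum ≠ 0 := by
  intro h0
  rcases hp : C.sub.path e with _ | ⟨d, t⟩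
  · exact C.sub.path_ne_nil e hp
  · rw [hp, List.map_cons, List.sum_cons] at h0
    exact hl d (P.sharp _ _ h0)

lemma IsLengths.posOf_sub_path (h : C.IsLengths lam l) (e : C.curve.D) {s : ℤ}
    (hs : ∀ d ∈ C.sub.path e, C.slope d = s) :
    C.posOf lam (C.β (C.sub.vtx (C.curve.tgt e))) - C.posOf lam (C.β (C.sub.vtx (C.curve.src e))) =
      s • toGp ((C.sub.path e).map l).sum := by
  have key : ∀ (p : List C.eqd.D) (u w : C.eqd.V), C.eqd.IsPath u p w →
      (∀ d ∈ p, C.slope d = s) →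
      C.posOf lam (C.β w) - C.posOf lam (C.β u) = s • toGp (p.map l).sum := by
    intro p
    induction p with
    | nil =>
      rintro u _ rfl _
      rw [List.map_nil, List.sum_nil, map_zero, smul_zero, sub_self]
    | cons d p ih =>
      rintro _ w ⟨rfl, hp⟩ hs
      rw [List.map_cons, List.sum_cons, map_add, smul_add,
        ← ih _ w hp fun e he => hs e (by simp [he]), ← hs d (by simp), ← h.posOf_sub]
      abel
  exact key _ _ _ (C.sub.path_isPath e) hs

variable (C) in
/-- The object with the combinatorics of `C` and with given lengths. -/
noncomputable abbrev retype (h : C.IsLengths lam l) (hlam : ∀ i, lam i ≠ 0) (hl : ∀ d, l d ≠ 0) :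
    RubPt P n where
  curve := C.curve.withLen (fun e => ((C.sub.path e).map l).sum) h.pathSum_rev (pathSum_ne hl)
  α v := C.posOf lam (C.β (C.sub.vtx v))
  isPL e := by
    obtain ⟨s, _, hs⟩ := C.exists_curve_slope e
    exact ⟨s, h.posOf_sub_path e hs⟩
  normalized := posOf_leg lam
  eqd := C.eqd.withLen l h.rev hl
  sub :=
    { vtx := C.sub.vtx
      vtx_inj := C.sub.vtx_inj
      path := C.sub.path
      path_isPath := fun d => C.eqd.isPath_withLen _ _ _ (C.sub.path_isPath d)
      path_rev := C.sub.path_rev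
      path_nodup := C.sub.path_nodup
      cover := C.sub.cover
      interior := C.sub.interior
      bivalent := C.sub.bivalent
      leg := C.sub.leg
      len_sum := fun _ => rfl }
  line :=
    { k := C.line.k
      pos := C.posOf lam
      len := lam
      len_ne := hlam
      pos_succ := posOf_succ lam }
  β := C.β
  β_edge := C.β_edge
  isLift := by
    refine ⟨fun _ => rfl, fun e s hs d hd => ?_⟩
    obtain ⟨t, _, ht⟩ := C.exists_curve_slope e
    obtain rfl : s = t := zsmul_toGp_injective P (pathSum_ne hl e)
      (hs.symm.trans (h.posOf_sub_path e ht))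
    rw [← ht d hd]
    exact h.posOf_sub d
  stable_line := C.stable_line
  stable_edge e he := by
    obtain ⟨s, hs, hs'⟩ := C.exists_curve_slope e
    refine C.stable_edge e ?_
    have h0 : s = 0 := zsmul_toGp_injective P (pathSum_ne hl e) (by
      rw [zero_smul, ← h.posOf_sub_path e hs']
      exact sub_eq_zero.2 he)
    rwa [h0, zero_smul, sub_eq_zero] at hs

/-- Nothing is contracted, so all combinatorial components are identities. The positions agree
because their steps do and both are normalized at the first leg. -/
lemma exists_hom_of_retype (h : C.IsLengths lam l) (hlam : ∀ i, lam i ≠ 0) (hl : ∀ d, l d ≠ 0)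
    (g : P →+ M) (hg : ∀ i, g (lam i) = C.line.len i) (hg' : ∀ d, g (l d) = C.eqd.len d)
    (hloc : ∀ m, g m = 0 → m = 0) :
    ∃ φ : RubHom ⟨P, C.retype h hlam hl⟩ ⟨M, C⟩, φ.base = g ∧ (∀ v, φ.eqd.vtx v = v) ∧
      ∀ d, φ.eqd.dart d = d := by
  have hpos : ∀ i, gpMap g (C.posOf lam i) = C.line.pos i := by
    have h1 : ∀ i, gpMap g (toGp (Fin.partialSum lam i)) = C.line.pos i - C.line.pos 0 := by
      intro i
      induction i using Fin.induction with
      | zero => rw [Fin.partialSum_zero, map_zero, map_zero, sub_self]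
      | succ i ih =>
        rw [Fin.partialSum_succ, map_add, map_add, ih, gpMap_toGp, hg, ← C.line.pos_succ]
        abel
    intro i
    have h2 : C.line.pos (C.β (C.sub.vtx (C.curve.leg 0))) = 0 :=
      (C.isLift.1 _).trans C.normalized
    rw [posOf, map_sub, h1, h1, h2]
    abel
  have hrel : ∀ {Q : TropCurve P n} {v w : Q.V}, Relation.ReflTransGen
      (fun a b => ∃ d, g (Q.len d) = 0 ∧ Q.src d = a ∧ Q.tgt d = b) v w → v = w := by
    intro Q v w hvw
    induction hvw with
    | refl => rfl
    | tail _ hs _ =>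
      obtain ⟨d, hd, _⟩ := hs
      exact absurd (hloc _ hd) (Q.len_ne d)
  have hsum : ∀ e, C.curve.len e = g ((C.sub.path e).map l).sum := by
    intro e
    rw [map_list_sum, List.map_map, ← C.sub.len_sum]
    congr 1
    exact List.map_congr_left fun d _ => (hg' d).symm
  let c₁ : Contraction g (C.retype h hlam hl).curve C.curve :=
    { vtx := fun v => v
      dart := fun d => d
      dart_inj := fun _ _ h => h
      dart_range := fun d => ⟨fun _ h0 => (C.retype h hlam hl).curve.len_ne d (hloc _ h0),
        fun _ => ⟨d, rfl⟩⟩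
      dart_rev := fun _ => rfl
      dart_src := fun _ => rfl
      dart_len := hsum
      vtx_leg := fun _ => rfl
      vtx_surj := fun v => ⟨v, rfl⟩
      vtx_eq_iff := fun v w => ⟨fun h => h ▸ .refl, fun h => hrel h⟩ }
  let c₂ : Contraction g (C.retype h hlam hl).eqd C.eqd :=
    { vtx := fun v => v
      dart := fun d => d
      dart_inj := fun _ _ h => h
      dart_range := fun d => ⟨fun _ h0 => (C.retype h hlam hl).eqd.len_ne d (hloc _ h0),
        fun _ => ⟨d, rfl⟩⟩
      dart_rev := fun _ => rfl
      dart_src := fun _ => rfl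
      dart_len := fun d => (hg' d).symm
      vtx_leg := fun _ => rfl
      vtx_surj := fun v => ⟨v, rfl⟩
      vtx_eq_iff := fun v w => ⟨fun h => h ▸ .refl, fun h => hrel h⟩ }
  refine ⟨{
    base := g
    con := c₁
    eqd := c₂
    map_α := fun v => by
      rw [← C.isLift.1]
      exact (hpos _).symm
    map_vtx := fun _ => rfl
    map_path := fun e => by
      change List.Sublist (List.map (fun d => d) (C.sub.path e)) (C.sub.path e)
      rw [List.map_id']
    map_line := by
      change Set.range C.line.pos = gpMap g '' Set.range (C.posOf lam)
      rw [← Set.range_comp]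
      exact congrArg _ (funext fun i => (hpos i).symm)
    map_β := fun x => (hpos _).symm }, rfl, fun _ => rfl, fun _ => rfl⟩

end Retype

end RubPt

/-! ### Minimal objects of the universal family -/

namespace Point

variable {M N P : Type} [AddCommMonoid M] [AddCommMonoid N] [AddCommMonoid P] {n : ℕ}
  {h : N →+ P} {k : M →+ P}
  {Γ : TropCurve M n} {Δ : TropCurve N n} {Θ : TropCurve P n}

lemma MapsTo.exists_vertex {φ : Contraction h Δ Θ} (hh : ∀ m, h m = 0 → m = 0) {q : Point Δ}
    {t : Θ.V} (hq : q.MapsTo φ (.vertex t)) : ∃ w, q = .vertex w ∧ φ.vtx w = t := by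
  cases q with
  | vertex w => exact ⟨w, rfl, (Point.vertex.inj (mapsTo_vertex_iff.1 hq)).symm⟩
  | edge d a b ha hb hab =>
    rcases mapsTo_edge_vertex_iff.1 hq with ⟨h0, _⟩ | ⟨h0, _⟩
    · exact absurd (hh _ h0) ha
    · exact absurd (hh _ h0) hb

lemma MapsTo.lift_vertex {g : M →+ N} {φ : Contraction h Δ Θ} {ψ : Contraction k Γ Θ}
    {χ : Contraction g Γ Δ} (hh : ∀ m, h m = 0 → m = 0) (hv : ∀ v, φ.vtx (χ.vtx v) = ψ.vtx v)
    {v : Γ.V} {q : Point Δ} {r : Point Θ} (hp : MapsTo ψ (.vertex v) r) (hq : q.MapsTo φ r) :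
    MapsTo χ (.vertex v) q := by
  rw [mapsTo_vertex_iff] at hp
  subst hp
  obtain ⟨w, rfl, hw⟩ := hq.exists_vertex hh
  rw [mapsTo_vertex_iff, φ.vtx_injective hh (hw.trans (hv v).symm)]

/-- The point `q` prescribes how the length `L` over `N` is divided. A lift `χ` respects the points
exactly if its base map sends `a₀` and `b₀` to the two parts, which yields existence and uniqueness
from the universal property of the split length. -/
lemma MapsTo.exists_split {φ : Contraction h Δ Θ} {ψ : Contraction k Γ Θ}
    (hh : ∀ m, h m = 0 → m = 0) {d : Γ.D} {a₀ b₀ : M} {ha : a₀ ≠ 0} {hb : b₀ ≠ 0}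
    {hab : a₀ + b₀ = Γ.len d} {q : Point Δ} {r : Point Θ}
    (hp : MapsTo ψ (.edge d a₀ b₀ ha hb hab) r) (hq : q.MapsTo φ r) (L : N)
    (hL : h L = k (Γ.len d)) (hL' : ∀ e, ψ.dart e = d → Δ.len (φ.dart e) = L) :
    ∃ a b, a + b = L ∧ h a = k a₀ ∧ h b = k b₀ ∧ ∀ (g : M →+ N) (χ : Contraction g Γ Δ),
      (∀ v, φ.vtx (χ.vtx v) = ψ.vtx v) → (∀ e, χ.dart (φ.dart e) = ψ.dart e) →
      (∀ m, k m = h (g m)) → g (Γ.len d) = L →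
      (MapsTo χ (.edge d a₀ b₀ ha hb hab) q ↔ g a₀ = a ∧ g b₀ = b) := by
  have hk : k (Γ.len d) = k a₀ + k b₀ := by rw [← hab, map_add]
  have hdrev : ∀ e, ψ.dart e = Γ.rev d → Δ.len (φ.dart e) = L := fun e he => by
    rw [← hL' (Θ.rev e) (by rw [ψ.dart_rev, he, Γ.rev_rev]), φ.dart_rev, Δ.len_rev]
  cases r with
  | vertex t =>
    obtain ⟨w, rfl, hw⟩ := hq.exists_vertex hh
    rcases mapsTo_edge_vertex_iff.1 hp with ⟨h0, rfl⟩ | ⟨h0, rfl⟩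
    -- The point has moved to the source, so the first part of the length is zero; it is already
    -- zero over `N` because `h` is local.
    · refine ⟨0, L, zero_add _, by rw [map_zero, h0], by rw [hL, hk, h0, zero_add], ?_⟩
      intro g χ hv _ hg hgL
      have h1 : g a₀ = 0 := hh _ (by rw [← hg, h0])
      have h2 : g b₀ = L := by rw [← hgL, ← hab, map_add, h1, zero_add]
      refine ⟨fun _ => ⟨h1, h2⟩, fun _ => ?_⟩
      exact mapsTo_edge_vertex_iff.2 (.inl ⟨h1, φ.vtx_injective hh (hw.trans (hv _).symm)⟩)
    · refine ⟨L, 0, add_zero _, by rw [hL, hk, h0, add_zero], by rw [map_zero, h0], ?_⟩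
      intro g χ hv _ hg hgL
      have h1 : g b₀ = 0 := hh _ (by rw [← hg, h0])
      have h2 : g a₀ = L := by rw [← hgL, ← hab, map_add, h1, add_zero]
      refine ⟨fun _ => ⟨h2, h1⟩, fun _ => ?_⟩
      exact mapsTo_edge_vertex_iff.2 (.inr ⟨h1, φ.vtx_injective hh (hw.trans (hv _).symm)⟩)
  | edge e a'' b'' ha'' hb'' hab'' =>
    cases q with
    | vertex w => cases mapsTo_vertex_iff.1 hq
    | edge e₂ a b ha' hb' hab' =>
      have hne : Γ.rev d ≠ d := Γ.rev_ne d
      rcases mapsTo_edge_edge_iff.1 hq with ⟨h1, rfl, rfl⟩ | ⟨h1, rfl, rfl⟩ <;>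
        rcases mapsTo_edge_edge_iff.1 hp with ⟨h2, h3, h4⟩ | ⟨h2, h3, h4⟩
      · refine ⟨a, b, by rw [hab', ← h1, hL' e h2], h3, h4, ?_⟩
        intro g χ hv hd hg hgL
        rw [mapsTo_edge_edge_iff, ← h1, hd, h2]
        simp [hne.symm, eq_comm]
      · refine ⟨b, a, by rw [add_comm, hab', ← h1, hdrev e h2], h4, h3, ?_⟩
        intro g χ hv hd hg hgL
        rw [mapsTo_edge_edge_iff, ← h1, hd, h2]
        simp only [hne, false_and, false_or, true_and]
        exact ⟨fun h => ⟨h.2.symm, h.1.symm⟩, fun h => ⟨h.2.symm, h.1.symm⟩⟩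
      · refine ⟨b, a, by rw [add_comm, hab', ← Δ.len_rev, ← h1, hL' e h2], h3, h4, ?_⟩
        intro g χ hv hd hg hgL
        have h5 : χ.dart e₂ = Γ.rev d := by
          rw [← Δ.rev_rev e₂, ← h1, χ.dart_rev, hd, h2]
        rw [mapsTo_edge_edge_iff, h5]
        simp only [hne, false_and, false_or, true_and]
        exact ⟨fun h => ⟨h.2.symm, h.1.symm⟩, fun h => ⟨h.2.symm, h.1.symm⟩⟩
      · refine ⟨a, b, by rw [hab', ← Δ.len_rev, ← h1, hdrev e h2], h4, h3, ?_⟩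
        intro g χ hv hd hg hgL
        have h5 : χ.dart e₂ = d := by
          rw [← Δ.rev_rev e₂, ← h1, χ.dart_rev, hd, h2, Γ.rev_rev]
        rw [mapsTo_edge_edge_iff, h5]
        simp [hne.symm, eq_comm]

end Point

namespace RubPt

variable {M P : FSMon} {n : ℕ} [NeZero n] {C : RubPt M n} {lam : Fin C.line.k → P}
  {l : C.eqd.D → P} {h : C.IsLengths lam l} {hlam : ∀ i, lam i ≠ 0} {hl : ∀ d, l d ≠ 0}
  {η ζ : Rub n}

/-- The lengths that `ψ` prescribes over `ζ.base` are refined to lengths over `η.base`, read off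
from `η` through the bijections given by the local map `φ`. They form a length system for `C`, so
the universal property turns them into a base map for the lift. -/
lemma exists_lift_lengths (ψ : RubHom ⟨P, C.retype h hlam hl⟩ ζ) (φ : RubHom η ζ)
    (hφ : ∀ m, φ.base m = 0 → m = 0) :
    ∃ (lam' : Fin C.line.k → η.base) (l' : C.eqd.D → η.base), C.IsLengths lam' l' ∧
      (∀ i, φ.base (lam' i) = ψ.base (lam i)) ∧ (∀ d, φ.base (l' d) = ψ.base (l d)) ∧
      (∀ e, η.pt.eqd.len (φ.eqd.dart e) = l' (ψ.eqd.dart e)) ∧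
      ∀ g : P →+ η.base, (∀ i, g (lam i) = lam' i) →
        ∀ i, ∃ j, η.pt.line.pos j = gpMap g (C.posOf lam i) := by
  classical
  have hf : ∀ i, ∃ j, gpMap φ.base (η.pt.line.pos j) = gpMap ψ.base (C.posOf lam i) := by
    intro i
    have h1 : gpMap ψ.base (C.posOf lam i) ∈ Set.range ζ.pt.line.pos := by
      rw [ψ.map_line]
      exact ⟨_, ⟨i, rfl⟩, rfl⟩
    rw [φ.map_line] at h1
    obtain ⟨_, ⟨j, rfl⟩, hj⟩ := h1
    exact ⟨j, hj⟩
  choose f hf using hf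
  have hfβ : ∀ (x : C.eqd.V) (y : η.pt.eqd.V), φ.eqd.vtx y = ψ.eqd.vtx x →
      η.pt.β y = f (C.β x) := by
    intro x y hxy
    apply η.pt.line.pos_injective_of_local φ.base hφ
    rw [hf, ← φ.map_β, hxy, ψ.map_β]
  have hlam' : ∀ i : Fin C.line.k, ∃ m : η.base,
      η.pt.line.pos (f i.succ) - η.pt.line.pos (f i.castSucc) = toGp m := by
    intro i
    rcases le_total (f i.castSucc) (f i.succ) with hle | hle
    · obtain ⟨m, hm, _⟩ := η.pt.line.exists_pos_sub hle
      exact ⟨m, hm⟩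
    -- If `f` reversed the order, `m` would have an image that is both nonnegative and nonpositive.
    -- So it is zero, and then `m = 0` by locality.
    · obtain ⟨m, hm, _⟩ := η.pt.line.exists_pos_sub hle
      have h1 : φ.base m = 0 := by
        refine toGp_add_toGp_eq_zero ζ.base (x := gpMap φ.base (toGp m)) (gpMap_toGp _ _)
          (b := ψ.base (lam i)) ?_
        rw [← hm, map_sub, hf, hf, neg_sub, ← map_sub, posOf_succ, gpMap_toGp]
      refine ⟨0, ?_⟩
      rw [hφ _ h1, map_zero, sub_eq_zero] at hm
      rw [hm, sub_self, map_zero]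
  choose lam' hlam' using hlam'
  have hφlam : ∀ i, φ.base (lam' i) = ψ.base (lam i) := by
    intro i
    apply toGp_injective
    rw [← gpMap_toGp, ← gpMap_toGp, ← hlam', ← posOf_succ, map_sub, map_sub, hf, hf]
  -- Edges contracted by `ψ` get length zero, the others the length of the corresponding edge of
  -- `η`.
  let l' : C.eqd.D → η.base := fun d =>
    if h : ∃ e, ψ.eqd.dart e = d then η.pt.eqd.len (φ.eqd.dart h.choose) else 0
  have hl' : ∀ e, l' (ψ.eqd.dart e) = η.pt.eqd.len (φ.eqd.dart e) := by
    intro e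
    have he : ∃ e', ψ.eqd.dart e' = ψ.eqd.dart e := ⟨e, rfl⟩
    change dite _ _ _ = _
    rw [dif_pos he, ψ.eqd.dart_inj he.choose_spec]
  have hl0 : ∀ d, ψ.base (l d) = 0 → l' d = 0 := by
    intro d hd
    refine dif_neg fun ⟨e, he⟩ => ?_
    exact (ψ.eqd.dart_range d).1 ⟨e, he⟩ hd
  have hφl : ∀ d, φ.base (l' d) = ψ.base (l d) := by
    intro d
    by_cases h0 : ψ.base (l d) = 0
    · rw [hl0 d h0, h0, map_zero]
    · obtain ⟨e, rfl⟩ := (ψ.eqd.dart_range d).2 h0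
      rw [hl', ← φ.eqd.dart_len, ψ.eqd.dart_len]
  refine ⟨lam', l', ⟨fun d => ?_, fun d i hi => ?_⟩, hφlam, hφl, fun e => (hl' e).symm, ?_⟩
  · by_cases h0 : ψ.base (l d) = 0
    · rw [hl0 d h0, hl0 _ (by rw [h.rev, h0])]
    · obtain ⟨e, rfl⟩ := (ψ.eqd.dart_range d).2 h0
      have h1 := ψ.eqd.dart_rev e
      change ψ.eqd.dart _ = C.eqd.rev _ at h1
      rw [← h1, hl', hl', φ.eqd.dart_rev, η.pt.eqd.len_rev]
  · have h2 : C.slope d • (toGp (ψ.base (l d)) : Gp ζ.base) = toGp (ψ.base (lam i)) := by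
      rw [← gpMap_toGp, ← gpMap_toGp, ← map_zsmul, h.slope_smul d i hi]
    by_cases h0 : ψ.base (l d) = 0
    · have h1 : ψ.base (lam i) = 0 := by
        apply toGp_injective
        rw [← h2, h0, map_zero, smul_zero]
      rw [hl0 d h0, hφ (lam' i) (by rw [hφlam, h1]), map_zero, smul_zero]
    · obtain ⟨e, rfl⟩ := (ψ.eqd.dart_range d).2 h0
      have hsrc : η.pt.β (η.pt.eqd.src (φ.eqd.dart e)) = f i.castSucc := by
        rw [← hi.1]
        exact hfβ _ _ ((φ.eqd.dart_src e).trans (ψ.eqd.dart_src e).symm)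
      have htgt : η.pt.β (η.pt.eqd.tgt (φ.eqd.dart e)) = f i.succ := by
        rw [← hi.2]
        exact hfβ _ _ ((φ.eqd.dart_tgt e).trans (ψ.eqd.dart_tgt e).symm)
      have h3 := η.pt.slope_spec (φ.eqd.dart e)
      rw [hsrc, htgt, hlam', ← hl'] at h3
      have h4 := congrArg (gpMap φ.base) h3
      rw [map_zsmul, gpMap_toGp, gpMap_toGp, hφlam, hφl, ← h2] at h4
      rw [zsmul_toGp_injective ζ.base h0 h4, h3]
  · intro g hg i
    -- Lengths fix positions only up to translation; the first leg fixes the translation.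
    have h0 : η.pt.line.pos (f (C.β (C.sub.vtx (C.curve.leg 0)))) = 0 := by
      rw [← hfβ _ (η.pt.sub.vtx (η.pt.curve.leg 0)), ← η.pt.normalized]
      · exact η.pt.isLift.1 _
      · have h1 := ψ.map_vtx (C.curve.leg 0)
        have h2 := ψ.con.vtx_leg 0
        change ψ.con.vtx (C.curve.leg 0) = _ at h2
        rw [φ.map_vtx, φ.con.vtx_leg, ← h2]
        exact h1.symm
    have h1 : ∀ i, gpMap g (toGp (Fin.partialSum lam i)) =
        η.pt.line.pos (f i) - η.pt.line.pos (f 0) := by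
      intro i
      induction i using Fin.induction with
      | zero => rw [Fin.partialSum_zero, map_zero, map_zero, sub_self]
      | succ i ih =>
        rw [Fin.partialSum_succ, map_add, map_add, ih, gpMap_toGp, hg, ← hlam']
        abel
    refine ⟨f i, ?_⟩
    rw [posOf, map_sub, h1, h1, h0]
    abel

/-- Two lifts of a morphism out of `C.retype` agree up to the base homomorphism, and the base
homomorphisms agree on the lengths. -/
lemma lift_unique {ψ : RubHom ⟨P, C.retype h hlam hl⟩ ζ} {φ : RubHom η ζ}
    (hφ : ∀ m, φ.base m = 0 → m = 0) {χ χ' : (⟨P, C.retype h hlam hl⟩ : Rub n) ⟶ η}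
    (hχ : χ ≫ (show η ⟶ ζ from φ) = ψ) (hχ' : χ' ≫ (show η ⟶ ζ from φ) = ψ) :
    (∀ i, RubHom.base χ (lam i) = RubHom.base χ' (lam i)) ∧
      (∀ d, RubHom.base χ (l d) = RubHom.base χ' (l d)) ∧
      (∀ v, (RubHom.con χ).vtx v = (RubHom.con χ').vtx v) ∧
      (∀ e, (RubHom.con χ).dart e = (RubHom.con χ').dart e) ∧
      (∀ v, (RubHom.eqd χ).vtx v = (RubHom.eqd χ').vtx v) ∧
      (∀ e, (RubHom.eqd χ).dart e = (RubHom.eqd χ').dart e) := by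
  have hbase : ∀ {χ : (⟨P, C.retype h hlam hl⟩ : Rub n) ⟶ η}, χ ≫ (show η ⟶ ζ from φ) = ψ →
      ∀ m, φ.base (RubHom.base χ m) = ψ.base m := by
    rintro χ rfl m
    rfl
  have hdart : ∀ {χ : (⟨P, C.retype h hlam hl⟩ : Rub n) ⟶ η}, χ ≫ (show η ⟶ ζ from φ) = ψ →
      ∀ e, (RubHom.eqd χ).dart (φ.eqd.dart e) = ψ.eqd.dart e := by
    rintro χ rfl m
    rfl
  have hpos : ∀ {χ : (⟨P, C.retype h hlam hl⟩ : Rub n) ⟶ η}, χ ≫ (show η ⟶ ζ from φ) = ψ →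
      ∀ i, ∃ j, gpMap (RubHom.base χ) (C.posOf lam i) = η.pt.line.pos j ∧
        gpMap φ.base (η.pt.line.pos j) = gpMap ψ.base (C.posOf lam i) := by
    rintro χ rfl i
    have h1 : gpMap (RubHom.base χ) (C.posOf lam i) ∈ Set.range η.pt.line.pos := by
      rw [RubHom.map_line χ]
      exact ⟨_, ⟨i, rfl⟩, rfl⟩
    obtain ⟨j, hj⟩ := h1
    exact ⟨j, hj.symm, by rw [hj]; exact (gpMap_comp _ _ _).symm⟩
  have hpos' : ∀ i, gpMap (RubHom.base χ) (C.posOf lam i) =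
      gpMap (RubHom.base χ') (C.posOf lam i) := by
    intro i
    obtain ⟨j, h1, h2⟩ := hpos hχ i
    obtain ⟨j', h1', h2'⟩ := hpos hχ' i
    rw [h1, h1', η.pt.line.pos_injective_of_local φ.base hφ (h2.trans h2'.symm)]
  refine ⟨fun i => ?_, fun d => ?_, fun v => φ.con.vtx_injective hφ ?_, fun e => ?_,
    fun v => φ.eqd.vtx_injective hφ ?_, fun e => ?_⟩
  · apply toGp_injective
    rw [← gpMap_toGp, ← gpMap_toGp, ← posOf_succ, map_sub, map_sub, hpos', hpos']
  · by_cases h0 : ψ.base (l d) = 0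
    · rw [hφ (RubHom.base χ (l d)) (by rw [hbase hχ, h0]),
        hφ (RubHom.base χ' (l d)) (by rw [hbase hχ', h0])]
    · obtain ⟨e, he⟩ := (ψ.eqd.dart_range d).2 h0
      have h1 := (RubHom.eqd χ).dart_len (φ.eqd.dart e)
      have h2 := (RubHom.eqd χ').dart_len (φ.eqd.dart e)
      rw [hdart hχ, he] at h1
      rw [hdart hχ', he] at h2
      exact h1.symm.trans h2
  · exact (congrArg (fun t : RubHom _ ζ => t.con.vtx v) hχ).trans
      (congrArg (fun t : RubHom _ ζ => t.con.vtx v) hχ').symm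
  · obtain ⟨e, rfl⟩ := φ.con.dart_surjective hφ e
    exact (congrArg (fun t : RubHom _ ζ => t.con.dart e) hχ).trans
      (congrArg (fun t : RubHom _ ζ => t.con.dart e) hχ').symm
  · exact (congrArg (fun t : RubHom _ ζ => t.eqd.vtx v) hχ).trans
      (congrArg (fun t : RubHom _ ζ => t.eqd.vtx v) hχ').symm
  · obtain ⟨e, rfl⟩ := φ.eqd.dart_surjective hφ e
    exact (hdart hχ e).trans (hdart hχ' e).symm

end RubPt

/-- Keep the combinatorics of `ξ` and replace its lengths by universal ones, split at `p` if `p` is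
interior to an edge. Locality of the arrow to `ξ` holds because all lengths of `ξ` are non-zero.
Lifts exist by the universal property, and are unique because homomorphisms out of `Q` are
determined on lengths. -/
theorem univRub_exists_minimal (n : ℕ) [NeZero n] (ξ : UnivRub n) :
    ∃ (d : UnivRub n) (φ : d ⟶ ξ), IsMinimal (UnivRub.proj n) d ∧
      (dualCone ((UnivRub.proj n).obj d)).IsSimplicial ∧ IsLocal ((UnivRub.proj n).map φ) := by
  classical
  obtain ⟨⟨M, C⟩, p⟩ := ξ
  have := C.eqd.finD
  have := Fintype.ofFinite C.eqd.D
  have hself := (C.isLengthSystem_iff _ _).2 C.isLengths_self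
  have hself_ne : ∀ x, Sum.elim C.line.len C.eqd.len x ≠ 0 := by
    rintro (i | d)
    · exact C.line.len_ne i
    · exact C.eqd.len_ne d
  have hsum : ∀ {Q : FSMon} (l₀ : Fin C.line.k ⊕ C.eqd.D → Q),
      l₀ = Sum.elim (fun i => l₀ (.inl i)) fun d => l₀ (.inr d) := fun l₀ =>
    (Sum.elim_comp_inl_inr l₀).symm
  cases p with
  | vertex v =>
    obtain ⟨Q, l₀, hQ, hl₀, hne, hext, hex⟩ :=
      exists_universal_lengths C.cell C.weight_pos C.cell_surjective
    have h₀ : C.IsLengths (fun i => l₀ (.inl i)) fun d => l₀ (.inr d) :=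
      (C.isLengthSystem_iff _ _).1 (by rwa [← hsum])
    obtain ⟨g, hg, hgloc⟩ := hex M _ hself
    obtain ⟨φ, hφ, hφv, hφd⟩ := C.exists_hom_of_retype h₀ (fun i => hne _) (fun d => hne _) g
      (fun i => hg (.inl i)) (fun d => hg (.inr d)) (hgloc hself_ne)
    let d₀ : UnivRub n :=
      ⟨⟨Q, C.retype h₀ (fun i => hne _) (fun d => hne _)⟩, .vertex v⟩
    refine ⟨d₀, ⟨φ, ?_⟩, ?_, hQ, ?_⟩
    · refine Point.mapsTo_vertex_iff.2 ?_
      rw [hφv]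
    · intro ζ η ψ θ hθ
      obtain ⟨lam', l', h', h1, h2, h3, h4⟩ := RubPt.exists_lift_lengths ψ.1 θ.1 hθ
      obtain ⟨k, hk, _⟩ := hex _ _ ((C.isLengthSystem_iff _ _).2 h')
      have hbase : ∀ m, RubHom.base ψ.1 m = RubHom.base θ.1 (k m) := by
        refine DFunLike.congr_fun (hext ζ.rub.base (RubHom.base ψ.1)
          ((RubHom.base θ.1).comp k) ?_)
        rintro (i | d)
        · exact (h1 i).symm.trans (congrArg (RubHom.base θ.1) (hk (.inl i)).symm)
        · exact (h2 d).symm.trans (congrArg (RubHom.base θ.1) (hk (.inr d)).symm)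
      obtain ⟨χ, rfl, hcv, hcd, hev, hed⟩ := RubHom.exists_lift θ.1 ψ.1 hθ k hbase
        (fun e => (h3 e).trans (hk (.inr _)).symm) (h4 k fun i => hk (.inl i))
      refine ⟨⟨χ, Point.MapsTo.lift_vertex hθ hev ψ.2 θ.2⟩,
        Subtype.ext (RubHom.hom_ext (fun m => (hbase m).symm) hcv hcd hev hed), ?_⟩
      intro χ' hχ'
      have hχ : (show d₀.rub ⟶ η.rub from χ) ≫ θ.1 = ψ.1 :=
        RubHom.hom_ext (fun m => (hbase m).symm) hcv hcd hev hed
      obtain ⟨u1, u2, u3, u4, u5, u6⟩ := RubPt.lift_unique hθ (congrArg Subtype.val hχ') hχ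
      refine Subtype.ext (RubHom.hom_ext (DFunLike.congr_fun (hext _ _ _ ?_)) u3 u4 u5 u6)
      rintro (i | d)
      · exact u1 i
      · exact u2 d
    · change IsLocal φ.base
      rw [hφ]
      exact hgloc hself_ne
  | edge z a b ha hb hab =>
    obtain ⟨Q, l₀, a₀, b₀, hQ, hl₀, hne, ha₀, hb₀, hab₀, hext, hex⟩ :=
      exists_universal_lengths_split C.cell C.weight_pos C.cell_surjective (.inr z)
    have h₀ : C.IsLengths (fun i => l₀ (.inl i)) fun d => l₀ (.inr d) :=
      (C.isLengthSystem_iff _ _).1 (by rwa [← hsum])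
    obtain ⟨g, hg, hga, hgb, hgloc⟩ := hex M _ a b hself hab
    obtain ⟨φ, hφ, hφv, hφd⟩ := C.exists_hom_of_retype h₀ (fun i => hne _) (fun d => hne _) g
      (fun i => hg (.inl i)) (fun d => hg (.inr d)) (hgloc hself_ne ha hb)
    let d₀ : UnivRub n :=
      ⟨⟨Q, C.retype h₀ (fun i => hne _) (fun d => hne _)⟩, .edge z a₀ b₀ ha₀ hb₀ hab₀⟩
    refine ⟨d₀, ⟨φ, ?_⟩, ?_, hQ, ?_⟩
    · refine Point.mapsTo_edge_edge_iff.2 (.inl ⟨hφd z, ?_, ?_⟩)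
      · rw [hφ, hga]
      · rw [hφ, hgb]
    · intro ζ η ψ θ hθ
      obtain ⟨lam', l', h', h1, h2, h3, h4⟩ := RubPt.exists_lift_lengths ψ.1 θ.1 hθ
      -- The parts of the edge `z` prescribed by the point of `η`; they may be zero, which the
      -- universal property permits.
      obtain ⟨a', b', hab', ha', hb', hiff⟩ := Point.MapsTo.exists_split hθ ψ.2 θ.2 (l' z) (h2 z)
        (by rintro e he; rw [h3, he])
      obtain ⟨k, hk, hka, hkb, _⟩ := hex _ _ a' b' ((C.isLengthSystem_iff _ _).2 h') hab'
      have hbase : ∀ m, RubHom.base ψ.1 m = RubHom.base θ.1 (k m) := by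
        refine DFunLike.congr_fun (hext ζ.rub.base (RubHom.base ψ.1)
          ((RubHom.base θ.1).comp k) ?_ ?_ ?_)
        · rintro (i | d)
          · exact (h1 i).symm.trans (congrArg (RubHom.base θ.1) (hk (.inl i)).symm)
          · exact (h2 d).symm.trans (congrArg (RubHom.base θ.1) (hk (.inr d)).symm)
        · exact ha'.symm.trans (congrArg (RubHom.base θ.1) hka.symm)
        · exact hb'.symm.trans (congrArg (RubHom.base θ.1) hkb.symm)
      obtain ⟨χ, rfl, hcv, hcd, hev, hed⟩ := RubHom.exists_lift θ.1 ψ.1 hθ k hbase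
        (fun e => (h3 e).trans (hk (.inr _)).symm) (h4 k fun i => hk (.inl i))
      have hχ : (show d₀.rub ⟶ η.rub from χ) ≫ θ.1 = ψ.1 :=
        RubHom.hom_ext (fun m => (hbase m).symm) hcv hcd hev hed
      refine ⟨⟨χ, (hiff χ.base χ.eqd hev hed hbase (hk (.inr z))).2 ⟨hka, hkb⟩⟩,
        Subtype.ext hχ, ?_⟩
      intro χ' hχ'
      have hχ'' : χ'.1 ≫ θ.1 = ψ.1 := congrArg Subtype.val hχ'
      obtain ⟨u1, u2, u3, u4, u5, u6⟩ := RubPt.lift_unique hθ hχ'' hχ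
      have hpt := (hiff (RubHom.base χ'.1) (RubHom.eqd χ'.1)
        (fun v => congrArg (fun t : RubHom _ ζ.rub => t.eqd.vtx v) hχ'')
        (fun e => congrArg (fun t : RubHom _ ζ.rub => t.eqd.dart e) hχ'')
        (fun m => (DFunLike.congr_fun (congrArg RubHom.base hχ'') m).symm)
        ((u2 z).trans (hk (.inr z)))).1 χ'.2
      refine Subtype.ext (RubHom.hom_ext (DFunLike.congr_fun (hext _ _ _ ?_ ?_ ?_)) u3 u4 u5 u6)
      · rintro (i | d)
        · exact u1 i
        · exact u2 d
      · exact hpt.1.trans hka.symm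
      · exact hpt.2.trans hkb.symm
    · change IsLocal φ.base
      rw [hφ]
      exact hgloc hself_ne ha hb

theorem univRub_representable (n : ℕ) [NeZero n] :
    ∃ S : ConeStack, S.IsSimplicial ∧ S.Represents (UnivRub.proj n) :=
  exists_simplicial_coneStack_represents (univRub_allCocartesian n) (univRub_hasPushforwards n)
    (univRub_exists_minimal n)

/-! ### The curve with an additional leg -/

section GpLE

variable {M : Type} [AddCommMonoid M]

lemma GpLE.refl (x : Gp M) : GpLE x x := ⟨0, by rw [sub_self, map_zero]⟩

lemma GpLE.trans {x y z : Gp M} (h : GpLE x y) (h' : GpLE y z) : GpLE x z := by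
  obtain ⟨a, ha⟩ := h
  obtain ⟨b, hb⟩ := h'
  exact ⟨a + b, by rw [map_add, ← ha, ← hb]; abel⟩

lemma TropLine.gpLE_pos {P : FSMon} (X : TropLine P) {i j : Fin (X.k + 1)} (h : i ≤ j) :
    GpLE (X.pos i) (X.pos j) :=
  let ⟨m, hm, _⟩ := X.exists_pos_sub h
  ⟨m, hm⟩

lemma gpLE_of_sub_eq_zsmul {x y : Gp M} {s : ℤ} {a : M} (hs : 0 ≤ s) (h : y - x = s • toGp a) :
    GpLE x y := by
  obtain ⟨k, rfl⟩ := Int.eq_ofNat_of_zero_le hs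
  exact ⟨k • a, by rw [h, map_nsmul, natCast_zsmul]⟩

lemma gpLE_of_sub_eq_zsmul_of_nonpos {x y : Gp M} {s : ℤ} {a : M} (hs : s ≤ 0)
    (h : y - x = s • toGp a) : GpLE y x :=
  gpLE_of_sub_eq_zsmul (s := -s) (a := a) (by omega) (by rw [neg_smul, ← h, neg_sub])

end GpLE

/-- Values at vertices of the model are positions on the line, hence comparable. A new vertex lies
on an edge whose ends have equal or neighbouring positions, so its value lies between these and no
position separates it from both. -/
theorem IsMarkedAt.ordered {M : FSMon} {n : ℕ} [NeZero n] {C : RubPt M n} {p : Point C.eqd}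
    {T : DivPt M (n + 1)} (h : IsMarkedAt C p T) (v w : T.curve.V) :
    GpLE (T.α v) (T.α w) ∨ GpLE (T.α w) (T.α v) := by
  obtain ⟨σ, hlift, hexc, hp⟩ := h
  have key : ∀ v, v ∉ Set.range σ.vtx → ∀ x, GpLE (T.α v) (T.α (σ.vtx x)) ∨
      GpLE (T.α (σ.vtx x)) (T.α v) := by
    intro v hv x
    obtain rfl := hexc v hv
    cases p with
    | vertex u => exact absurd ⟨u, hp⟩ hv
    | edge d a b ha hb hab =>
      obtain ⟨e, f, hef, he, hf, hleg⟩ := hp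
      obtain ⟨s, hs⟩ := C.exists_slope d
      have h1 : T.α (T.curve.tgt e) - T.α (T.curve.src e) = s • toGp (T.curve.len e) :=
        hlift.2 d s hs e (by rw [hef]; simp)
      have h2 : T.α (T.curve.tgt f) - T.α (T.curve.src f) = s • toGp (T.curve.len f) :=
        hlift.2 d s hs f (by rw [hef]; simp)
      have h3 : T.curve.src e = σ.vtx (C.eqd.src d) := σ.src_head hef
      have h4 : T.curve.tgt f = σ.vtx (C.eqd.tgt d) := σ.tgt_last (A := [e]) hef
      have h5 : T.curve.tgt e = T.curve.src f := σ.tgt_eq_src (A := []) hef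
      rw [hleg, h3, hlift.1] at h1
      rw [← h5, hleg, h4, hlift.1] at h2
      rw [hlift.1]
      have h6 := C.β_edge d
      have h7 := C.β_edge (C.eqd.rev d)
      rw [C.eqd.tgt_rev] at h7
      change _ ≤ (C.β (C.eqd.tgt d) : ℕ) + 1 at h7
      -- The sign of the slope tells which end is lower. A vertex of the line strictly above the
      -- lower end is at or above the upper one.
      rcases le_total 0 s with h0 | h0
      · rcases le_or_gt (C.β x) (C.β (C.eqd.src d)) with hle | hlt
        · exact .inr ((C.line.gpLE_pos hle).trans (gpLE_of_sub_eq_zsmul h0 h1))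
        · refine .inl ((gpLE_of_sub_eq_zsmul h0 h2).trans (C.line.gpLE_pos ?_))
          exact Fin.le_def.2 (by have := Fin.lt_def.1 hlt; omega)
      · rcases le_or_gt (C.β x) (C.β (C.eqd.tgt d)) with hle | hlt
        · exact .inr ((C.line.gpLE_pos hle).trans (gpLE_of_sub_eq_zsmul_of_nonpos h0 h2))
        · refine .inl ((gpLE_of_sub_eq_zsmul_of_nonpos h0 h1).trans (C.line.gpLE_pos ?_))
          exact Fin.le_def.2 (by have := Fin.lt_def.1 hlt; omega)
  by_cases hv : v ∈ Set.range σ.vtx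
  · obtain ⟨x, rfl⟩ := hv
    by_cases hw : w ∈ Set.range σ.vtx
    · obtain ⟨y, rfl⟩ := hw
      rw [hlift.1, hlift.1]
      exact (le_total (C.β x) (C.β y)).imp C.line.gpLE_pos C.line.gpLE_pos
    · exact (key w hw x).symm
  · by_cases hw : w ∈ Set.range σ.vtx
    · obtain ⟨y, rfl⟩ := hw
      exact key v hv y
    · rw [hexc v hv, hexc w hw]
      exact .inl (.refl _)

/-! ### Attaching a leg, and subdividing an edge at a point. -/

namespace TropCurve

variable {M : Type} [AddCommMonoid M] {n : ℕ}

/-- Attach a last leg at `x`. -/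
abbrev addLeg (Γ : TropCurve M n) (x : Γ.V) : TropCurve M (n + 1) where
  V := Γ.V
  D := Γ.D
  finV := Γ.finV
  finD := Γ.finD
  src := Γ.src
  rev := Γ.rev
  rev_rev := Γ.rev_rev
  rev_ne := Γ.rev_ne
  connected := Γ.connected
  leg := Fin.snoc (α := fun _ => Γ.V) Γ.leg x
  len := Γ.len
  len_rev := Γ.len_rev
  len_ne := Γ.len_ne

lemma isPath_addLeg (Γ : TropCurve M n) (x : Γ.V) {u w : Γ.V} {p : List Γ.D}
    (h : Γ.IsPath u p w) : (Γ.addLeg x).forgetLeg.IsPath u p w := by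
  induction p generalizing u with
  | nil => exact h
  | cons d p ih => exact ⟨h.1, ih h.2⟩

/-- The trivial subdivision. -/
def trivialSubdivision (Γ : TropCurve M n) : Subdivision Γ Γ where
  vtx v := v
  vtx_inj _ _ h := h
  path d := [d]
  path_isPath d := ⟨rfl, rfl⟩
  path_rev _ := rfl
  path_nodup _ := List.nodup_singleton _
  cover d := ⟨d, List.mem_singleton_self d, fun _ h => (List.mem_singleton.1 h).symm⟩
  interior _ _ h := by simp at h
  bivalent x hx := absurd ⟨x, rfl⟩ hx
  leg _ := rfl
  len_sum _ := by simp

end TropCurve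

/-- A subdivision remains one when a leg is attached and forgotten. -/
def Subdivision.addLeg {M : Type} [AddCommMonoid M] {n : ℕ} {Γ' Γ : TropCurve M n}
    (σ : Subdivision Γ' Γ) (x : Γ'.V) : Subdivision (Γ'.addLeg x).forgetLeg Γ where
  vtx := σ.vtx
  vtx_inj := σ.vtx_inj
  path := σ.path
  path_isPath d := Γ'.isPath_addLeg x (σ.path_isPath d)
  path_rev := σ.path_rev
  path_nodup := σ.path_nodup
  cover := σ.cover
  interior := σ.interior
  bivalent := σ.bivalent
  leg i := (σ.leg i).trans (Fin.snoc_castSucc (α := fun _ => Γ'.V) _ _ _).symm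
  len_sum := σ.len_sum

lemma exists_isMarkedAt_of_subdivision {M : FSMon} {n : ℕ} [NeZero n] {C : RubPt M n}
    {p : Point C.eqd} {Γ' : TropCurve M n} (σ : Subdivision Γ' C.eqd) (x : Γ'.V)
    (α : Γ'.V → Gp M) (hα : σ.IsLift (fun x => C.line.pos (C.β x)) α)
    (hexc : ∀ y, y ∉ Set.range σ.vtx → y = x)
    (hp : match p with
      | .vertex v => σ.vtx v = x
      | .edge d a b _ _ _ => ∃ e f, σ.path d = [e, f] ∧ Γ'.len e = a ∧ Γ'.len f = b ∧
        Γ'.tgt e = x) :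
    ∃ T : DivPt M (n + 1), IsMarkedAt C p T := by
  have hlast : (Γ'.addLeg x).leg (Fin.last n) = x := Fin.snoc_last (α := fun _ => Γ'.V) _ _
  refine ⟨{
    curve := Γ'.addLeg x
    α := α
    isPL := fun d' => by
      obtain ⟨d, hd, _⟩ := σ.cover d'
      obtain ⟨s, hs⟩ := C.exists_slope d
      exact ⟨s, hα.2 d s hs d' hd⟩
    normalized := by
      have h0 : (0 : Fin (n + 1)) = Fin.castSucc (0 : Fin n) := Fin.ext (by simp)
      have h1 : (Γ'.addLeg x).leg 0 = Γ'.leg 0 := by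
        rw [h0]
        exact Fin.snoc_castSucc (α := fun _ => Γ'.V) _ _ _
      rw [h1, ← σ.leg, hα.1, ← C.sub.leg]
      exact (C.isLift.1 _).trans C.normalized }, σ.addLeg x, hα, ?_, ?_⟩
  · intro y hy
    rw [hlast]
    exact hexc y hy
  · cases p with
    | vertex v => exact hp.trans hlast.symm
    | edge d a b ha hb hab =>
      obtain ⟨e, f, h1, h2, h3, h4⟩ := hp
      exact ⟨e, f, h1, h2, h3, h4.trans hlast.symm⟩

namespace TropCurve

variable {M : Type} [AddCommMonoid M] {n : ℕ} (Γ : TropCurve M n) (z : Γ.D) (a b : M)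

open Classical in
/-- The reversal on the subdivision of `Γ` at a point of `z`: the half edges are `inl z` and
`inr false` in the direction of `z`, and `inl (rev z)` and `inr true` in the other direction. -/
noncomputable def splitRev : Γ.D ⊕ Bool → Γ.D ⊕ Bool
  | .inl d => if d = z then .inr true else if d = Γ.rev z then .inr false else .inl (Γ.rev d)
  | .inr true => .inl z
  | .inr false => .inl (Γ.rev z)

open Classical in
/-- The lengths on the subdivision. -/
noncomputable def splitLen : Γ.D ⊕ Bool → M
  | .inl d => if d = z then a else if d = Γ.rev z then b else Γ.len d
  | .inr true => a
  | .inr false => b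

/-- The sources on the subdivision. -/
def splitSrc : Γ.D ⊕ Bool → Option Γ.V
  | .inl d => some (Γ.src d)
  | .inr _ => none

variable {Γ z}

@[simp] lemma splitRev_self : Γ.splitRev z (.inl z) = .inr true := by simp [splitRev]

@[simp] lemma splitRev_rev : Γ.splitRev z (.inl (Γ.rev z)) = .inr false := by
  simp [splitRev, Γ.rev_ne]

lemma splitRev_of_ne {d : Γ.D} (h : d ≠ z) (h' : d ≠ Γ.rev z) :
    Γ.splitRev z (.inl d) = .inl (Γ.rev d) := by simp [splitRev, h, h']

lemma rev_ne_of_ne {d : Γ.D} (h' : d ≠ Γ.rev z) : Γ.rev d ≠ z := fun h0 =>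
  h' (by rw [← h0, Γ.rev_rev])

lemma split_cases (d : Γ.D) : d = z ∨ d = Γ.rev z ∨ (d ≠ z ∧ d ≠ Γ.rev z) := by tauto

lemma splitRev_splitRev (d : Γ.D ⊕ Bool) : Γ.splitRev z (Γ.splitRev z d) = d := by
  rcases d with d | _ | _
  · rcases split_cases (z := z) d with rfl | rfl | ⟨h, h'⟩
    · rw [splitRev_self]; rfl
    · rw [splitRev_rev]; rfl
    · rw [splitRev_of_ne h h', splitRev_of_ne (rev_ne_of_ne h') (Γ.rev_injective.ne h),
        Γ.rev_rev]
  · exact splitRev_rev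
  · exact splitRev_self

variable (Γ z) in
/-- The subdivision of `Γ` at the point of `z` at distance `a` from the source and at distance `b`
from the target. -/
noncomputable abbrev split (ha : a ≠ 0) (hb : b ≠ 0) : TropCurve M n where
  V := Option Γ.V
  D := Γ.D ⊕ Bool
  finV := have := Γ.finV; inferInstance
  finD := have := Γ.finD; inferInstance
  src := Γ.splitSrc
  rev := Γ.splitRev z
  rev_rev := splitRev_splitRev
  rev_ne d := by
    rcases d with d | _ | _
    · rcases split_cases (z := z) d with rfl | rfl | ⟨h, h'⟩
      · simp
      · simp
      · rw [splitRev_of_ne h h']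
        exact fun h0 => Γ.rev_ne d (Sum.inl.inj h0)
    · simp [splitRev]
    · simp [splitRev]
  connected := by
    let r : Option Γ.V → Option Γ.V → Prop :=
      fun x y => ∃ d, Γ.splitSrc d = x ∧ Γ.splitSrc (Γ.splitRev z d) = y
    have h1 : Relation.ReflTransGen r (some (Γ.src z)) none :=
      .single ⟨.inl z, rfl, by rw [splitRev_self]; rfl⟩
    have h2 : Relation.ReflTransGen r none (some (Γ.src z)) := .single ⟨.inr true, rfl, rfl⟩
    have h3 : Relation.ReflTransGen r (some (Γ.tgt z)) none :=
      .single ⟨.inl (Γ.rev z), rfl, by rw [splitRev_rev]; rfl⟩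
    have h4 : Relation.ReflTransGen r none (some (Γ.tgt z)) := .single ⟨.inr false, rfl, rfl⟩
    have h5 : ∀ v w, Relation.ReflTransGen r (some v) (some w) := by
      intro v w
      refine (Γ.connected v w).lift' some ?_
      rintro _ _ ⟨d, rfl, rfl⟩
      rcases split_cases (z := z) d with rfl | rfl | ⟨h, h'⟩
      · exact h1.trans h4
      · have := h3.trans h2
        rw [Function.onFun, Γ.rev_rev]
        exact this
      · exact .single ⟨.inl d, rfl, by rw [splitRev_of_ne h h']; rfl⟩
    have h6 : ∀ x, Relation.ReflTransGen r x (some (Γ.src z)) ∧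
        Relation.ReflTransGen r (some (Γ.src z)) x := by
      rintro (_ | v)
      · exact ⟨h2, h1⟩
      · exact ⟨h5 _ _, h5 _ _⟩
    exact fun x y => (h6 x).1.trans (h6 y).2
  leg i := some (Γ.leg i)
  len := Γ.splitLen z a b
  len_rev d := by
    rcases d with d | _ | _
    · rcases split_cases (z := z) d with rfl | rfl | ⟨h, h'⟩
      · simp [splitLen]
      · simp [splitLen, Γ.rev_ne]
      · rw [splitRev_of_ne h h']
        simp [splitLen, h, h', rev_ne_of_ne h', Γ.rev_injective.ne h, Γ.len_rev]
    · simp [splitLen, splitRev, Γ.rev_ne]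
    · simp [splitLen, splitRev]
  len_ne d := by
    rcases d with d | _ | _
    · rcases split_cases (z := z) d with rfl | rfl | ⟨h, h'⟩
      · simpa [splitLen] using ha
      · simpa [splitLen, Γ.rev_ne] using hb
      · simpa [splitLen, h, h'] using Γ.len_ne d
    · exact hb
    · exact ha

open Classical in
variable (Γ z) in
/-- The path of an edge in the subdivision. -/
noncomputable def splitPath (d : Γ.D) : List (Γ.D ⊕ Bool) :=
  if d = z then [.inl z, .inr false] else if d = Γ.rev z then [.inl (Γ.rev z), .inr true]
    else [.inl d]

@[simp] lemma splitPath_self : Γ.splitPath z z = [.inl z, .inr false] := by simp [splitPath]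

@[simp] lemma splitPath_rev : Γ.splitPath z (Γ.rev z) = [.inl (Γ.rev z), .inr true] := by
  simp [splitPath, Γ.rev_ne]

lemma splitPath_of_ne {d : Γ.D} (h : d ≠ z) (h' : d ≠ Γ.rev z) : Γ.splitPath z d = [.inl d] := by
  simp [splitPath, h, h']

/-- The split curve is a subdivision. -/
noncomputable def splitSubdivision (ha : a ≠ 0) (hb : b ≠ 0) (hab : a + b = Γ.len z) :
    Subdivision (Γ.split z a b ha hb) Γ where
  vtx := some
  vtx_inj := Option.some_injective _
  path := Γ.splitPath z
  path_isPath d := by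
    rcases split_cases (z := z) d with rfl | rfl | ⟨h, h'⟩
    · rw [splitPath_self]
      refine ⟨rfl, ?_, rfl⟩
      change none = Γ.splitSrc (Γ.splitRev d (.inl d))
      rw [splitRev_self]
      rfl
    · rw [splitPath_rev, Γ.tgt_rev]
      refine ⟨rfl, ?_, rfl⟩
      change none = Γ.splitSrc (Γ.splitRev z (.inl (Γ.rev z)))
      rw [splitRev_rev]
      rfl
    · rw [splitPath_of_ne h h']
      refine ⟨rfl, ?_⟩
      change Γ.splitSrc (Γ.splitRev z (.inl d)) = _
      rw [splitRev_of_ne h h']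
      rfl
  path_rev d := by
    rcases split_cases (z := z) d with rfl | rfl | ⟨h, h'⟩
    · rw [splitPath_self, splitPath_rev]
      simp [splitRev]
    · rw [splitPath_rev, Γ.rev_rev, splitPath_self]
      simp [splitRev, Γ.rev_ne]
    · rw [splitPath_of_ne h h', splitPath_of_ne (rev_ne_of_ne h') (Γ.rev_injective.ne h)]
      simp [splitRev_of_ne h h']
  path_nodup d := by
    rcases split_cases (z := z) d with rfl | rfl | ⟨h, h'⟩
    · simp
    · simp
    · simp [splitPath_of_ne h h']
  cover d' := by
    have hmem : ∀ d, d' ∈ Γ.splitPath z d ↔ d' = .inl d ∨ (d' = .inr false ∧ d = z) ∨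
        (d' = .inr true ∧ d = Γ.rev z) := by
      intro d
      rcases split_cases (z := z) d with rfl | rfl | ⟨h, h'⟩
      · simp [(Γ.rev_ne d).symm]
      · simp [Γ.rev_ne]
      · simp [splitPath_of_ne h h', h, h']
    simp only [hmem]
    rcases d' with d | _ | _
    · exact ⟨d, by simp, by simp [eq_comm]⟩
    · exact ⟨z, by simp, by simp⟩
    · exact ⟨Γ.rev z, by simp, by simp⟩
  interior d d' hd' := by
    rcases split_cases (z := z) d with rfl | rfl | ⟨h, h'⟩
    · rw [splitPath_self] at hd'
      obtain rfl : d' = .inr false := by simpa using hd'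
      rintro ⟨v, hv⟩
      cases hv
    · rw [splitPath_rev] at hd'
      obtain rfl : d' = .inr true := by simpa using hd'
      rintro ⟨v, hv⟩
      cases hv
    · rw [splitPath_of_ne h h'] at hd'
      simp at hd'
  bivalent x hx := by
    rcases x with _ | v
    · have : {d' : Γ.D ⊕ Bool | Γ.splitSrc d' = none} = {.inr true, .inr false} := by
        ext d'
        rcases d' with d | _ | _ <;> simp [splitSrc]
      change Set.ncard {d' : Γ.D ⊕ Bool | Γ.splitSrc d' = none} = 2
      rw [this, Set.ncard_pair (by simp)]
    · exact absurd ⟨v, rfl⟩ hx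
  leg _ := rfl
  len_sum d := by
    rcases split_cases (z := z) d with rfl | rfl | ⟨h, h'⟩
    · simp [splitLen, hab]
    · simp [splitLen, Γ.rev_ne, add_comm b, hab, Γ.len_rev]
    · simp [splitPath_of_ne h h', splitLen, h, h']

end TropCurve

theorem exists_isMarkedAt {M : FSMon} {n : ℕ} [NeZero n] (C : RubPt M n) (p : Point C.eqd) :
    ∃ T : DivPt M (n + 1), IsMarkedAt C p T := by
  cases p with
  | vertex v =>
    refine exists_isMarkedAt_of_subdivision C.eqd.trivialSubdivision v
      (fun x => C.line.pos (C.β x)) ⟨fun _ => rfl, fun d s hs d' hd' => ?_⟩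
      (fun y hy => absurd ⟨y, rfl⟩ hy) rfl
    obtain rfl : d' = d := List.mem_singleton.1 hd'
    exact hs
  | edge z a b ha hb hab =>
    have hspec := C.slope_spec z
    have hsum : C.slope z • (toGp (C.eqd.len z) : Gp M) =
        C.slope z • toGp a + C.slope z • toGp b := by rw [← hab, map_add, smul_add]
    -- The slope of the edge and the distance `a` from its source force the value at the new vertex.
    let α : Option C.eqd.V → Gp M := fun o => o.elim
      (C.line.pos (C.β (C.eqd.src z)) + C.slope z • toGp a) fun x => C.line.pos (C.β x)
    refine exists_isMarkedAt_of_subdivision (TropCurve.splitSubdivision a b ha hb hab) none α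
      ⟨fun _ => rfl, fun d s hs d' hd' => ?_⟩ ?_ ?_
    · obtain rfl := C.slope_unique hs
      change α ((C.eqd).splitSrc (C.eqd.splitRev z d')) - α (C.eqd.splitSrc d') =
        _ • toGp (C.eqd.splitLen z a b d')
      change d' ∈ C.eqd.splitPath z d at hd'
      rcases TropCurve.split_cases (z := z) d with rfl | rfl | ⟨h, h'⟩
      · rw [TropCurve.splitPath_self] at hd'
        simp only [List.mem_cons, List.not_mem_nil, or_false] at hd'
        rcases hd' with rfl | rfl
        · rw [TropCurve.splitRev_self]
          simp [α, TropCurve.splitSrc, TropCurve.splitLen]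
        · change C.line.pos (C.β (C.eqd.tgt d)) -
            (C.line.pos (C.β (C.eqd.src d)) + C.slope d • toGp a) = C.slope d • toGp b
          rw [sub_add_eq_sub_sub, hspec, hsum, add_sub_cancel_left]
      · rw [TropCurve.splitPath_rev] at hd'
        simp only [List.mem_cons, List.not_mem_nil, or_false] at hd'
        rw [C.slope_rev]
        rcases hd' with rfl | rfl
        · rw [TropCurve.splitRev_rev]
          have hlen : C.eqd.splitLen z a b (.inl (C.eqd.rev z)) = b := by
            simp [TropCurve.splitLen, C.eqd.rev_ne]
          rw [hlen]
          change (C.line.pos (C.β (C.eqd.src z)) + C.slope z • toGp a) -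
            C.line.pos (C.β (C.eqd.tgt z)) = _
          rw [sub_eq_iff_eq_add] at hspec
          rw [hspec, hsum, neg_smul]
          abel
        · change C.line.pos (C.β (C.eqd.src z)) -
            (C.line.pos (C.β (C.eqd.src z)) + C.slope z • toGp a) = -C.slope z • toGp a
          rw [neg_smul]
          abel
      · rw [TropCurve.splitPath_of_ne h h'] at hd'
        obtain rfl := List.mem_singleton.1 hd'
        rw [TropCurve.splitRev_of_ne h h']
        have hlen : C.eqd.splitLen z a b (.inl d) = C.eqd.len d := by
          simp [TropCurve.splitLen, h, h']
        rw [hlen]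
        exact C.slope_spec d
    · rintro (_ | y) hy
      · rfl
      · exact absurd ⟨y, rfl⟩ hy
    · refine ⟨.inl z, .inr false, TropCurve.splitPath_self, ?_, rfl, ?_⟩
      · change C.eqd.splitLen z a b (.inl z) = a
        simp [TropCurve.splitLen]
      · change C.eqd.splitSrc (C.eqd.splitRev z (.inl z)) = none
        rw [TropCurve.splitRev_self]
        rfl

/-! ### A marked curve that does not come from a tropical line -/

/-- The monoid of natural numbers. -/
abbrev natMon : FSMon where
  carrier := ℕ
  sharp a b h := by omega
  fg := inferInstance
  integral := inferInstance
  saturated k x hk := by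
    rintro ⟨m, hm⟩
    obtain ⟨a, b, rfl⟩ := exists_toGp_sub x
    have h : k * a = m + k * b := by
      refine Algebra.GrothendieckAddGroup.of_injective (M := ℕ) ?_
      rw [smul_sub, sub_eq_iff_eq_add, ← map_nsmul, ← map_nsmul, ← map_add] at hm
      simpa using hm
    have hba : b ≤ a := Nat.le_of_mul_le_mul_left (by omega : k * b ≤ k * a) hk
    obtain ⟨c, rfl⟩ := Nat.exists_eq_add_of_le hba
    exact ⟨c, by rw [map_add, add_sub_cancel_left]⟩

/-- One is not a sum of two non-zero natural numbers, so such an edge cannot be cut. -/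
lemma Subdivision.exists_path_eq_singleton {n : ℕ} {Γ' Γ : TropCurve natMon n}
    (σ : Subdivision Γ' Γ) {d : Γ.D} (hd : Γ.len d = (1 : ℕ)) :
    ∃ e, σ.path d = [e] ∧ Γ'.len e = (1 : ℕ) := by
  have hsum := σ.len_sum d
  have hne := σ.path_ne_nil d
  match hp : σ.path d with
  | [] => exact absurd hp hne
  | [e] =>
    rw [hp, List.map_singleton, List.sum_singleton, hd] at hsum
    exact ⟨e, rfl, hsum⟩
  | e :: f :: l =>
    rw [hp, hd, List.map_cons, List.map_cons, List.sum_cons, List.sum_cons] at hsum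
    have key : ∀ x y z : ℕ, x ≠ 0 → y ≠ 0 → x + (y + z) ≠ 1 := fun x y z hx hy => by omega
    exact absurd hsum (key _ _ _ (Γ'.len_ne e) (Γ'.len_ne f))

lemma natMon_gpLE {a b : ℕ} (h : a ≤ b) :
    GpLE (toGp (M := natMon) a) (toGp (M := natMon) b) :=
  ⟨(b - a : ℕ), by
    rw [sub_eq_iff_eq_add, ← map_add]
    exact congrArg toGp (Nat.sub_add_cancel h).symm⟩

/-- Over `ℕ`, an edge of length one of the curve of a stable map to a tropical line has no values
of the piecewise linear function strictly between those at its endpoints. -/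
lemma RubPt.no_value_between {n : ℕ} [NeZero n] (R : RubPt natMon n) {d : R.curve.D}
    (hd : R.curve.len d = (1 : ℕ)) {v : R.curve.V} {a b c : ℕ} (hab : a < b) (hbc : b < c)
    (hsrc : R.α (R.curve.src d) = toGp (M := natMon) a) (hv : R.α v = toGp (M := natMon) b)
    (htgt : R.α (R.curve.tgt d) = toGp (M := natMon) c) : False := by
  obtain ⟨e, he, -⟩ := R.sub.exists_path_eq_singleton hd
  have h1 : R.line.pos (R.β (R.eqd.src e)) = toGp (M := natMon) a := by
    rw [R.sub.src_head he, ← hsrc]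
    exact R.isLift.1 _
  have h2 : R.line.pos (R.β (R.eqd.tgt e)) = toGp (M := natMon) c := by
    rw [R.sub.tgt_last (A := []) he, ← htgt]
    exact R.isLift.1 _
  have h3 : R.line.pos (R.β (R.sub.vtx v)) = toGp (M := natMon) b := by
    rw [← hv]
    exact R.isLift.1 _
  have key : ∀ {i j : Fin (R.line.k + 1)} {x y : ℕ}, x < y →
      R.line.pos i = toGp (M := natMon) x → R.line.pos j = toGp (M := natMon) y → i < j := by
    intro i j x y hxy hi hj
    refine lt_of_le_of_ne (R.line.le_of_gpLE ?_) ?_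
    · rw [hi, hj]
      exact natMon_gpLE hxy.le
    · rintro rfl
      exact hxy.ne (toGp_injective natMon (hi.symm.trans hj))
  -- The vertex of the line at value `b` lies strictly between the ends of `e`, so `β` would jump by
  -- at least two along `e`.
  have h4 := Fin.lt_def.1 (key hab h1 h3)
  have h5 := Fin.lt_def.1 (key hbc h3 h2)
  have h6 := R.β_edge e
  omega

/-- Two edges of lengths two and one, labelled by `true` and `false`, between the same vertices.
An oriented edge is given by its label and its source. -/
abbrev bananaCurve (n : ℕ) : TropCurve natMon n where
  V := Bool
  D := Bool × Bool
  src d := d.2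
  rev d := (d.1, !d.2)
  rev_rev d := by simp
  rev_ne d h := by simpa using congrArg Prod.snd h
  connected v w := by
    by_cases h : v = w
    · exact h ▸ .refl
    · exact .single ⟨(true, v), rfl, by revert v w; decide⟩
  leg _ := false
  len d := bif d.1 then (2 : ℕ) else (1 : ℕ)
  len_rev _ := rfl
  len_ne d := by
    obtain ⟨_ | _, _⟩ := d
    · exact one_ne_zero (α := ℕ)
    · exact two_ne_zero (α := ℕ)

/-- The segment from `0` to `2`. -/
abbrev segment : TropLine natMon where
  k := 1
  pos := ![0, toGp (M := natMon) (2 : ℕ)]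
  len _ := (2 : ℕ)
  len_ne _ := two_ne_zero (α := ℕ)
  pos_succ i := by
    obtain rfl : i = 0 := Subsingleton.elim _ _
    exact sub_zero _

/-- The slope of the function on `bananaCurve` with values `0` and `2`. -/
lemma bananaCurve_slope (d : Bool × Bool) :
    ∃ s : ℤ, (bif !d.2 then toGp (M := natMon) (2 : ℕ) else 0) -
      (bif d.2 then toGp (M := natMon) (2 : ℕ) else 0) =
        s • toGp (M := natMon) (bif d.1 then (2 : ℕ) else (1 : ℕ)) := by
  have h : toGp (M := natMon) (2 : ℕ) = (2 : ℤ) • toGp (M := natMon) (1 : ℕ) := by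
    rw [two_zsmul, ← map_add]
  obtain ⟨_ | _, _ | _⟩ := d
  · exact ⟨2, by simp [h]⟩
  · exact ⟨-2, by simp [h]⟩
  · exact ⟨1, by simp⟩
  · exact ⟨-1, by simp⟩

/-- The function on `bananaCurve` with values `0` and `2`, as a map to `segment`. -/
abbrev bananaRub (n : ℕ) [NeZero n] : RubPt natMon n where
  curve := bananaCurve n
  α v := bif v then toGp (M := natMon) (2 : ℕ) else 0
  isPL := bananaCurve_slope
  normalized := rfl
  eqd := bananaCurve n
  sub := (bananaCurve n).trivialSubdivision
  line := segment
  β v := bif v then 1 else 0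
  β_edge d := by obtain ⟨_, _ | _⟩ := d <;> simp [TropCurve.tgt]
  isLift := by
    have h : ∀ v : Bool, segment.pos (bif v then 1 else 0) =
        bif v then toGp (M := natMon) (2 : ℕ) else 0 := by
      rintro (_ | _) <;> rfl
    refine ⟨h, fun d s hs d' hd' => ?_⟩
    obtain rfl : d' = d := List.mem_singleton.1 hd'
    refine Eq.trans ?_ hs
    exact congrArg₂ (· - ·) (h _) (h _)
  stable_line i := by
    fin_cases i
    · exact ⟨false, rfl⟩
    · exact ⟨true, rfl⟩
  stable_edge _ _ := rfl

/-- `bananaRub` with the middle of the edge of length two. -/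
abbrev bananaUniv (n : ℕ) [NeZero n] : UnivRub n where
  rub := ⟨natMon, bananaRub n⟩
  point := .edge ((true, false) : Bool × Bool) (1 : ℕ) (1 : ℕ) (one_ne_zero (α := ℕ))
    (one_ne_zero (α := ℕ)) rfl

/-- The midpoint of the edge of length two has value 1, strictly between the values 0 and 2 at the
ends of the edge of length one. A map to a line would have to cut that edge into halves, which do
not exist over `ℕ`. -/
theorem not_factors (n : ℕ) [NeZero n] : ∃ (C : UnivRub n) (T : DivPt C.rub.base (n + 1)),
    IsMarkedAt C.rub.pt C.point T ∧ ¬ ∃ R : RubPt C.rub.base (n + 1),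
      Nonempty (DivHom (AddMonoidHom.id C.rub.base) R.toDivPt T) := by
  obtain ⟨T, hT⟩ := exists_isMarkedAt (bananaUniv n).rub.pt (bananaUniv n).point
  refine ⟨bananaUniv n, T, hT, ?_⟩
  rintro ⟨R, ⟨c⟩⟩
  obtain ⟨σ, hlift, -, e, f, hef, he, hf, -⟩ := hT
  have hα : ∀ v, T.α (c.vtx v) = R.α v := fun v => (c.map_α v).trans (gpMap_id _)
  have h2 : T.α (T.curve.tgt e) = toGp (M := natMon) (1 : ℕ) := by
    -- The long edge has slope 1, so the value at distance 1 from its lower end is 1.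
    have h := hlift.2 ((true, false) : Bool × Bool) 1
      (by simp [TropCurve.tgt]) e (by rw [hef]; simp)
    have hs : T.curve.src e = σ.vtx false := σ.src_head hef
    have h0 : T.α (σ.vtx false) = 0 := hlift.1 false
    change T.α (T.curve.tgt e) - T.α (T.curve.src e) = (1 : ℤ) • toGp (T.curve.len e) at h
    rw [hs, h0, sub_zero, he, one_smul] at h
    exact h
  obtain ⟨d, hd, hd1⟩ : ∃ d : T.curve.D, σ.path ((false, false) : Bool × Bool) = [d] ∧
    T.curve.len d = (1 : ℕ) := σ.exists_path_eq_singleton rfl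
  obtain ⟨v, hv⟩ := c.vtx_surj (T.curve.tgt e)
  have hlen : R.curve.len (c.dart d) = (1 : ℕ) := (c.dart_len d).symm.trans hd1
  refine R.no_value_between hlen (v := v) zero_lt_one one_lt_two ?_ ?_ ?_
  · refine (hα _).symm.trans ?_
    rw [c.dart_src]
    have hs : T.curve.src d = σ.vtx false := σ.src_head hd
    rw [hs]
    exact (hlift.1 false).trans (map_zero (toGp (M := natMon))).symm
  · rw [← hα, hv, h2]
  · refine (hα _).symm.trans ?_
    rw [c.dart_tgt]
    have hs : T.curve.tgt d = σ.vtx true := σ.tgt_last (A := []) hd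
    rw [hs]
    exact hlift.1 true

end TropRub

theorem mainTheorem12 (n : ℕ) [NeZero n] :
    -- the universal family over `Σ_Rub` is a simplicial cone stack
    (∃ S : TropRub.ConeStack, S.IsSimplicial ∧ S.Represents (TropRub.UnivRub.proj n)) ∧
    -- it maps to `Σ_Div` with `n + 1` legs, and this map factors through `Σ_Ord`
    (∀ C : TropRub.UnivRub n,
      (∃ T : TropRub.DivPt C.rub.base (n + 1), TropRub.IsMarkedAt C.rub.pt C.point T) ∧
      ∀ T : TropRub.DivPt C.rub.base (n + 1), TropRub.IsMarkedAt C.rub.pt C.point T →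
        ∃ o : TropRub.OrdPt C.rub.base (n + 1), o.toDivPt = T) ∧
    -- but it does not factor through `Σ_Rub`
    (∃ (C : TropRub.UnivRub n) (T : TropRub.DivPt C.rub.base (n + 1)),
      TropRub.IsMarkedAt C.rub.pt C.point T ∧
      ¬ ∃ R : TropRub.RubPt C.rub.base (n + 1),
        Nonempty (TropRub.DivHom (AddMonoidHom.id C.rub.base) R.toDivPt T)) :=
  ⟨TropRub.univRub_representable n, fun C => ⟨TropRub.exists_isMarkedAt C.rub.pt C.point,
    fun T hT => ⟨{ toDivPt := T, ordered := hT.ordered }, rfl⟩⟩, TropRub.not_factors n⟩
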